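/- **Setting.** Consider a conformal field theory in the vertex operator formulation: a complex vector space $V=\bigoplus_{(w_L,w_R)\in\mathbb{R}^2} V_{(w_L,w_R)}$ with $w_L-w_R\in\mathbb{Z}$, graded by the eigenvalues of $(L_0,\tilde L_0)$ for two commuting Virasoro algebras of equal central charge; vertex operators $Y(u,z,\bar z)=\sum_{(p,q)}u_{[p,q]}z^p\bar z^q$, linear in $u$, where $p-q\in\mathbb{Z}$, the operator $u_{[p,q]}$ raises weights by $(p+h_L,q+h_R)$ for $u\in V_{(h_L,h_R)}$, and for given $u,w\in V$ the set of $(p,q)$ with $u_{[p,q]}w\ne0$ is locally finite, with $Y(L_{-1}u)=\partial_zY(u)$ and $Y(\tilde L_{-1}u)=\partial_{\bar z}Y(u)$; and for all $u,v,w\in V$ and every functional $w'$ of finite weight a 4-point function $w'Z(u,v,z,\bar z,t,\bar t)w$, real-analytic for $z\neq0$, $t\ne0$, $z\neq t$, whose expansions for $|z|>|t|$, $|z|<|t|$, $|z-t|<|t|$ are $w'Y(u,z,\bar z)Y(v,t,\bar t)w$, $w'Y(v,t,\bar t)Y(u,z,\bar z)w$ and $w'Y(Y(u,z-t,\overline{z-t})v,t,\bar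 t)w$. Moreover $V$ is a graded subspace of an $\mathbb{R}^2$-graded space $W$ on which chiral operators (changing only the left weight) and antichiral operators (changing only the right weight) act and commute, with $Y(u,z,\bar z)=\sum_iY_i(u,z)\tilde Y_i(u,\bar z)$ for homogeneous $u$. **Hypotheses.** Let $u,v,w\in V$, with $u$ primary of weight $(1,1)$, and fix $t\ne0$. Suppose that, for finitely many labels $(\alpha,\beta)\in\mathbb{R}^2$ and finitely many indices $i$ for each, $$Zw=\sum_{\alpha,\beta}Z_{\alpha,\beta}w,\qquad Z_{\alpha,\beta}=\sum_iZ_{\alpha,\beta,i}(u,v,z,t)\,\tilde Z_{\alpha,\beta,i}(u,v,\bar z,\bar t),$$ where $Z_{\alpha,\beta,i}$ is chiral, $\tilde Z_{\alpha,\beta,i}$ is antichiral, and for every functional $w'$ on $W$ of finite weight the matrix elements of $w'Z_{\alpha,\beta,i}\,(z-t)^{-\alpha}z^{-\beta}$ (resp. of $w'\tilde Z_{\alpha,\beta,i}\,(\overline{z-t})^{-\alpha}\bar z^{-\beta}$) are meromorphic (resp. antimeromorphic) functions of $z$ on $\mathbb{CP}^1$ with poles at most at $0,t,\infty$. Here conjugate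 branches are used for the two chiralities, on the half-plane $\operatorname{Im}(z/t)>0$. Suppose that there are expansions $$Z_{\alpha,\beta,i}=Y_{\alpha,\beta,i}(v,t)Y_{\alpha,\beta,i}(u,z)\ (|z|<|t|),\quad Z_{\alpha,\beta,i}=Y'_{\alpha,\beta,i}(u,z)Y_{\alpha,\beta,i}(v,t)\ (|z|>|t|),$$ $$Z_{\alpha,\beta,i}=Y_{\alpha,\beta,i}(Y''_{\alpha,\beta,i}(u,z-t)v,t)\ (|z-t|<|t|),$$ $$Y_{\alpha,\beta,i}(u,z)=\sum_{k\in\beta+\mathbb{Z}}u_{-k}z^{k-1},\quad Y'_{\alpha,\beta,i}(u,z)=\sum_{k\in\alpha+\beta+\mathbb{Z}}u'_{-k}z^{k-1},\quad Y''_{\alpha,\beta,i}(u,z)=\sum_{k\in\alpha+\mathbb{Z}}u''_{-k}z^{k-1}$$ (modes with index $-k$ raise the left weight by $k$; the indices $\alpha,\beta,i$ of the modes are suppressed), and similarly for the $\tilde{\ }$'s, the chiral operators occurring here commuting with the antichiral ones. Let $\mathcal Y_{\alpha,\beta,i}$ be the vertex operator of the $(\alpha,\beta,i)$ summand: it is linear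 in the field, $\mathcal Y_{\alpha,\beta,i}(v)=Y_{\alpha,\beta,i}(v,t)\tilde Y_{\alpha,\beta,i}(v,\bar t)$, and $\mathcal Y_{\alpha,\beta,i}(u''_{-k}\tilde u''_{-l}v)=Y_{\alpha,\beta,i}(u''_{-k}v,t)\tilde Y_{\alpha,\beta,i}(\tilde u''_{-l}v,\bar t)$. Assume the zero modes vanish: $u_0w=0$, $u''_0v=0$, $u'_0Y_{\alpha,\beta,i}(v,t)w=0$ (a condition only if $\beta$, $\alpha$, $\alpha+\beta$ respectively is an integer), and similarly for the $\tilde{\ }$'s. Let $\omega_0,\omega_\infty,\omega_t$ be the primitives in $z$ of the three expansions obtained from $\int z^{k-1}dz=z^k/k$. Continue $\omega_\infty$ as a primitive of $Z_{\alpha,\beta,i}$ over the half-plane $\operatorname{Im}(z/t)>0$, and let $C_{\alpha,\beta,i}=\omega_\infty-\omega_t$ and $D_{\alpha,\beta,i}=\omega_\infty-\omega_0$ there (operators constant in $z$, considered on vectors satisfying the chiral zero mode conditions); define $\tilde C_{\alpha,\beta,i},\tilde D_{\alpha,\beta,i}$ analogously in $\bar z$ with the conjugate branches. Let $r,s,R>0$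 with $r+s<|t|$ and $|t|+s<R$, and let $\Sigma=\{z: r<|z|<R,\ |z-t|>s\}$. Put $$Y_{u,\alpha,\beta}(v,t,\bar t)=\frac i2\int_\Sigma Z_{\alpha,\beta}\,dz\,d\bar z$$ (that is, the integral with respect to Lebesgue measure), and let $Y_u(v,t,\bar t)=Y(v,t,\bar t)+\epsilon\,\frac i2\int_\Sigma Z\,dz\,d\bar z$ be the vertex operator deformed infinitesimally along $u$, with $\epsilon^2=0$. Put $$\phi_{\alpha,\beta,i}=\pi\sum_{k\in\beta+\mathbb{Z},\,k\ne0} r^{2k}\,\frac{u_{-k}\tilde u_{-k}}{k},\quad \phi'_{\alpha,\beta,i}=\pi\sum_{k\in\alpha+\beta+\mathbb{Z},\,k\ne0} R^{2k}\,\frac{u'_{-k}\tilde u'_{-k}}{k},\quad \phi''_{\alpha,\beta,i}=\pi\sum_{k\in\alpha+\mathbb{Z},\,k\ne0} s^{2k}\,\frac{u''_{-k}\tilde u''_{-k}}{k}.$$ **Theorem.** In the sense of matrix elements against all functionals of finite weight on $W$: the integrals defining $Y_{u,\alpha,\beta}(v,t,\bar t)w$ converge, and $$Y_u(v,t,\bar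 t)w=Y(v,t,\bar t)w+\epsilon\sum_{\alpha,\beta}Y_{u,\alpha,\beta}(v,t,\bar t)w;$$ the constants $C_{\alpha,\beta,i},D_{\alpha,\beta,i},\tilde C_{\alpha,\beta,i},\tilde D_{\alpha,\beta,i}$ exist; the sums over $k$ below converge; and $$Y_{u,\alpha,\beta}(v,t,\bar t)w=\sum_i\Big[\phi'_{\alpha,\beta,i}\mathcal Y_{\alpha,\beta,i}(v)w-\mathcal Y_{\alpha,\beta,i}(\phi''_{\alpha,\beta,i}v)w-\mathcal Y_{\alpha,\beta,i}(v)\phi_{\alpha,\beta,i}w$$ $$\qquad+\frac i2\Big(C_{\alpha,\beta,i}\tilde C_{\alpha,\beta,i}(-1+e^{-2\pi i\alpha})+D_{\alpha,\beta,i}\tilde D_{\alpha,\beta,i}(1-e^{2\pi i\beta})\Big)w\Big].$$ If $\alpha\in\mathbb{Z}$ and $\beta\notin\mathbb{Z}$, then $D_{\alpha,\beta,i}=\tilde D_{\alpha,\beta,i}=0$; if $\beta\in\mathbb{Z}$ and $\alpha\notin\mathbb{Z}$, then $C_{\alpha,\beta,i}=\tilde C_{\alpha,\beta,i}=0$. If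 $\alpha\in\mathbb{Z}$, or $\beta\in\mathbb{Z}$, or $\alpha+\beta\in\mathbb{Z}$ (in particular if $\alpha=0$, $\beta=0$ or $\alpha=-\beta$), then $$Y_{u,\alpha,\beta}(v,t,\bar t)w=\sum_i\Big[\phi'_{\alpha,\beta,i}\mathcal Y_{\alpha,\beta,i}(v)w-\mathcal Y_{\alpha,\beta,i}(\phi''_{\alpha,\beta,i}v)w-\mathcal Y_{\alpha,\beta,i}(v)\phi_{\alpha,\beta,i}w\Big].$$ Finally, whenever $\mathcal Y_{\alpha,\beta,i}$ agrees with the vertex operator $Y(\cdot,t,\bar t)$ on the fields that occur here (for the pairs field/vector $(v,w)$, $(\phi''_kv,w)$ and $(v,\phi_kw)$, where $\phi_k,\phi''_k$ are the individual terms of $\phi,\phi''$ without the powers of the radii, and $\phi''_kv,\phi_kw\in V$), the local expression for that $i$ equals $\phi'_{\alpha,\beta,i}Y(v,t,\bar t)w-Y(\phi''_{\alpha,\beta,i}v,t,\bar t)w-Y(v,t,\bar t)\phi_{\alpha,\beta,i}w$. -/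

import Mathlib

open Complex MeasureTheory Filter Topology ComplexConjugate

/-- A linear functional is of (finite) weight `h` if it vanishes on all weight spaces of weight
different from `h`. -/
def IsOfWeight {V : Type*} [AddCommGroup V] [Module ℂ V] (gr : ℝ × ℝ → Submodule ℂ V)
    (h : ℝ × ℝ) (f : Module.Dual ℂ V) : Prop :=
  ∀ k, k ≠ h → ∀ x ∈ gr k, f x = 0

/-- The monomial `z ^ p * (conj z) ^ q`; it is single-valued when `p - q` is an integer. -/
noncomputable def bimono (e : ℝ × ℝ) (z : ℂ) : ℂ :=
  z ^ (e.1 : ℂ) * conj (z ^ (e.2 : ℂ))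

/-- The matrix element `f Y(a, z, conj z) x` of the field whose modes are `mode a`; the sum has
finitely many nonzero terms when `f` is of finite weight. -/
noncomputable def matrixElement {V : Type*} [AddCommGroup V] [Module ℂ V]
    (mode : V →ₗ[ℂ] (ℝ × ℝ → Module.End ℂ V)) (f : Module.Dual ℂ V) (a x : V) (z : ℂ) : ℂ :=
  ∑ᶠ e : ℝ × ℝ, f (mode a e x) * bimono e z

/-- A conformal field theory in the vertex operator formulation, with state space `V`.
The chiral (left moving) and antichiral (right moving) constituents of the vertex operators act on
a bigraded space `W` containing `V`. -/
structure VertexCFT (V : Type*) (W : Type*) [AddCommGroup V] [Module ℂ V]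
    [AddCommGroup W] [Module ℂ W] where
  /-- the weight spaces `V_(wL, wR)` -/
  gr : ℝ × ℝ → Submodule ℂ V
  gr_internal : DirectSum.IsInternal gr
  gr_spin : ∀ h, gr h ≠ ⊥ → ∃ n : ℤ, h.1 - h.2 = n
  /-- `mode u (p, q)` is the coefficient of `z ^ p * (conj z) ^ q` in `Y(u, z, conj z)` -/
  mode : V →ₗ[ℂ] (ℝ × ℝ → Module.End ℂ V)
  mode_mem : ∀ h k e, ∀ u ∈ gr h, ∀ x ∈ gr k, mode u e x ∈ gr (k + (h + e))
  mode_spin : ∀ u e, mode u e ≠ 0 → ∃ n : ℤ, e.1 - e.2 = n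
  mode_discrete : ∀ (u x : V) (M : ℝ),
    {e : ℝ × ℝ | mode u e x ≠ 0 ∧ |e.1| ≤ M ∧ |e.2| ≤ M}.Finite
  /-- the two commuting Virasoro algebras, with the same central charge -/
  L : ℤ → Module.End ℂ V
  Lt : ℤ → Module.End ℂ V
  centralCharge : ℂ
  virasoro : ∀ m n : ℤ, L m * L n - L n * L m = ((m : ℂ) - n) • L (m + n) +
    (if m + n = 0 then centralCharge / 12 * ((m : ℂ) ^ 3 - m) else 0) • (1 : Module.End ℂ V)
  virasoro_t : ∀ m n : ℤ, Lt m * Lt n - Lt n * Lt m = ((m : ℂ) - n) • Lt (m + n) +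
    (if m + n = 0 then centralCharge / 12 * ((m : ℂ) ^ 3 - m) else 0) • (1 : Module.End ℂ V)
  virasoro_comm : ∀ m n : ℤ, Commute (L m) (Lt n)
  gr_eq : ∀ h x, x ∈ gr h ↔ L 0 x = (h.1 : ℂ) • x ∧ Lt 0 x = (h.2 : ℂ) • x
  /-- `Y(L_{-1} u) = ∂_z Y(u)`, coefficient by coefficient -/
  derivative : ∀ u e, mode (L (-1) u) e = ((e.1 + 1 : ℝ) : ℂ) • mode u (e.1 + 1, e.2)
  derivative_t : ∀ u e, mode (Lt (-1) u) e = ((e.2 + 1 : ℝ) : ℂ) • mode u (e.1, e.2 + 1)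
  /-- the 4-point function `f Z(u, v, z, conj z, t, conj t) w`, written `corr f u v w z t` -/
  corr : Module.Dual ℂ V → V → V → V → ℂ → ℂ → ℂ
  corr_analytic : ∀ h f u v w, IsOfWeight gr h f →
    AnalyticOnNhd ℝ (fun p : ℂ × ℂ => corr f u v w p.1 p.2)
      {p | p.1 ≠ 0 ∧ p.2 ≠ 0 ∧ p.1 ≠ p.2}
  /-- expansion `f Y(u, z) Y(v, t) w` -/
  corr_uv : ∀ h f u v w z t, IsOfWeight gr h f → t ≠ 0 → ‖t‖ < ‖z‖ →
    HasSum (fun e => matrixElement mode f u (mode v e w) z * bimono e t) (corr f u v w z t)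
  /-- expansion `f Y(v, t) Y(u, z) w` -/
  corr_vu : ∀ h f u v w z t, IsOfWeight gr h f → z ≠ 0 → ‖z‖ < ‖t‖ →
    HasSum (fun e => matrixElement mode f v (mode u e w) t * bimono e z) (corr f u v w z t)
  /-- expansion `f Y(Y(u, z - t) v, t) w` -/
  corr_assoc : ∀ h f u v w z t, IsOfWeight gr h f → z ≠ t → ‖z - t‖ < ‖t‖ →
    HasSum (fun e => matrixElement mode f (mode u e v) w t * bimono e (z - t))
      (corr f u v w z t)
  /-- the space on which chiral and antichiral operators act separately -/
  grW : ℝ × ℝ → Submodule ℂ W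
  grW_internal : DirectSum.IsInternal grW
  emb : V →ₗ[ℂ] W
  emb_injective : Function.Injective emb
  emb_mem : ∀ h, ∀ x ∈ gr h, emb x ∈ grW h
  /-- chiral splitting `Y(u, z, conj z) = ∑ i, Y_i(u, z) * Yt_i(u, conj z)` -/
  splitIdx : Type*
  chi : V → splitIdx → ℝ → Module.End ℂ W
  chiT : V → splitIdx → ℝ → Module.End ℂ W
  chi_mem : ∀ h k i p, ∀ u ∈ gr h, ∀ x ∈ grW k, chi u i p x ∈ grW (k.1 + (h.1 + p), k.2)
  chiT_mem : ∀ h k i q, ∀ u ∈ gr h, ∀ x ∈ grW k, chiT u i q x ∈ grW (k.1, k.2 + (h.2 + q))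
  chi_comm : ∀ u v i j p q, Commute (chi u i p) (chiT v j q)
  split_finite : ∀ h, ∀ u ∈ gr h, ∀ (e : ℝ × ℝ) (x : V),
    {i | chi u i e.1 (chiT u i e.2 (emb x)) ≠ 0}.Finite
  split : ∀ h, ∀ u ∈ gr h, ∀ (e : ℝ × ℝ) (x : V),
    emb (mode u e x) = ∑ᶠ i, chi u i e.1 (chiT u i e.2 (emb x))

/-- `u` is a primary field of weight `h`. -/
def VertexCFT.IsPrimary {V W : Type*} [AddCommGroup V] [Module ℂ V] [AddCommGroup W]
    [Module ℂ W] (X : VertexCFT V W) (h : ℝ × ℝ) (u : V) : Prop :=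
  u ∈ X.gr h ∧ ∀ n : ℤ, 0 < n → X.L n u = 0 ∧ X.Lt n u = 0

/-- The worldsheet: the disk of radius `R` around `0` (that is, a disk around `∞` is cut out),
with the disks of radius `r` around `0` and of radius `s` around `t` cut out. -/
def worldsheet (t : ℂ) (r s R : ℝ) : Set ℂ :=
  {z | r < ‖z‖ ∧ ‖z‖ < R ∧ s < ‖z - t‖}

/-- Matrix elements, in the dual numbers `ℂ[ε]`, of the deformation along `u` of the vertex
operator `Y(v, t, conj t)`: the `ε`-part is the integral of the 4-point function, with respect to
`(i/2) dz d(conj z)`, that is, Lebesgue measure on `ℂ`. -/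
noncomputable def VertexCFT.deformed {V W : Type*} [AddCommGroup V] [Module ℂ V]
    [AddCommGroup W] [Module ℂ W] (X : VertexCFT V W) (u v : V) (t : ℂ) (r s R : ℝ)
    (f : Module.Dual ℂ V) (w : V) : DualNumber ℂ :=
  TrivSqZeroExt.inl (matrixElement X.mode f v w t) +
    TrivSqZeroExt.inr (∫ z in worldsheet t r s R, X.corr f u v w z t)

/-- The function `g` is meromorphic on the Riemann sphere, with poles at most at `0`, `t`, `∞`. -/
def MeromorphicOnSphere (t : ℂ) (g : ℂ → ℂ) : Prop :=
  DifferentiableOn ℂ g {z | z ≠ 0 ∧ z ≠ t} ∧ MeromorphicAt g 0 ∧ MeromorphicAt g t ∧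
    MeromorphicAt (fun z => g z⁻¹) 0

/-- Left movers and right movers. -/
inductive Chirality
  | left
  | right

/-- The component of the weight which operators of the given chirality change. -/
def Chirality.coord : Chirality → ℝ × ℝ → ℝ
  | left, h => h.1
  | right, h => h.2

/-- Replace this component of the weight `h` by `c`. -/
def Chirality.replace : Chirality → ℝ × ℝ → ℝ → ℝ × ℝ
  | left, h, c => (c, h.2)
  | right, h, c => (h.1, c)

/-- A branch of `z ^ γ`, namely `exp (γ log z)` where `log z` is `l` at `z = t` and is continuous
on each of the two open half-planes bounded by the line through `0` and `t`. -/
noncomputable def branchPow (t l z : ℂ) (γ : ℝ) : ℂ :=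
  exp (γ * (l + log (z / t)))

/-- One chiral constituent `Z_i(u, v, z, t)` of the 4-point function, at a fixed point `t` whose
logarithm is `l`, together with its three expansions. Multivalued functions of `z` are
represented by their branches on the open half-plane `side`.

An operator which lands in a completion of `W` with respect to weights of the given chirality is
represented by the family of its components: `A c` is the component in weight `c`. -/
structure ChiralBlock {W : Type*} [AddCommGroup W] [Module ℂ W]
    (gr : ℝ × ℝ → Submodule ℂ W) (χ : Chirality) (t l : ℂ) (side : Set ℂ) (α β : ℝ)
    (v : W) where
  /-- `Z_i(u, v, z, t) * (z - t) ^ (-α) * z ^ (-β)` -/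
  Z : ℝ → ℂ → Module.End ℂ W
  /-- the chiral vertex operator `Y_i(a, t)`, linear in the field `a` -/
  Y : W →ₗ[ℂ] (ℝ → Module.End ℂ W)
  /-- `m n` is the coefficient of `z ^ (n + β - 1)` in `Y_i(u, z)` -/
  m : ℤ → Module.End ℂ W
  /-- `m' n` is the coefficient of `z ^ (n + α + β - 1)` in `Y'_i(u, z)` -/
  m' : ℤ → Module.End ℂ W
  /-- `m'' n` is the coefficient of `z ^ (n + α - 1)` in `Y''_i(u, z)` -/
  m'' : ℤ → Module.End ℂ W
  Z_mem : ∀ h c z, ∀ x ∈ gr h, Z c z x ∈ gr (χ.replace h c)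
  Y_mem : ∀ a h c, ∀ x ∈ gr h, Y a c x ∈ gr (χ.replace h c)
  m_mem : ∀ h (n : ℤ), ∀ x ∈ gr h, m n x ∈ gr (χ.replace h (χ.coord h + (n + β)))
  m'_mem : ∀ h (n : ℤ), ∀ x ∈ gr h, m' n x ∈ gr (χ.replace h (χ.coord h + (n + α + β)))
  m''_mem : ∀ h (n : ℤ), ∀ x ∈ gr h, m'' n x ∈ gr (χ.replace h (χ.coord h + (n + α)))
  meromorphic : ∀ h f x, IsOfWeight gr h f →
    MeromorphicOnSphere t (fun z => f (Z (χ.coord h) z x))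
  /-- `Z_i(u, v, z, t) = Y_i(v, t) Y_i(u, z)` when `z` is near `0` -/
  expand_zero : ∀ h f x, IsOfWeight gr h f → ∀ z ∈ side, ‖z‖ < ‖t‖ →
    HasSum (fun n : ℤ => f (Y v (χ.coord h) (m n x)) * branchPow t l z (n + β - 1))
      (branchPow t l (z - t) α * branchPow t l z β * f (Z (χ.coord h) z x))
  /-- `Z_i(u, v, z, t) = Y'_i(u, z) Y_i(v, t)` when `z` is near `∞` -/
  expand_infty : ∀ h f x, IsOfWeight gr h f → ∀ z ∈ side, ‖t‖ < ‖z‖ →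
    HasSum (fun n : ℤ => f (m' n (Y v (χ.coord h - (n + α + β)) x)) *
        branchPow t l z (n + α + β - 1))
      (branchPow t l (z - t) α * branchPow t l z β * f (Z (χ.coord h) z x))
  /-- `Z_i(u, v, z, t) = Y_i(Y''_i(u, z - t) v, t)` when `z` is near `t` -/
  expand_t : ∀ h f x, IsOfWeight gr h f → ∀ z ∈ side, ‖z - t‖ < ‖t‖ →
    HasSum (fun n : ℤ => f (Y (m'' n v) (χ.coord h) x) * branchPow t l (z - t) (n + α - 1))
      (branchPow t l (z - t) α * branchPow t l z β * f (Z (χ.coord h) z x))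

namespace ChiralBlock

variable {W : Type*} [AddCommGroup W] [Module ℂ W] {gr : ℝ × ℝ → Submodule ℂ W}
  {χ : Chirality} {t l : ℂ} {side : Set ℂ} {α β : ℝ} {v : W}

/-- All modes and components of the fields which occur in the three expansions. -/
def operators (B : ChiralBlock gr χ t l side α β v) : Set (Module.End ℂ W) :=
  Set.range B.m ∪ Set.range B.m' ∪ Set.range B.m'' ∪ Set.range (B.Y v) ∪
    ⋃ n, Set.range (B.Y (B.m'' n v))

/-- The modes of `u` whose index is zero vanish on `x`, on `v` and on `Y_i(v, t) x`. -/
def NoZeroModes (B : ChiralBlock gr χ t l side α β v) (x : W) : Prop :=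
  (∀ n : ℤ, (n : ℝ) + β = 0 → B.m n x = 0) ∧
  (∀ n : ℤ, (n : ℝ) + α = 0 → B.m'' n v = 0) ∧
  (∀ n : ℤ, (n : ℝ) + α + β = 0 → ∀ c, B.m' n (B.Y v c x) = 0)

/-- Termwise primitive `ω_0` of the expansion near `0`. -/
noncomputable def ω0 (B : ChiralBlock gr χ t l side α β v) (h : ℝ × ℝ) (f : Module.Dual ℂ W)
    (x : W) (z : ℂ) : ℂ :=
  ∑' n : ℤ, f (B.Y v (χ.coord h) (B.m n x)) * (branchPow t l z (n + β) / ((n + β : ℝ) : ℂ))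

/-- Termwise primitive `ω_∞` of the expansion near `∞`. -/
noncomputable def ωInfty (B : ChiralBlock gr χ t l side α β v) (h : ℝ × ℝ)
    (f : Module.Dual ℂ W) (x : W) (z : ℂ) : ℂ :=
  ∑' n : ℤ, f (B.m' n (B.Y v (χ.coord h - (n + α + β)) x)) *
    (branchPow t l z (n + α + β) / ((n + α + β : ℝ) : ℂ))

/-- Termwise primitive `ω_t` of the expansion near `t`. -/
noncomputable def ωt (B : ChiralBlock gr χ t l side α β v) (h : ℝ × ℝ)
    (f : Module.Dual ℂ W) (x : W) (z : ℂ) : ℂ :=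
  ∑' n : ℤ, f (B.Y (B.m'' n v) (χ.coord h) x) *
    (branchPow t l (z - t) (n + α) / ((n + α : ℝ) : ℂ))

/-- `C = ω_∞ - ω_t` and `D = ω_∞ - ω_0`, where `ω_∞` is continued as a primitive `F` of the
chiral 4-point function to the whole half-plane `side`. Like `Z_i`, the operators `C`, `D` are
given by their components; they are considered on the vectors without zero modes, where the
termwise primitives are primitives, and there they are determined by these conditions. -/
def IsDiscrepancy (B : ChiralBlock gr χ t l side α β v) (C D : ℝ → Module.End ℂ W) : Prop :=
  (∀ h c x, x ∈ (⨆ a, gr (χ.replace h a)) → B.NoZeroModes x →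
    C c x ∈ gr (χ.replace h c) ∧ D c x ∈ gr (χ.replace h c)) ∧
  ∀ h f x, IsOfWeight gr h f → B.NoZeroModes x → ∃ F : ℂ → ℂ,
    (∀ z ∈ side, HasDerivAt F
      (branchPow t l (z - t) α * branchPow t l z β * f (B.Z (χ.coord h) z x)) z) ∧
    (∀ z ∈ side, ‖t‖ < ‖z‖ → F z = B.ωInfty h f x z) ∧
    (∀ z ∈ side, ‖z - t‖ < ‖t‖ → F z - B.ωt h f x z = f (C (χ.coord h) x)) ∧
    (∀ z ∈ side, ‖z‖ < ‖t‖ → F z - B.ω0 h f x z = f (D (χ.coord h) x))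

end ChiralBlock

/-- A summand `Z_i(u, v, z, t) * Zt_i(u, v, conj z, conj t)` of the 4-point function: a chiral and
an antichiral constituent which commute. The antichiral one is a function of `ζ = conj z`, and its
branches are the complex conjugate ones. -/
structure BlockPair {W : Type*} [AddCommGroup W] [Module ℂ W]
    (gr : ℝ × ℝ → Submodule ℂ W) (t : ℂ) (α β : ℝ) (v : W) where
  L : ChiralBlock gr .left t (log t) {z | 0 < (z / t).im} α β v
  R : ChiralBlock gr .right (conj t) (conj (log t)) {ζ | (ζ / conj t).im < 0} α β v
  comm : ∀ A ∈ L.operators, ∀ B ∈ R.operators, Commute A B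
  /-- the vertex operator `Y_i(·, t) * Yt_i(·, conj t)` of the summand, on fields generated from
  `v` by the chiral and antichiral modes of `u` -/
  Y : W →ₗ[ℂ] (ℝ × ℝ → Module.End ℂ W)
  Y_v : ∀ c, Y v c = L.Y v c.1 * R.Y v c.2
  Y_desc : ∀ n k c, Y (L.m'' n (R.m'' k v)) c = L.Y (L.m'' n v) c.1 * R.Y (R.m'' k v) c.2

namespace BlockPair

variable {W : Type*} [AddCommGroup W] [Module ℂ W] {gr : ℝ × ℝ → Submodule ℂ W}
  {t : ℂ} {α β : ℝ} {v : W}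

/-- Matrix element of `Z_i * Zt_i` between `w` and a functional `f` of weight `c`. -/
noncomputable def fourPoint (P : BlockPair gr t α β v) (c : ℝ × ℝ) (f : Module.Dual ℂ W)
    (w : W) (z : ℂ) : ℂ :=
  ((‖z - t‖ ^ (2 * α) * ‖z‖ ^ (2 * β) : ℝ) : ℂ) * f (P.L.Z c.1 z (P.R.Z c.2 (conj z) w))

/-- The summand of index `n + β` of `φ = π ∑ u_{-k} ut_{-k} / k`. -/
noncomputable def φ (P : BlockPair gr t α β v) (n : ℤ) : Module.End ℂ W :=
  ((Real.pi / (n + β) : ℝ) : ℂ) • (P.L.m n * P.R.m n)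

/-- The summand of index `n + α + β` of `φ' = π ∑ u'_{-k} ut'_{-k} / k`. -/
noncomputable def φ' (P : BlockPair gr t α β v) (n : ℤ) : Module.End ℂ W :=
  ((Real.pi / (n + α + β) : ℝ) : ℂ) • (P.L.m' n * P.R.m' n)

/-- The summand of index `n + α` of `φ'' = π ∑ u''_{-k} ut''_{-k} / k`. -/
noncomputable def φ'' (P : BlockPair gr t α β v) (n : ℤ) : Module.End ℂ W :=
  ((Real.pi / (n + α) : ℝ) : ℂ) • (P.L.m'' n * P.R.m'' n)

/-- The terms of the matrix element of `φ' Y(v) w`, scaled by the radius `R`. -/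
noncomputable def outerTerm (P : BlockPair gr t α β v) (R : ℝ) (c : ℝ × ℝ)
    (f : Module.Dual ℂ W) (w : W) (n : ℤ) : ℂ :=
  ((R ^ (2 * (n + α + β)) : ℝ) : ℂ) *
    f (P.φ' n (P.Y v (c.1 - (n + α + β), c.2 - (n + α + β)) w))

/-- The terms of the matrix element of `Y(φ'' v) w`, scaled by the radius `s`. -/
noncomputable def fieldTerm (P : BlockPair gr t α β v) (s : ℝ) (c : ℝ × ℝ)
    (f : Module.Dual ℂ W) (w : W) (n : ℤ) : ℂ :=
  ((s ^ (2 * (n + α)) : ℝ) : ℂ) * f (P.Y (P.φ'' n v) c w)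

/-- The terms of the matrix element of `Y(v) φ w`, scaled by the radius `r`. -/
noncomputable def innerTerm (P : BlockPair gr t α β v) (r : ℝ) (c : ℝ × ℝ)
    (f : Module.Dual ℂ W) (w : W) (n : ℤ) : ℂ :=
  ((r ^ (2 * (n + β)) : ℝ) : ℂ) * f (P.Y v c (P.φ n w))

/-- Matrix element of the local expression `φ' Y(v) w - Y(φ'' v) w - Y(v) φ w`. -/
noncomputable def localPart (P : BlockPair gr t α β v) (r s R : ℝ) (c : ℝ × ℝ)
    (f : Module.Dual ℂ W) (w : W) : ℂ :=
  (∑' n, P.outerTerm R c f w n) - (∑' n, P.fieldTerm s c f w n) - ∑' n, P.innerTerm r c f w n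

/-- The zero modes of both chiralities vanish. -/
def NoZeroModes (P : BlockPair gr t α β v) (w : W) : Prop :=
  P.L.NoZeroModes w ∧ P.R.NoZeroModes w

end BlockPair

/-- The vertex operator `Y_i * Yt_i` of the summand agrees with that of the conformal field theory
for the field `a` acting on `x`. -/
def VertexCFT.AgreesOn {V W : Type*} [AddCommGroup V] [Module ℂ V] [AddCommGroup W]
    [Module ℂ W] (X : VertexCFT V W) {t : ℂ} {α β : ℝ} {v : W} (P : BlockPair X.grW t α β v)
    (a x : V) : Prop :=
  ∀ c f, IsOfWeight X.grW c f →
    f (P.Y (X.emb a) c (X.emb x)) = matrixElement X.mode (f ∘ₗ X.emb) a x t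

/-- Matrix element of the local expression `φ' Y(v) w - Y(φ'' v) w - Y(v) φ w` formed with the
vertex operator `Y(·, t, conj t)` of the conformal field theory; `a n` and `b n` stand for the
summands of `φ'' v` and `φ w`. -/
noncomputable def VertexCFT.localPart {V W : Type*} [AddCommGroup V] [Module ℂ V]
    [AddCommGroup W] [Module ℂ W] (X : VertexCFT V W) {t : ℂ} {α β : ℝ} {x : W}
    (P : BlockPair X.grW t α β x) (r s R : ℝ) (f : Module.Dual ℂ W) (v w : V)
    (a b : ℤ → V) : ℂ :=
  (∑' n : ℤ, ((R ^ (2 * (n + α + β)) : ℝ) : ℂ) *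
      matrixElement X.mode ((f ∘ₗ P.φ' n) ∘ₗ X.emb) v w t) -
    (∑' n : ℤ, ((s ^ (2 * (n + α)) : ℝ) : ℂ) * matrixElement X.mode (f ∘ₗ X.emb) (a n) w t) -
    ∑' n : ℤ, ((r ^ (2 * (n + β)) : ℝ) : ℂ) * matrixElement X.mode (f ∘ₗ X.emb) v (b n) t

open Classical in
/-- The matrix element of `Z_{α,β}`, the sum of the summands with label `(α, β) = p`. -/
noncomputable def labelFourPoint {W : Type*} [AddCommGroup W] [Module ℂ W]
    {gr : ℝ × ℝ → Submodule ℂ W} {t : ℂ} {v : W} {J : Type*} [Fintype J] (lab : J → ℝ × ℝ)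
    (P : ∀ j, BlockPair gr t (lab j).1 (lab j).2 v) (p c : ℝ × ℝ) (f : Module.Dual ℂ W) (w : W)
    (z : ℂ) : ℂ :=
  ∑ j with lab j = p, (P j).fourPoint c f w z

/-! Everything reduces to one scalar integral. After the scaling z = t y, a matrix element of one
summand is a finite sum of products A · conj A', where A = (y - 1)^α y^β a(y) with a holomorphic off
0 and 1, and A' is of the same kind (`TriBlock`). Each factor is multivalued, but the product is
single-valued, since only the moduli of the powers survive. Its integral over the plane with discs
around 0, 1, ∞ removed is computed by a relation of Riemann bilinear type
(`TriBlock.integral_worldsheet`).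

Choose cutoffs P₀, P₁, P_∞ around the punctures and let mid = 1 - P₀ - P₁ - P_∞. Near a puncture let
ω be the termwise primitive of the expansion of A. The function ∂_z(P ω) · conj A' is single-valued;
in polar coordinates Parseval's identity turns its angular integral into a radial derivative
(`integral_annulusIntegrand`). The boundary values are the terms φ, φ', φ'' of the local expression.

What is left is `rest`, supported away from the punctures. In the upper half-plane A has one
primitive F, with F = ω_∞ = ω_1 + C = ω_0 + D, and A' has a primitive G. There rest · dz ∧ d(conj z)
is the differential of mid · F · conj A' · d(conj z) - conj G · (D dP₀ + C dP₁), so Stokes' theorem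
leaves an integral over the real axis (`integral_upper_rest`). The lower half-plane is treated as
the upper half-plane of the conjugate blocks (`TriBlock.star`). On (-∞, 0) and (1, ∞) the two
boundary contributions cancel, because the monodromy factors are inverse to each other. On (0, 1),
up to a phase, F and its conjugate counterpart differ by the constant D (1 - e^(-2πiβ)); the
difference of the forms is then an exact derivative, and only the values of the cutoffs at 0 and 1
contribute (`integral_rest`).

The monodromy relation D (1 - e^(-2πiβ)) = C (1 - e^(2πiα)) (`D_mul_eq_C_mul`) comes from comparing
ω_0 + D = ω_1 + C above and below (0, 1). It brings the result into its symmetric form and yields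
all statements about integral exponents.

The passage from operators to scalars rests on a finiteness property: meromorphic functions on the
sphere grow polynomially, and a family of vectors all of whose matrix elements are of this kind
spans a finite-dimensional space (`finiteDimensional_span_of_meromorphic`). Hence C and D are
operators with values in W and not only functionals on its dual, and the vector produced by the
antichiral factor can be expanded in a finite basis. The chiral zero mode conditions pass to that
basis because the antichiral values are combinations of the antichiral expansion coefficients at 0,
whose operators commute with the chiral modes. -/

/-! ### Laurent series and their termwise primitives -/

/-- The Laurent series with coefficients `c`. -/
noncomputable def laurent (c : ℤ → ℂ) (z : ℂ) : ℂ := ∑' n : ℤ, c n * z ^ n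

/-- Absolute convergence of the Laurent series with coefficients `c` on the circles with radius
in the open set `U` of radii. -/
def LaurentConv (c : ℤ → ℂ) (U : Set ℝ) : Prop :=
  U ⊆ Set.Ioi 0 ∧ ∀ ρ ∈ U, Summable fun n : ℤ => ‖c n‖ * ρ ^ n

/-- If γ is not an integer, its distance to the integers bounds n + γ from below. If γ is an
integer, the nonzero values of n + γ have modulus at least 1, and the value 0 is harmless because
its inverse is 0 by convention. So dividing Laurent coefficients by n + γ never destroys
convergence. -/
theorem exists_inv_add_int_le (γ : ℝ) : ∃ K : ℝ, 0 ≤ K ∧ ∀ n : ℤ, ‖((n : ℂ) + γ)⁻¹‖ ≤ K := by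
  have key : ∀ n : ℤ, ‖((n : ℂ) + γ)⁻¹‖ = |(n : ℝ) + γ|⁻¹ := by
    intro n
    rw [norm_inv, ← Complex.ofReal_intCast, ← Complex.ofReal_add, Complex.norm_real,
      Real.norm_eq_abs]
  by_cases h : γ = round γ
  · refine ⟨1, zero_le_one, fun n => ?_⟩
    rw [key, h]
    have : ((n : ℝ) + (round γ : ℤ)) = ((n + round γ : ℤ) : ℝ) := by push_cast; ring
    rw [this]
    rcases eq_or_ne (n + round γ) 0 with h0 | h0
    · rw [h0]; simp
    · apply inv_le_one_of_one_le₀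
      exact_mod_cast Int.one_le_abs h0
  · have hpos : 0 < |γ - round γ| := abs_pos.2 (sub_ne_zero.2 h)
    refine ⟨|γ - round γ|⁻¹, by positivity, fun n => ?_⟩
    rw [key]
    apply inv_anti₀ hpos
    have := round_le γ (-n)
    push_cast at this
    rwa [sub_neg_eq_add, add_comm γ] at this

namespace LaurentConv

variable {c d : ℤ → ℂ} {U : Set ℝ}

theorem norm_summable (h : LaurentConv c U) {z : ℂ} (hz : ‖z‖ ∈ U) :
    Summable fun n : ℤ => ‖c n * z ^ n‖ := by
  simpa [norm_mul, norm_zpow] using h.2 _ hz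

theorem hasSum (h : LaurentConv c U) {z : ℂ} (hz : ‖z‖ ∈ U) :
    HasSum (fun n : ℤ => c n * z ^ n) (laurent c z) :=
  (h.norm_summable hz).of_norm.hasSum

theorem of_le (h : LaurentConv c U) (K : ℝ) (hd : ∀ n, ‖d n‖ ≤ K * ‖c n‖) : LaurentConv d U := by
  refine ⟨h.1, fun ρ hρ => ?_⟩
  have hρ0 : 0 < ρ := h.1 hρ
  refine Summable.of_nonneg_of_le (fun n => by positivity) (fun n => ?_) ((h.2 ρ hρ).mul_left K)
  have := hd n
  calc ‖d n‖ * ρ ^ n ≤ (K * ‖c n‖) * ρ ^ n := by gcongr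
    _ = _ := by ring

theorem conj_coeff (h : LaurentConv c U) : LaurentConv (fun n => conj (c n)) U :=
  h.of_le 1 fun n => by simp

theorem div (h : LaurentConv c U) (γ : ℝ) : LaurentConv (fun n => c n / (n + γ)) U := by
  obtain ⟨K, -, hK⟩ := exists_inv_add_int_le γ
  refine h.of_le K fun n => ?_
  rw [div_eq_mul_inv, norm_mul, mul_comm]
  gcongr
  exact hK n

/-- Near a point of an open annulus, the terms of a Laurent series are uniformly summable. -/
theorem exists_bound (h : LaurentConv c U) (hU : IsOpen U) {z : ℂ} (hz : ‖z‖ ∈ U) :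
    ∃ (u : ℤ → ℝ) (ε : ℝ), 0 < ε ∧ Summable u ∧ ∀ y ∈ Metric.ball z ε, ‖y‖ ∈ U ∧
      ∀ n, ‖c n‖ * ‖y‖ ^ n ≤ u n := by
  obtain ⟨ε, hε, hεU⟩ := Metric.isOpen_iff.1 hU _ hz
  have hmem : ∀ x : ℝ, |x - ‖z‖| < ε → x ∈ U := fun x hx => hεU (by simpa [Real.dist_eq] using hx)
  have h1 : ‖z‖ - ε / 2 ∈ U := hmem _ (by rw [abs_lt]; constructor <;> linarith)
  have h2 : ‖z‖ + ε / 2 ∈ U := hmem _ (by rw [abs_lt]; constructor <;> linarith)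
  refine ⟨fun n => ‖c n‖ * (‖z‖ - ε / 2) ^ n + ‖c n‖ * (‖z‖ + ε / 2) ^ n, ε / 2, by linarith,
    (h.2 _ h1).add (h.2 _ h2), fun y hy => ?_⟩
  have h1' : 0 < ‖z‖ - ε / 2 := h.1 h1
  have hd : |‖y‖ - ‖z‖| < ε / 2 := by
    rw [Metric.mem_ball, dist_eq_norm] at hy
    exact (abs_norm_sub_norm_le y z).trans_lt hy
  rw [abs_lt] at hd
  have hyU : ‖y‖ ∈ U := hmem _ (by rw [abs_lt]; constructor <;> linarith)
  have hy0 : 0 < ‖y‖ := h.1 hyU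
  refine ⟨hyU, fun n => ?_⟩
  beta_reduce
  rw [← mul_add]
  gcongr
  -- For n ≥ 0 the power is largest on the outer circle, for n ≤ 0 on the inner one; the sum of the
  -- two dominates in both cases.
  rcases le_total 0 n with hn | hn
  · have : ‖y‖ ^ n ≤ (‖z‖ + ε / 2) ^ n := zpow_le_zpow_left₀ hn hy0.le (by linarith)
    have : 0 < (‖z‖ - ε / 2) ^ n := zpow_pos h1' n
    linarith
  · have : ‖y‖ ^ n ≤ (‖z‖ - ε / 2) ^ n := by
      obtain ⟨m, rfl⟩ := Int.eq_ofNat_of_zero_le (neg_nonneg.2 hn) |>.imp fun m hm => neg_eq_iff_eq_neg.1 hm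
      simp only [zpow_neg, zpow_natCast]
      gcongr
      linarith
    have : 0 < (‖z‖ + ε / 2) ^ n := zpow_pos (by linarith) n
    linarith

theorem differentiableAt (h : LaurentConv c U) (hU : IsOpen U) {z : ℂ} (hz : ‖z‖ ∈ U) :
    DifferentiableAt ℂ (laurent c) z := by
  obtain ⟨u, ε, hε, hu, hb⟩ := h.exists_bound hU hz
  refine (differentiableOn_tsum_of_summable_norm (u := u) hu (fun n y hy => ?_) Metric.isOpen_ball
    (fun n y hy => ?_)).differentiableAt (Metric.ball_mem_nhds z hε)
  · have : y ≠ 0 := norm_pos_iff.1 (h.1 (hb y hy).1)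
    exact ((differentiableAt_zpow.2 (Or.inl this)).const_mul _).differentiableWithinAt
  · rw [norm_mul, norm_zpow]
    exact (hb y hy).2 n

/-- Dividing the coefficients by `n + γ` produces, up to the factor `z ^ γ`, a primitive. -/
theorem hasDerivAt_div (h : LaurentConv c U) (hU : IsOpen U) {γ : ℝ}
    (h0 : ∀ n : ℤ, (n : ℝ) + γ = 0 → c n = 0) {z : ℂ} (hz : ‖z‖ ∈ U) :
    HasDerivAt (laurent fun n => c n / (n + γ))
      ((laurent c z - γ * laurent (fun n => c n / (n + γ)) z) / z) z := by
  obtain ⟨u, ε, hε, hu, hb⟩ := h.exists_bound hU hz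
  obtain ⟨K, hK0, hK⟩ := exists_inv_add_int_le γ
  have hz0 : 0 < ‖z‖ := h.1 hz
  -- The identity is n/(n + γ) = 1 - γ/(n + γ). At n + γ = 0 the quotient is 0 by convention, and
  -- the identity survives only because that coefficient vanishes.
  have hterm : ∀ n : ℤ, ∀ y : ℂ, y ≠ 0 →
      c n / (n + γ) * (n * y ^ (n - 1)) = (c n - γ * (c n / (n + γ))) * y ^ n / y := by
    intro n y hy
    rw [zpow_sub_one₀ hy]
    by_cases hn : (n : ℂ) + γ = 0
    · have : c n = 0 := h0 n (by exact_mod_cast hn)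
      simp [this]
    · field_simp
      ring
  have hy0 : ∀ y ∈ Metric.ball z (min ε (‖z‖ / 2)), ‖z‖ / 2 < ‖y‖ := by
    intro y hy
    have h1 : dist y z < ‖z‖ / 2 := (Metric.mem_ball.1 hy).trans_le (min_le_right _ _)
    rw [dist_eq_norm] at h1
    have := (abs_norm_sub_norm_le y z).trans_lt h1
    rw [abs_lt] at this
    linarith
  have key := hasDerivAt_tsum_of_isPreconnected (𝕜 := ℂ)
    (g := fun (n : ℤ) (y : ℂ) => c n / (n + γ) * y ^ n)
    (g' := fun (n : ℤ) (y : ℂ) => c n / (n + γ) * (n * y ^ (n - 1)))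
    (u := fun n => (1 + |γ| * K) * u n / (‖z‖ / 2)) (t := Metric.ball z (min ε (‖z‖ / 2)))
    (y₀ := z) (y := z)
    ((hu.mul_left _).div_const _) Metric.isOpen_ball
    (convex_ball z (min ε (‖z‖ / 2))).isPreconnected ?_ ?_
    (Metric.mem_ball_self (by positivity)) (((h.div γ).norm_summable hz).of_norm)
    (Metric.mem_ball_self (by positivity))
  · refine key.congr_deriv ?_
    rw [laurent, laurent, ← tsum_mul_left, ← ((h.hasSum hz).summable).tsum_sub
      (((h.div γ).hasSum hz).summable.mul_left _), ← tsum_div_const]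
    refine tsum_congr fun n => ?_
    rw [hterm n z (norm_pos_iff.1 hz0)]
    ring
  · intro n y hy
    have : y ≠ 0 := norm_pos_iff.1 ((by positivity : 0 < ‖z‖ / 2).trans (hy0 y hy))
    exact (hasDerivAt_zpow n y (Or.inl this)).const_mul _
  · intro n y hy
    have hyε : y ∈ Metric.ball z ε := Metric.ball_subset_ball (min_le_left _ _) hy
    have hy1 := hy0 y hy
    have : y ≠ 0 := norm_pos_iff.1 ((by positivity : 0 < ‖z‖ / 2).trans hy1)
    rw [hterm n y this, norm_div, norm_mul, norm_zpow]
    have hb1 := (hb y hyε).2 n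
    have hu0 : 0 ≤ u n := le_trans (by positivity) hb1
    have hc : ‖c n - γ * (c n / (n + γ))‖ ≤ (1 + |γ| * K) * ‖c n‖ := by
      calc _ ≤ ‖c n‖ + ‖(γ : ℂ) * (c n / (n + γ))‖ := norm_sub_le _ _
        _ = ‖c n‖ + |γ| * (‖c n‖ * ‖((n : ℂ) + γ)⁻¹‖) := by
          rw [norm_mul, div_eq_mul_inv, norm_mul, Complex.norm_real, Real.norm_eq_abs]
        _ ≤ ‖c n‖ + |γ| * (‖c n‖ * K) := by gcongr; exact hK n
        _ = _ := by ring
    calc _ ≤ (1 + |γ| * K) * ‖c n‖ * ‖y‖ ^ n / ‖y‖ := by gcongr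
      _ = (1 + |γ| * K) * (‖c n‖ * ‖y‖ ^ n) / ‖y‖ := by ring
      _ ≤ (1 + |γ| * K) * u n / (‖z‖ / 2) := by gcongr

/-- The product of two coefficient sequences, on the annulus of squared radii. -/
theorem mul_conj {V : Set ℝ} (hc : LaurentConv c U) (hd : LaurentConv d U)
    (hV : ∀ x ∈ V, 0 < x ∧ √x ∈ U) : LaurentConv (fun n => c n * conj (d n)) V := by
  refine ⟨fun x hx => (hV x hx).1, fun x hx => ?_⟩
  obtain ⟨hx0, hxU⟩ := hV x hx
  have h1 := hc.2 _ hxU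
  have h2 := hd.2 _ hxU
  have h3 := (h1.mul_of_nonneg h2 (fun n => by positivity) (fun n => by positivity)).comp_injective
    (i := fun n : ℤ => (n, n)) (fun a b hab => (Prod.ext_iff.1 hab).1)
  refine h3.congr fun n => ?_
  simp only [Function.comp, norm_mul, RCLike.norm_conj]
  have : x ^ n = √x ^ n * √x ^ n := by rw [← mul_zpow, Real.mul_self_sqrt hx0.le]
  rw [this]; ring

end LaurentConv

/-! ### Parseval's identity and integrals over annuli -/

theorem integral_exp_int_mul_I (n : ℤ) :
    ∫ θ in Set.Ioo (-Real.pi) Real.pi, exp (n * θ * I) = if n = 0 then (2 * Real.pi : ℂ) else 0 := by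
  rw [← integral_Ioc_eq_integral_Ioo, ← intervalIntegral.integral_of_le (by linarith [Real.pi_pos])]
  split_ifs with h
  · simp [h]; ring
  · have h' : (n : ℂ) * I ≠ 0 := mul_ne_zero (by exact_mod_cast h) I_ne_zero
    have := integral_exp_mul_complex (a := -Real.pi) (b := Real.pi) h'
    rw [show (fun θ : ℝ => exp (n * θ * I)) = fun θ : ℝ => exp (n * I * θ) by
      ext θ; ring_nf, this]
    rw [div_eq_zero_iff]
    left
    rw [sub_eq_zero, exp_eq_exp_iff_exists_int]
    exact ⟨n, by push_cast; ring⟩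

/-- Parseval's identity on a circle, for two Laurent series. -/
theorem integral_laurent_mul_conj {c d : ℤ → ℂ} {ρ : ℝ} (hρ : 0 < ρ)
    (hc : Summable fun n : ℤ => ‖c n‖ * ρ ^ n) (hd : Summable fun n : ℤ => ‖d n‖ * ρ ^ n) :
    ∫ θ in Set.Ioo (-Real.pi) Real.pi,
        laurent c (ρ * exp (θ * I)) * conj (laurent d (ρ * exp (θ * I))) =
      2 * Real.pi * laurent (fun n => c n * conj (d n)) ((ρ ^ 2 : ℝ) : ℂ) := by
  have hnorm : ∀ θ : ℝ, ‖(ρ : ℂ) * exp (θ * I)‖ = ρ := fun θ => by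
    rw [norm_mul, norm_exp_ofReal_mul_I, mul_one, norm_real, Real.norm_of_nonneg hρ.le]
  have hsum : ∀ (e : ℤ → ℂ), (Summable fun n : ℤ => ‖e n‖ * ρ ^ n) → ∀ θ : ℝ,
      Summable fun n : ℤ => ‖e n * ((ρ : ℂ) * exp (θ * I)) ^ n‖ := fun e he θ => by
    simpa only [norm_mul, norm_zpow, norm_exp_ofReal_mul_I, mul_one, norm_real,
      Real.norm_of_nonneg hρ.le] using he
  set T : ℤ × ℤ → ℝ → ℂ := fun p θ => (c p.1 * ((ρ : ℂ) * exp (θ * I)) ^ p.1) *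
    conj (d p.2 * ((ρ : ℂ) * exp (θ * I)) ^ p.2) with hT
  have hTexp : ∀ p θ, T p θ = (c p.1 * conj (d p.2) * ((ρ : ℂ) ^ p.1 * (ρ : ℂ) ^ p.2)) *
      exp ((p.1 - p.2 : ℤ) * θ * I) := by
    intro p θ
    simp only [hT, mul_zpow, map_mul, map_zpow₀, conj_ofReal, ← exp_conj, conj_I, ← exp_int_mul, map_intCast]
    rw [show ((p.1 - p.2 : ℤ) * θ * I : ℂ) = p.1 * (θ * I) + p.2 * (θ * -I) by push_cast; ring,
      Complex.exp_add]
    ring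
  have hTnorm : ∀ p θ, ‖T p θ‖ = (‖c p.1‖ * ρ ^ p.1) * (‖d p.2‖ * ρ ^ p.2) := by
    intro p θ
    simp only [hT, norm_mul, RCLike.norm_conj, norm_zpow, norm_exp_ofReal_mul_I, mul_one,
      norm_real, Real.norm_of_nonneg hρ.le]
  have hTc : ∀ p, Continuous (T p) := by
    intro p
    rw [show T p = _ from funext (hTexp p)]
    fun_prop
  have hprod : Summable fun p : ℤ × ℤ => (‖c p.1‖ * ρ ^ p.1) * (‖d p.2‖ * ρ ^ p.2) :=
    hc.mul_of_nonneg hd (fun n => by positivity) (fun n => by positivity)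
  have hint : ∀ p, Integrable (T p) (volume.restrict (Set.Ioo (-Real.pi) Real.pi)) := fun p =>
    ((hTc p).integrableOn_Icc (a := -Real.pi) (b := Real.pi)).mono_set Set.Ioo_subset_Icc_self
  have h1 : ∫ θ in Set.Ioo (-Real.pi) Real.pi,
        laurent c (ρ * exp (θ * I)) * conj (laurent d (ρ * exp (θ * I))) =
      ∫ θ in Set.Ioo (-Real.pi) Real.pi, ∑' p, T p θ := by
    refine integral_congr_ae (Eventually.of_forall fun θ => ?_)
    have hs := hsum d hd θ
    simp only [laurent, conj_tsum, hT]
    exact tsum_mul_tsum_of_summable_norm (hsum c hc θ) (by simpa only [RCLike.norm_conj] using hs)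
  rw [h1, ← integral_tsum_of_summable_integral_norm hint]
  · have h2 : ∀ p : ℤ × ℤ, ∫ θ in Set.Ioo (-Real.pi) Real.pi, T p θ =
        if p.1 = p.2 then 2 * Real.pi * (c p.1 * conj (d p.1) * ((ρ ^ 2 : ℝ) : ℂ) ^ p.1) else 0 := by
      intro p
      simp only [hTexp]
      rw [integral_const_mul, integral_exp_int_mul_I]
      simp only [sub_eq_zero]
      split_ifs with h
      · rw [← h]; push_cast; rw [← mul_zpow]; ring_nf
      · simp
    simp only [h2]
    rw [← Function.Injective.tsum_eq (g := fun n : ℤ => (n, n))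
      (fun a b hab => (Prod.ext_iff.1 hab).1)]
    · simp only [if_true]
      rw [tsum_mul_left, laurent]
    · intro p hp
      simp only [Function.mem_support, ne_eq, ite_eq_right_iff, Classical.not_imp] at hp
      exact ⟨p.1, Prod.ext rfl hp.1⟩
  · simp only [hTnorm, integral_const]
    exact hprod.mul_left _

/-- The value at squared radius `N` of the local boundary contribution of two Laurent series. -/
noncomputable def localSeries (c d : ℤ → ℂ) (γ N : ℝ) : ℂ :=
  Real.pi * ((N ^ γ : ℝ) * laurent (fun n => c n * conj (d n) / (n + γ)) N)

/-- The derivative of N^(n+γ)/(n+γ) is N^(n+γ)/N. Here N is a squared radius, so the product series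
is considered on the set `V` of those N with √N in U. -/
theorem hasDerivAt_localSeries {c d : ℤ → ℂ} {U : Set ℝ} (hU : IsOpen U) (hc : LaurentConv c U)
    (hd : LaurentConv d U) {γ : ℝ} (h0 : ∀ n : ℤ, (n : ℝ) + γ = 0 → c n = 0) {ρ : ℝ}
    (hρ : ρ ∈ U) :
    HasDerivAt (localSeries c d γ) (Real.pi * ((((ρ ^ 2) ^ γ : ℝ) : ℂ) *
      laurent (fun n => c n * conj (d n)) ((ρ ^ 2 : ℝ) : ℂ) / ((ρ ^ 2 : ℝ) : ℂ))) (ρ ^ 2) := by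
  set V : Set ℝ := Set.Ioi 0 ∩ (fun x => √x) ⁻¹' U with hV
  have hVo : IsOpen V := isOpen_Ioi.inter (hU.preimage Real.continuous_sqrt)
  have he : LaurentConv (fun n => c n * conj (d n)) V := hc.mul_conj hd fun x hx => hx
  have hρ0 : 0 < ρ := hc.1 hρ
  have hmem : ‖((ρ ^ 2 : ℝ) : ℂ)‖ ∈ V := by
    rw [norm_real, Real.norm_of_nonneg (by positivity)]
    exact ⟨by simp only [Set.mem_Ioi]; positivity, by simpa [Real.sqrt_sq hρ0.le] using hρ⟩
  have h1 := (he.hasDerivAt_div hVo (γ := γ) (fun n hn => by simp [h0 n hn]) hmem).comp_ofReal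
  have h2 : HasDerivAt (fun N : ℝ => ((N ^ γ : ℝ) : ℂ)) ((γ * (ρ ^ 2) ^ (γ - 1) : ℝ) : ℂ) (ρ ^ 2) :=
    (Real.hasDerivAt_rpow_const (Or.inl (by positivity))).ofReal_comp
  refine ((h2.mul h1).const_mul (Real.pi : ℂ)).congr_deriv ?_
  have hne : ((ρ ^ 2 : ℝ) : ℂ) ≠ 0 := by exact_mod_cast (by positivity : ρ ^ 2 ≠ 0)
  rw [Real.rpow_sub_one (by positivity)]
  simp only [ofReal_mul, ofReal_div]
  field_simp
  ring

/-- The integrand of the local contribution of an annulus, for the cutoff function `P` of the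
squared radius. -/
noncomputable def annulusIntegrand (c d : ℤ → ℂ) (γ : ℝ) (P : ℝ → ℝ) (z : ℂ) : ℂ :=
  ((‖z‖ ^ (2 * γ) : ℝ) : ℂ) * (P (‖z‖ ^ 2) * (laurent c z / ((‖z‖ ^ 2 : ℝ) : ℂ)) +
    deriv P (‖z‖ ^ 2) * laurent (fun n => c n / (n + γ)) z) * conj (laurent d z)

theorem continuousOn_annulusIntegrand {c d : ℤ → ℂ} {U : Set ℝ} (hU : IsOpen U)
    (hc : LaurentConv c U) (hd : LaurentConv d U) (γ : ℝ) {P : ℝ → ℝ} (hP : ContDiff ℝ 1 P) :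
    ContinuousOn (annulusIntegrand c d γ P) {z | ‖z‖ ∈ U} := by
  intro z hz
  have hz0 : ‖z‖ ≠ 0 := (hc.1 hz).ne'
  have hP' : Continuous (deriv P) := hP.continuous_deriv le_rfl
  have h1 := (hc.differentiableAt hU hz).continuousAt
  have h2 := ((hc.div γ).differentiableAt hU hz).continuousAt
  have h3 := (hd.differentiableAt hU hz).continuousAt
  have h4 : ContinuousAt (fun z : ℂ => ((‖z‖ ^ (2 * γ) : ℝ) : ℂ)) z :=
    continuous_ofReal.continuousAt.comp (continuous_norm.continuousAt.rpow_const (Or.inl hz0))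
  have h5 : ContinuousAt (fun z : ℂ => (P (‖z‖ ^ 2) : ℂ)) z :=
    (continuous_ofReal.comp (hP.continuous.comp (by fun_prop))).continuousAt
  have h6 : ContinuousAt (fun z : ℂ => ((deriv P (‖z‖ ^ 2) : ℝ) : ℂ)) z :=
    (continuous_ofReal.comp (hP'.comp (continuous_norm.pow 2))).continuousAt
  have h7 : ContinuousAt (fun z : ℂ => ((‖z‖ ^ 2 : ℝ) : ℂ)) z := by fun_prop
  have h8 : ((‖z‖ ^ 2 : ℝ) : ℂ) ≠ 0 := by exact_mod_cast pow_ne_zero 2 hz0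
  exact ((h4.mul ((h5.mul (h1.div h7 h8)).add (h6.mul h2))).mul
    (continuous_conj.continuousAt.comp h3)).continuousWithinAt

theorem integrableOn_annulusIntegrand {c d : ℤ → ℂ} {U : Set ℝ} (hU : IsOpen U)
    (hc : LaurentConv c U) (hd : LaurentConv d U) (γ : ℝ) {P : ℝ → ℝ} (hP : ContDiff ℝ 1 P)
    {x y : ℝ} (hxy : Set.Icc x y ⊆ U) :
    IntegrableOn (annulusIntegrand c d γ P) {z | x < ‖z‖ ∧ ‖z‖ < y} := by
  have hK : IsCompact {z : ℂ | x ≤ ‖z‖ ∧ ‖z‖ ≤ y} := by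
    refine Metric.isCompact_of_isClosed_isBounded ?_ ?_
    · exact (isClosed_le continuous_const continuous_norm).inter
        (isClosed_le continuous_norm continuous_const)
    · exact (Metric.isBounded_closedBall (x := (0 : ℂ)) (r := y)).subset fun z hz => by
        simpa using hz.2
  refine IntegrableOn.mono_set (ContinuousOn.integrableOn_compact hK
    ((continuousOn_annulusIntegrand hU hc hd γ hP).mono fun z hz => hxy hz)) fun z hz => ?_
  exact ⟨hz.1.le, hz.2.le⟩

/-- The integrand is ∂_z(P ω) times the conjugate of z^γ d(z)/z, with ω the termwise primitive.
Integrating over the angle leaves only diagonal terms, and together with the Jacobian ρ these form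
exactly the ρ-derivative of P(ρ²) · `localSeries`(ρ²). -/
theorem integral_annulusIntegrand {c d : ℤ → ℂ} {U : Set ℝ} (hU : IsOpen U)
    (hc : LaurentConv c U) (hd : LaurentConv d U) {γ : ℝ}
    (h0 : ∀ n : ℤ, (n : ℝ) + γ = 0 → c n = 0) {P : ℝ → ℝ} (hP : ContDiff ℝ 1 P)
    {x y : ℝ} (hxy : x ≤ y) (hsub : Set.Icc x y ⊆ U) :
    ∫ z in {z | x < ‖z‖ ∧ ‖z‖ < y}, annulusIntegrand c d γ P z =
      P (y ^ 2) * localSeries c d γ (y ^ 2) - P (x ^ 2) * localSeries c d γ (x ^ 2) := by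
  have hx0 : 0 < x := hc.1 (hsub ⟨le_rfl, hxy⟩)
  have hmeas : MeasurableSet {z : ℂ | x < ‖z‖ ∧ ‖z‖ < y} :=
    (isOpen_lt continuous_const continuous_norm).inter
      (isOpen_lt continuous_norm continuous_const) |>.measurableSet
  have hpol : ∀ p : ℝ × ℝ, Complex.polarCoord.symm p = p.1 * exp (p.2 * I) := fun p => by
    rw [Complex.polarCoord_symm_apply, exp_mul_I, ← ofReal_cos, ← ofReal_sin]
  have hnorm : ∀ ρ θ : ℝ, 0 < ρ → ‖(ρ : ℂ) * exp (θ * I)‖ = ρ := fun ρ θ hρ => by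
    rw [norm_mul, norm_exp_ofReal_mul_I, mul_one, norm_real, Real.norm_of_nonneg hρ.le]
  rw [← integral_indicator hmeas, ← Complex.integral_comp_polarCoord_symm, polarCoord_target]
  set f := annulusIntegrand c d γ P with hf
  have hstep : ∫ p in Set.Ioi (0 : ℝ) ×ˢ Set.Ioo (-Real.pi) Real.pi,
      p.1 • Set.indicator {z : ℂ | x < ‖z‖ ∧ ‖z‖ < y} f (Complex.polarCoord.symm p) =
      ∫ p in Set.Ioo x y ×ˢ Set.Ioo (-Real.pi) Real.pi,
        p.1 • f (p.1 * exp (p.2 * I)) := by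
    rw [← integral_indicator (measurableSet_Ioi.prod measurableSet_Ioo),
      ← integral_indicator (measurableSet_Ioo.prod measurableSet_Ioo)]
    congr 1
    ext p
    by_cases h1 : p.1 ∈ Set.Ioi (0 : ℝ)
    · by_cases h2 : p.2 ∈ Set.Ioo (-Real.pi) Real.pi
      · rw [Set.indicator_of_mem (Set.mk_mem_prod h1 h2), hpol]
        have hn := hnorm p.1 p.2 h1
        by_cases h3 : p.1 ∈ Set.Ioo x y
        · rw [Set.indicator_of_mem (s := Set.Ioo x y ×ˢ Set.Ioo (-Real.pi) Real.pi) ⟨h3, h2⟩,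
            Set.indicator_of_mem]
          exact ⟨hn.symm ▸ h3.1, hn.symm ▸ h3.2⟩
        · rw [Set.indicator_of_notMem (s := Set.Ioo x y ×ˢ Set.Ioo (-Real.pi) Real.pi)
            fun h => h3 h.1, Set.indicator_of_notMem, smul_zero]
          exact fun h => h3 ⟨hn ▸ h.1, hn ▸ h.2⟩
      · rw [Set.indicator_of_notMem fun h => h2 h.2, Set.indicator_of_notMem fun h => h2 h.2]
    · rw [Set.indicator_of_notMem fun h => h1 h.1, Set.indicator_of_notMem fun h => h1
        (hx0.trans h.1.1)]
  rw [hstep]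
  have hcont : ContinuousOn (fun p : ℝ × ℝ => p.1 • f (p.1 * exp (p.2 * I)))
      (Set.Icc x y ×ˢ Set.Icc (-Real.pi) Real.pi) := by
    refine continuous_fst.continuousOn.smul
      ((continuousOn_annulusIntegrand hU hc hd γ hP).comp (by fun_prop) ?_)
    rintro p ⟨hp, -⟩
    simp only [Set.mem_ofPred_eq, hnorm _ _ (hx0.trans_le hp.1)]
    exact hsub hp
  have hintg : IntegrableOn (fun p : ℝ × ℝ => p.1 • f (p.1 * exp (p.2 * I)))
      (Set.Ioo x y ×ˢ Set.Ioo (-Real.pi) Real.pi) :=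
    (hcont.integrableOn_compact (isCompact_Icc.prod isCompact_Icc)).mono_set
      (Set.prod_mono Set.Ioo_subset_Icc_self Set.Ioo_subset_Icc_self)
  rw [Measure.volume_eq_prod] at hintg ⊢
  rw [setIntegral_prod _ hintg]
  have hcirc : ∀ ρ ∈ Set.Ioo x y, ∫ θ in Set.Ioo (-Real.pi) Real.pi,
      ρ • f (ρ * exp (θ * I)) = 2 * ρ * (deriv P (ρ ^ 2) * localSeries c d γ (ρ ^ 2) +
        P (ρ ^ 2) * (Real.pi * ((((ρ ^ 2) ^ γ : ℝ) : ℂ) *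
      laurent (fun n => c n * conj (d n)) ((ρ ^ 2 : ℝ) : ℂ) / ((ρ ^ 2 : ℝ) : ℂ)))) := by
    intro ρ hρ
    have hρ0 : 0 < ρ := hx0.trans hρ.1
    have hρU : ρ ∈ U := hsub ⟨hρ.1.le, hρ.2.le⟩
    have hci : ∀ e : ℤ → ℂ, LaurentConv e U → Integrable
        (fun θ : ℝ => laurent e (ρ * exp (θ * I)) * conj (laurent d (ρ * exp (θ * I))))
        (volume.restrict (Set.Ioo (-Real.pi) Real.pi)) := by
      intro e he
      refine (Continuous.integrableOn_Icc (a := -Real.pi) (b := Real.pi) ?_).mono_set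
        Set.Ioo_subset_Icc_self
      have hlc : ∀ e : ℤ → ℂ, LaurentConv e U → Continuous
          fun θ : ℝ => laurent e (ρ * exp (θ * I)) := by
        intro e he
        rw [continuous_iff_continuousAt]
        intro θ
        refine ContinuousAt.comp (f := fun θ : ℝ => (ρ : ℂ) * exp (θ * I)) (g := laurent e) ?_
          (by fun_prop)
        exact (he.differentiableAt hU (by rwa [hnorm _ _ hρ0])).continuousAt
      exact (hlc e he).mul (continuous_conj.comp (hlc d hd))
    have hexp : ∀ θ : ℝ, ρ • f (ρ * exp (θ * I)) =
        (ρ * ((ρ ^ (2 * γ) : ℝ) : ℂ) * P (ρ ^ 2) / ((ρ ^ 2 : ℝ) : ℂ)) *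
          (laurent c (ρ * exp (θ * I)) * conj (laurent d (ρ * exp (θ * I)))) +
        (ρ * ((ρ ^ (2 * γ) : ℝ) : ℂ) * deriv P (ρ ^ 2)) *
          (laurent (fun n => c n / (n + γ)) (ρ * exp (θ * I)) *
            conj (laurent d (ρ * exp (θ * I)))) := by
      intro θ
      rw [hf, annulusIntegrand, hnorm _ _ hρ0, real_smul]
      ring
    simp only [hexp]
    rw [integral_add ((hci c hc).const_mul _) ((hci _ (hc.div γ)).const_mul _),
      integral_const_mul, integral_const_mul,
      integral_laurent_mul_conj hρ0 (hc.2 _ hρU) (hd.2 _ hρU),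
      integral_laurent_mul_conj hρ0 ((hc.div γ).2 _ hρU) (hd.2 _ hρU), localSeries,
      show (ρ ^ 2) ^ γ = ρ ^ (2 * γ) by rw [← Real.rpow_natCast_mul hρ0.le]; norm_num]
    have : (fun n : ℤ => c n / (n + γ) * conj (d n)) = fun n : ℤ => c n * conj (d n) / (n + γ) := by
      ext n; ring
    rw [this]
    ring
  rw [setIntegral_congr_fun measurableSet_Ioo hcirc, ← integral_Ioc_eq_integral_Ioo,
    ← intervalIntegral.integral_of_le hxy]
  have hder : ∀ ρ ∈ U, HasDerivAt (fun ρ : ℝ => (P (ρ ^ 2) : ℂ) * localSeries c d γ (ρ ^ 2))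
      (2 * ρ * (deriv P (ρ ^ 2) * localSeries c d γ (ρ ^ 2) +
        P (ρ ^ 2) * (Real.pi * ((((ρ ^ 2) ^ γ : ℝ) : ℂ) *
      laurent (fun n => c n * conj (d n)) ((ρ ^ 2 : ℝ) : ℂ) / ((ρ ^ 2 : ℝ) : ℂ))))) ρ := by
    intro ρ hρ
    have h1 : HasDerivAt (fun N : ℝ => (P N : ℂ)) ((deriv P (ρ ^ 2) : ℝ) : ℂ) (ρ ^ 2) :=
      ((hP.differentiable one_ne_zero).differentiableAt.hasDerivAt).ofReal_comp
    have h2 := h1.mul (hasDerivAt_localSeries hU hc hd h0 hρ)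
    have h3 := HasDerivAt.scomp (h := fun ρ : ℝ => ρ ^ 2) ρ h2 (by simpa using hasDerivAt_pow 2 ρ)
    refine h3.congr_deriv ?_
    rw [real_smul]
    push_cast
    ring
  rw [intervalIntegral.integral_eq_sub_of_hasDerivAt (fun ρ hρ => hder ρ (hsub (by
    rwa [Set.uIcc_of_le hxy] at hρ)))]
  refine ContinuousOn.intervalIntegrable ?_
  rw [Set.uIcc_of_le hxy]
  intro ρ hρ
  have hρU := hsub hρ
  have hρ0 : 0 < ρ := hx0.trans_le hρ.1
  have hP' : Continuous (deriv P) := hP.continuous_deriv le_rfl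
  have hsq : ContinuousAt (fun ρ : ℝ => ρ ^ 2) ρ := by fun_prop
  have k1 : ContinuousAt (fun ρ : ℝ => localSeries c d γ (ρ ^ 2)) ρ :=
    ContinuousAt.comp (f := fun ρ : ℝ => ρ ^ 2)
      (hasDerivAt_localSeries hU hc hd h0 hρU).continuousAt hsq
  set V : Set ℝ := Set.Ioi 0 ∩ (fun x => √x) ⁻¹' U with hV
  have hVo : IsOpen V := isOpen_Ioi.inter (hU.preimage Real.continuous_sqrt)
  have he : LaurentConv (fun n => c n * conj (d n)) V := hc.mul_conj hd fun x hx => hx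
  have hmem : ‖((ρ ^ 2 : ℝ) : ℂ)‖ ∈ V := by
    rw [norm_real, Real.norm_of_nonneg (by positivity)]
    exact ⟨by simp only [Set.mem_Ioi]; positivity, by simpa [Real.sqrt_sq hρ0.le] using hρU⟩
  have k2 : ContinuousAt (fun ρ : ℝ => laurent (fun n => c n * conj (d n)) ((ρ ^ 2 : ℝ) : ℂ)) ρ :=
    ContinuousAt.comp (f := fun ρ : ℝ => ((ρ ^ 2 : ℝ) : ℂ))
      (he.differentiableAt hVo hmem).continuousAt (continuous_ofReal.continuousAt.comp hsq)
  have k3 : ContinuousAt (fun ρ : ℝ => ((P (ρ ^ 2) : ℝ) : ℂ)) ρ :=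
    (continuous_ofReal.comp (hP.continuous.comp (by fun_prop))).continuousAt
  have k4 : ContinuousAt (fun ρ : ℝ => ((deriv P (ρ ^ 2) : ℝ) : ℂ)) ρ :=
    (continuous_ofReal.comp (hP'.comp (by fun_prop))).continuousAt
  have k5 : ContinuousAt (fun ρ : ℝ => (((ρ ^ 2) ^ γ : ℝ) : ℂ)) ρ :=
    continuous_ofReal.continuousAt.comp (hsq.rpow_const (Or.inl (by positivity)))
  have k6 : ContinuousAt (fun ρ : ℝ => ((ρ ^ 2 : ℝ) : ℂ)) ρ :=
    continuous_ofReal.continuousAt.comp hsq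
  have k7 : ((ρ ^ 2 : ℝ) : ℂ) ≠ 0 := by exact_mod_cast (by positivity : ρ ^ 2 ≠ 0)
  have k8 : ContinuousAt (fun ρ : ℝ => (2 * ρ : ℂ)) ρ := by fun_prop
  exact (k8.mul ((k4.mul k1).add (k3.mul (continuousAt_const.mul
    ((k5.mul k2).div k6 k7))))).continuousWithinAt

/-! ### Partial derivatives and Stokes' theorem in the half-plane -/

/-- `f` is real differentiable at `z`, with partial derivatives `a` and `b`. -/
def HasPartials (f : ℂ → ℂ) (a b z : ℂ) : Prop :=
  HasFDerivAt f (reCLM.smulRight a + imCLM.smulRight b) z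

namespace HasPartials

variable {f g : ℂ → ℂ} {a b c d z : ℂ}

theorem const (w z : ℂ) : HasPartials (fun _ => w) 0 0 z := by
  refine (hasFDerivAt_const w z).congr_fderiv ?_
  ext; simp

theorem sub (hf : HasPartials f a b z) (hg : HasPartials g c d z) :
    HasPartials (fun z => f z - g z) (a - c) (b - d) z := by
  refine (HasFDerivAt.sub hf hg).congr_fderiv ?_
  ext; simp; ring

theorem add (hf : HasPartials f a b z) (hg : HasPartials g c d z) :
    HasPartials (fun z => f z + g z) (a + c) (b + d) z := by
  refine (HasFDerivAt.add hf hg).congr_fderiv ?_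
  ext; simp; ring

theorem mul (hf : HasPartials f a b z) (hg : HasPartials g c d z) :
    HasPartials (fun z => f z * g z) (a * g z + f z * c) (b * g z + f z * d) z := by
  refine (HasFDerivAt.mul hf hg).congr_fderiv ?_
  ext; simp; ring

theorem conj_partials (hf : HasPartials f a b z) :
    HasPartials (fun z => conj (f z)) (conj a) (conj b) z := by
  refine (conjCLE.hasFDerivAt.comp z hf).congr_fderiv ?_
  ext; simp

theorem of_hasDerivAt (hf : HasDerivAt f a z) : HasPartials f a (I * a) z := by
  refine (hf.hasFDerivAt.restrictScalars ℝ).congr_fderiv ?_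
  ext v
  simp only [ContinuousLinearMap.coe_restrictScalars', ContinuousLinearMap.toSpanSingleton_apply,
    smul_eq_mul, add_apply, ContinuousLinearMap.smulRight_apply, reCLM_apply,
    imCLM_apply, real_smul]
  conv_lhs => rw [← re_add_im v]
  ring

theorem re (z : ℂ) : HasPartials (fun z => (z.re : ℂ)) 1 0 z := by
  refine ((ofRealCLM.comp reCLM).hasFDerivAt (x := z)).congr_fderiv ?_
  ext; simp

theorem im (z : ℂ) : HasPartials (fun z => (z.im : ℂ)) 0 1 z := by
  refine ((ofRealCLM.comp imCLM).hasFDerivAt (x := z)).congr_fderiv ?_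
  ext; simp

/-- A real function of the squared distance to the real point `e`. -/
theorem radial {P : ℝ → ℝ} {p e : ℝ} (h : HasDerivAt P p ((z.re - e) ^ 2 + z.im ^ 2)) :
    HasPartials (fun z => (P ((z.re - e) ^ 2 + z.im ^ 2) : ℂ)) (2 * (z.re - e) * p)
      (2 * z.im * p) z := by
  have h1 : HasFDerivAt (fun z : ℂ => (z.re - e) ^ 2 + z.im ^ 2)
      (((2 : ℝ) * (z.re - e)) • reCLM + ((2 : ℝ) * z.im) • imCLM) z := by
    have hr : HasFDerivAt (fun z : ℂ => z.re - e) reCLM z := reCLM.hasFDerivAt.sub_const e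
    have hi : HasFDerivAt (fun z : ℂ => z.im) imCLM z := imCLM.hasFDerivAt
    refine ((hr.pow 2).add (hi.pow 2)).congr_fderiv ?_
    ext; simp
  have h2 := h.ofReal_comp.hasFDerivAt.comp z h1
  refine h2.congr_fderiv ?_
  ext v; simp; ring

end HasPartials

/-- Stokes' theorem on the upper half-plane for the compactly supported 1-form `K₁ dx + K₂ dy`. -/
theorem integral_upperHalfPlane_eq {K₁ K₂ J : ℂ → ℂ} {T : ℝ} (hT : 0 < T)
    (h₁ : ContinuousOn K₁ {z | 0 ≤ z.im}) (h₂ : ContinuousOn K₂ {z | 0 ≤ z.im})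
    (hs₁ : ∀ z : ℂ, T ≤ ‖z‖ → K₁ z = 0) (hs₂ : ∀ z : ℂ, T ≤ ‖z‖ → K₂ z = 0)
    {a₁ b₁ a₂ b₂ : ℂ → ℂ}
    (hd₁ : ∀ z : ℂ, 0 < z.im → HasPartials K₁ (a₁ z) (b₁ z) z)
    (hd₂ : ∀ z : ℂ, 0 < z.im → HasPartials K₂ (a₂ z) (b₂ z) z)
    (hJ : ∀ z : ℂ, 0 < z.im → a₂ z - b₁ z = -2 * I * J z)
    (hsJ : ∀ z : ℂ, T ≤ ‖z‖ → J z = 0) (hJi : Integrable J) :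
    ∫ z in {z : ℂ | 0 < z.im}, J z = I / 2 * ∫ x in (-T)..T, K₁ x := by
  set e : ℝ × ℝ → ℂ := fun p => equivRealProdCLM.symm p with he
  have he' : ∀ p, e p = p.1 + p.2 * I := fun p => equivRealProd_symm_apply p
  have hec : Continuous e := equivRealProdCLM.symm.continuous
  have hre : ∀ p, (e p).re = p.1 := fun p => by simp [he']
  have him : ∀ p, (e p).im = p.2 := fun p => by simp [he']
  have hTre : ∀ p : ℝ × ℝ, T ≤ |p.1| → T ≤ ‖e p‖ := fun p hp =>
    hp.trans (by rw [← hre p]; exact abs_re_le_norm _)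
  have hTim : ∀ p : ℝ × ℝ, T ≤ |p.2| → T ≤ ‖e p‖ := fun p hp =>
    hp.trans (by rw [← him p]; exact abs_im_le_norm _)
  have hmp : MeasurePreserving e volume volume := volume_preserving_equiv_real_prod.symm
  have hme : MeasurableEmbedding e := measurableEquivRealProd.symm.measurableEmbedding
  have hJe : Integrable (fun p => J (e p)) := (hmp.integrable_comp_emb hme).2 hJi
  have hmap : ∀ p : ℝ × ℝ, p ∈ Set.Icc (-T, (0 : ℝ)) (T, T) → e p ∈ {z : ℂ | 0 ≤ z.im} := by
    intro p hp
    simp only [Set.mem_ofPred_eq, him]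
    exact hp.1.2
  have hder : ∀ (K : ℂ → ℂ) (a b : ℂ) (p : ℝ × ℝ), HasPartials K a b (e p) →
      HasFDerivAt (fun p => K (e p)) ((reCLM.smulRight a + imCLM.smulRight b).comp
        (equivRealProdCLM.symm : ℝ × ℝ →L[ℝ] ℂ)) p := fun K a b p h =>
    HasFDerivAt.comp (f := e) p h (equivRealProdCLM.symm.hasFDerivAt)
  have hdiv : ∀ p : ℝ × ℝ, 0 < p.2 → a₂ (e p) - b₁ (e p) = -2 * I * J (e p) := fun p hp =>
    hJ _ (by rwa [him])
  have hnull : volume {p : ℝ × ℝ | p.2 = 0} = 0 := by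
    have : {p : ℝ × ℝ | p.2 = 0} = Set.univ ×ˢ {0} := by ext p; simp
    rw [this, Measure.volume_eq_prod, Measure.prod_prod]
    simp
  have hne : ∀ᵐ p : ℝ × ℝ, p.2 ≠ 0 := by
    rw [ae_iff]
    simpa using hnull
  set f' : ℝ × ℝ → ℝ × ℝ →L[ℝ] ℂ := fun p =>
    (reCLM.smulRight (a₂ (e p)) + imCLM.smulRight (b₂ (e p))).comp
        (equivRealProdCLM.symm : ℝ × ℝ →L[ℝ] ℂ) with hf'
  set g' : ℝ × ℝ → ℝ × ℝ →L[ℝ] ℂ := fun p =>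
    -(reCLM.smulRight (a₁ (e p)) + imCLM.smulRight (b₁ (e p))).comp
        (equivRealProdCLM.symm : ℝ × ℝ →L[ℝ] ℂ) with hg'
  have hval : ∀ p, f' p (1, 0) + g' p (0, 1) = a₂ (e p) - b₁ (e p) := by
    intro p
    have h1 : equivRealProdCLM.symm ((1 : ℝ), (0 : ℝ)) = 1 := by
      apply Complex.ext <;> simp
    have h2 : equivRealProdCLM.symm ((0 : ℝ), (1 : ℝ)) = I := by
      apply Complex.ext <;> simp
    simp [hf', hg', h1, h2, sub_eq_add_neg]
  have hae : (fun p => f' p (1, 0) + g' p (0, 1)) =ᵐ[volume.restrict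
      (Set.Icc ((-T : ℝ), (0 : ℝ)) (T, T))] fun p => -2 * I * J (e p) := by
    filter_upwards [ae_restrict_mem measurableSet_Icc, ae_restrict_of_ae hne] with p hp hp0
    rw [hval]
    exact hdiv p (lt_of_le_of_ne hp.1.2 (Ne.symm hp0))
  -- The divergence theorem for the field (K₂, -K₁) on the rectangle [-T, T] × [0, T]. On the three
  -- sides off the real axis the norm is at least T, so the form vanishes there.
  have key := integral_divergence_prod_Icc_of_hasFDerivAt_of_le (fun p => K₂ (e p))
    (fun p => -K₁ (e p)) f' g' (-T, 0) (T, T)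
    ⟨by simp only; linarith, hT.le⟩
    (h₂.comp hec.continuousOn hmap) (h₁.comp hec.continuousOn hmap).neg
    (fun p hp => hder _ _ _ _ (hd₂ _ (by rw [him]; exact hp.2.1)))
    (fun p hp => (hder _ _ _ _ (hd₁ _ (by rw [him]; exact hp.2.1))).neg)
    ((integrableOn_congr_fun_ae hae).2 (hJe.const_mul _).integrableOn)
  rw [integral_congr_ae hae] at key
  have hset : ∫ p in Set.Icc ((-T : ℝ), (0 : ℝ)) (T, T), -2 * I * J (e p) =
      ∫ p in {p : ℝ × ℝ | 0 < p.2}, -2 * I * J (e p) := by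
    rw [← integral_indicator measurableSet_Icc,
      ← integral_indicator (measurableSet_lt measurable_const measurable_snd)]
    refine integral_congr_ae ?_
    filter_upwards [hne] with p hp0
    by_cases hp : p ∈ Set.Icc ((-T : ℝ), (0 : ℝ)) (T, T)
    · rw [Set.indicator_of_mem hp, Set.indicator_of_mem]
      exact lt_of_le_of_ne hp.1.2 (Ne.symm hp0)
    · rw [Set.indicator_of_notMem hp]
      by_cases hp2 : 0 < p.2
      · have : J (e p) = 0 := by
          apply hsJ
          by_contra hlt
          rw [not_le] at hlt
          have h1 : |p.1| < T := lt_of_not_ge fun h => hlt.not_ge (hTre p h)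
          have h2 : |p.2| < T := lt_of_not_ge fun h => hlt.not_ge (hTim p h)
          rw [abs_lt] at h1 h2
          exact hp ⟨⟨h1.1.le, hp2.le⟩, ⟨h1.2.le, h2.2.le⟩⟩
        rw [Set.indicator_apply]
        simp [this]
      · rw [Set.indicator_of_notMem]
        exact hp2
  have hpre : {p : ℝ × ℝ | 0 < p.2} = e ⁻¹' {z : ℂ | 0 < z.im} := by
    ext p; simp [him]
  have hT' : T ≤ |T| := le_abs_self T
  have z1 : ∀ x : ℝ, K₁ (e (x, T)) = 0 := fun x => hs₁ _ (hTim _ hT')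
  have z2 : ∀ y : ℝ, K₂ (e (T, y)) = 0 := fun y => hs₂ _ (hTre _ hT')
  have z3 : ∀ y : ℝ, K₂ (e (-T, y)) = 0 := fun y => hs₂ _ (hTre _ (by simpa using hT'))
  have z4 : ∀ x : ℝ, e (x, 0) = x := fun x => by simp [he']
  rw [hset, integral_const_mul, hpre, hmp.setIntegral_preimage_emb hme] at key
  simp only [z1, z2, z3, z4, neg_zero, intervalIntegral.integral_zero,
    intervalIntegral.integral_neg] at key
  linear_combination (I / 2) * key + (∫ z in {z : ℂ | 0 < z.im}, J z) * I_sq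

/-! ### Principal branches up to the boundary of the upper half-plane -/

/-- The closed upper half-plane. -/
def closedUpper : Set ℂ := {z | 0 ≤ z.im}

/-- The upper half-plane together with the negative real axis. -/
def upperLeft : Set ℂ := {z | 0 < z.im ∨ (z.im = 0 ∧ z.re < 0)}

theorem convex_upperLeft : Convex ℝ upperLeft := by
  rw [convex_iff_forall_pos]
  rintro x hx y hy a b ha hb -
  simp only [upperLeft, Set.mem_ofPred_eq, add_im, add_re, real_smul, mul_im, mul_re, ofReal_re,
    ofReal_im, zero_mul, sub_zero, add_zero] at *
  rcases hx with hx | ⟨hx, hx'⟩ <;> rcases hy with hy | ⟨hy, hy'⟩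
  · left; positivity
  · left; rw [hy]; simp; positivity
  · left; rw [hx]; simp; positivity
  · right; rw [hx, hy]; constructor
    · simp
    · nlinarith

theorem neg_mem_slitPlane_of_upperLeft {z : ℂ} (hz : z ∈ upperLeft) : -z ∈ slitPlane := by
  rw [mem_slitPlane_iff]
  rcases hz with hz | ⟨hz, hz'⟩
  · right; simp; exact hz.ne'
  · left; simpa using hz'

/-- On this set arg z = arg(-z) + π. The right-hand side has its cut on the positive axis, so it
extends the principal branch holomorphically across the negative axis. -/
theorem cpow_of_upperLeft {z : ℂ} (hz : z ∈ upperLeft) (γ : ℝ) :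
    z ^ (γ : ℂ) = exp (Real.pi * I * γ) * (-z) ^ (γ : ℂ) := by
  have hz0 : z ≠ 0 := by
    rintro rfl
    rcases hz with hz | ⟨-, hz⟩ <;> simp at hz
  have hlog : log z = log (-z) + Real.pi * I := by
    rcases hz with hz | ⟨hz, hz'⟩
    · rw [log, log, arg_neg_eq_arg_sub_pi_of_im_pos hz, norm_neg]
      push_cast; ring
    · have h1 : z = ((z.re : ℝ) : ℂ) := by
        apply Complex.ext <;> simp [hz]
      have h2 : -z = ((-z.re : ℝ) : ℂ) := by
        rw [ofReal_neg, ← h1]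
      rw [log, log, norm_neg, show arg z = Real.pi by rw [h1, arg_ofReal_of_neg hz'],
        show arg (-z) = 0 by rw [h2, arg_ofReal_of_nonneg (by linarith)]]
      push_cast; ring
  rw [cpow_def_of_ne_zero hz0, cpow_def_of_ne_zero (neg_ne_zero.2 hz0), hlog, ← Complex.exp_add]
  congr 1; ring

/-- The principal logarithm takes the value with argument π on its cut and is therefore continuous
there from above. -/
theorem continuousWithinAt_cpow_closedUpper {z : ℂ} (hz : z ≠ 0) (γ : ℝ) :
    ContinuousWithinAt (fun z : ℂ => z ^ (γ : ℂ)) closedUpper z := by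
  by_cases h : z ∈ slitPlane
  · exact (continuousAt_id.cpow continuousAt_const h).continuousWithinAt
  · have hlog : ContinuousWithinAt log closedUpper z := by
      rw [mem_slitPlane_iff, not_or, not_lt, not_not] at h
      refine continuousWithinAt_log_of_re_neg_of_im_zero (lt_of_le_of_ne h.1 ?_) h.2
      exact fun h0 => hz (Complex.ext h0 h.2)
    have h1 : ContinuousWithinAt (fun z : ℂ => exp (log z * γ)) closedUpper z :=
      (hlog.mul continuousWithinAt_const).cexp
    have h2 : ∀ᶠ y in 𝓝[closedUpper] z, y ^ (γ : ℂ) = exp (log y * γ) := by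
      filter_upwards [nhdsWithin_le_nhds (isOpen_ne.mem_nhds hz)] with y hy
      rw [cpow_def_of_ne_zero hy]
    exact h1.congr_of_eventuallyEq h2 (by rw [cpow_def_of_ne_zero hz])

theorem sub_one_mem_closedUpper {z : ℂ} (hz : z ∈ closedUpper) : z - 1 ∈ closedUpper := by
  simpa [closedUpper] using hz

/-- Two functions which are continuous up to the boundary and agree in the upper half-plane agree
on the boundary. -/
theorem eq_of_continuousWithinAt_closedUpper {f g : ℂ → ℂ} {z : ℂ} (hz : z ∈ closedUpper)
    (hf : ContinuousWithinAt f closedUpper z) (hg : ContinuousWithinAt g closedUpper z)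
    {U : Set ℂ} (hU : U ∈ 𝓝 z) (h : ∀ y ∈ U, 0 < y.im → f y = g y) : f z = g z := by
  have hsub : {y : ℂ | 0 < y.im} ⊆ closedUpper := fun y hy => le_of_lt (Set.mem_ofPred_eq ▸ hy)
  have hcl : z ∈ closure {y : ℂ | 0 < y.im} := by
    rw [closure_setOfPred_lt_im]
    exact hz
  have : (𝓝[{y : ℂ | 0 < y.im}] z).NeBot := mem_closure_iff_nhdsWithin_neBot.1 hcl
  refine tendsto_nhds_unique_of_eventuallyEq (hf.mono hsub) (hg.mono hsub) ?_
  filter_upwards [self_mem_nhdsWithin, nhdsWithin_le_nhds hU] with y hy hyU using h y hyU hy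

/-! ### Scalar blocks with punctures 0, 1, ∞ and their expansions -/

/-- A function holomorphic away from `0`, `1`, multiplied by `(z - 1) ^ α * z ^ β`, and its
expansions at `0`, `∞` and `1`. -/
structure TriBlock (α β : ℝ) where
  a : ℂ → ℂ
  c0 : ℤ → ℂ
  cI : ℤ → ℂ
  c1 : ℤ → ℂ
  diff : DifferentiableOn ℂ a {z | z ≠ 0 ∧ z ≠ 1}
  conv0 : LaurentConv c0 (Set.Ioo 0 1)
  convI : LaurentConv cI (Set.Ioi 1)
  conv1 : LaurentConv c1 (Set.Ioo 0 1)
  eq0 : ∀ z : ℂ, 0 < ‖z‖ → ‖z‖ < 1 →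
    laurent c0 z = z * (exp (Real.pi * I * α) * (1 - z) ^ (α : ℂ) * a z)
  eqI : ∀ z : ℂ, 1 < ‖z‖ → laurent cI z = z * ((1 - z⁻¹) ^ (α : ℂ) * a z)
  eq1 : ∀ z : ℂ, 0 < ‖z‖ → ‖z‖ < 1 → laurent c1 z = z * ((1 + z) ^ (β : ℂ) * a (1 + z))

namespace TriBlock

variable {α β : ℝ} (B : TriBlock α β)

/-- The principal branch of the multivalued function. -/
noncomputable def A (z : ℂ) : ℂ := (z - 1) ^ (α : ℂ) * z ^ (β : ℂ) * B.a z

/-- Termwise primitive of the expansion at `0`. -/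
noncomputable def w0 (z : ℂ) : ℂ := z ^ (β : ℂ) * laurent (fun n => B.c0 n / (n + β)) z

/-- Termwise primitive of the expansion at `1`. -/
noncomputable def w1 (z : ℂ) : ℂ :=
  (z - 1) ^ (α : ℂ) * laurent (fun n => B.c1 n / (n + α)) (z - 1)

/-- Termwise primitive of the expansion at `∞`. -/
noncomputable def wI (z : ℂ) : ℂ :=
  z ^ ((α + β : ℝ) : ℂ) * laurent (fun n => B.cI n / (n + (α + β : ℝ))) z

/-- The coefficients without a primitive vanish. -/
structure NoZero : Prop where
  zero : ∀ n : ℤ, (n : ℝ) + β = 0 → B.c0 n = 0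
  one : ∀ n : ℤ, (n : ℝ) + α = 0 → B.c1 n = 0
  infty : ∀ n : ℤ, (n : ℝ) + (α + β) = 0 → B.cI n = 0

/-- The constant `ω_∞ - ω_1`. -/
noncomputable def C : ℂ := B.wI (1 + I / 2) - B.w1 (1 + I / 2)

/-- The constant `ω_∞ - ω_0`. -/
noncomputable def D : ℂ := B.w1 (1 / 2 + I / 2) - B.w0 (1 / 2 + I / 2) + B.C

theorem sub_one_cpow {z : ℂ} (hz : z ∈ closedUpper) (h1 : z.im ≠ 0 ∨ z.re < 1) :
    (z - 1) ^ (α : ℂ) = exp (Real.pi * I * α) * (1 - z) ^ (α : ℂ) := by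
  rw [cpow_of_upperLeft, neg_sub]
  rcases eq_or_lt_of_le (show 0 ≤ z.im from hz) with h | h
  · right
    refine ⟨by simpa using h.symm, ?_⟩
    rcases h1 with h1 | h1
    · exact absurd h.symm h1
    · simpa using h1
  · left; simpa using h

theorem re_lt_one_of_norm {z : ℂ} (hz : ‖z‖ < 1) : z.re < 1 :=
  (re_le_norm z).trans_lt hz

theorem A_eq_zero_expansion {z : ℂ} (hz : z ∈ closedUpper) (h0 : 0 < ‖z‖) (h1 : ‖z‖ < 1) :
    B.A z = z ^ (β : ℂ) * laurent B.c0 z / z := by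
  have hz0 : z ≠ 0 := norm_pos_iff.1 h0
  rw [A, B.eq0 z h0 h1, sub_one_cpow hz (Or.inr (re_lt_one_of_norm h1))]
  field_simp

theorem A_eq_one_expansion {z : ℂ} (h0 : 0 < ‖z - 1‖) (h1 : ‖z - 1‖ < 1) :
    B.A z = (z - 1) ^ (α : ℂ) * laurent B.c1 (z - 1) / (z - 1) := by
  have hz0 : z - 1 ≠ 0 := norm_pos_iff.1 h0
  rw [A, B.eq1 _ h0 h1, add_sub_cancel]
  field_simp

/-- The principal logarithm of z(1 - 1/z) splits without a multiple of 2πi: both arguments are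
nonnegative and the second is below π/2, so a sum exceeding π would put z - 1 into the lower
half-plane. -/
theorem sub_one_cpow_of_one_lt {z : ℂ} (hz : z ∈ closedUpper) (h1 : 1 < ‖z‖) :
    (z - 1) ^ (α : ℂ) = z ^ (α : ℂ) * (1 - z⁻¹) ^ (α : ℂ) := by
  have hz0 : z ≠ 0 := norm_pos_iff.1 (zero_lt_one.trans h1)
  have hre : 0 < (1 - z⁻¹).re := by
    have : (z⁻¹).re < 1 := re_lt_one_of_norm (by rw [norm_inv]; exact inv_lt_one_of_one_lt₀ h1)
    simpa using this
  have hne : 1 - z⁻¹ ≠ 0 := fun h => by rw [h] at hre; simp at hre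
  have him : 0 ≤ (1 - z⁻¹).im := by
    rw [sub_im, one_im, inv_im, zero_sub, neg_div, neg_neg]
    exact div_nonneg hz (normSq_nonneg z)
  have hm : z - 1 = z * (1 - z⁻¹) := by field_simp
  have harg1 : 0 ≤ arg z := arg_nonneg_iff.2 hz
  have harg2 : 0 ≤ arg (1 - z⁻¹) := arg_nonneg_iff.2 him
  have hpos := Real.pi_pos
  have hsum : arg z + arg (1 - z⁻¹) ∈ Set.Ioc (-Real.pi) Real.pi := by
    refine ⟨by linarith, ?_⟩
    by_contra hgt
    rw [not_le] at hgt
    have h2 : arg z + arg (1 - z⁻¹) < 2 * Real.pi := by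
      have : arg (1 - z⁻¹) < Real.pi / 2 := (abs_lt.1 (abs_arg_lt_pi_div_two_iff.2 (Or.inl hre))).2
      linarith [arg_le_pi z]
    have h3 : (z - 1).im = ‖z‖ * ‖1 - z⁻¹‖ * Real.sin (arg z + arg (1 - z⁻¹)) := by
      rw [Real.sin_add, hm, mul_im]
      have e1 := norm_mul_cos_arg z
      have e2 := norm_mul_sin_arg z
      have e3 := norm_mul_cos_arg (1 - z⁻¹)
      have e4 := norm_mul_sin_arg (1 - z⁻¹)
      rw [← e1, ← e2, ← e3, ← e4]
      ring
    have h4 : Real.sin (arg z + arg (1 - z⁻¹)) < 0 := by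
      have := Real.sin_neg_of_neg_of_neg_pi_lt (x := arg z + arg (1 - z⁻¹) - 2 * Real.pi)
        (by linarith) (by linarith)
      rwa [Real.sin_sub_two_pi] at this
    have h5 : (z - 1).im < 0 := by
      rw [h3]
      exact mul_neg_of_pos_of_neg (mul_pos (norm_pos_iff.2 hz0) (norm_pos_iff.2 hne)) h4
    have : 0 ≤ (z - 1).im := sub_one_mem_closedUpper hz
    linarith
  rw [hm, cpow_def_of_ne_zero (mul_ne_zero hz0 hne), cpow_def_of_ne_zero hz0,
    cpow_def_of_ne_zero hne, (log_mul_eq_add_log_iff hz0 hne).2 hsum, ← Complex.exp_add]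
  congr 1; ring

theorem A_eq_infty_expansion {z : ℂ} (hz : z ∈ closedUpper) (h1 : 1 < ‖z‖) :
    B.A z = z ^ ((α + β : ℝ) : ℂ) * laurent B.cI z / z := by
  have hz0 : z ≠ 0 := norm_pos_iff.1 (zero_lt_one.trans h1)
  rw [A, B.eqI z h1, sub_one_cpow_of_one_lt hz h1, ofReal_add, cpow_add _ _ hz0]
  field_simp

/-- Derivative of `z ^ γ` times a Laurent series with coefficients divided by `n + γ`. -/
theorem _root_.LaurentConv.hasDerivAt_cpow_mul {c : ℤ → ℂ} {U : Set ℝ} (h : LaurentConv c U)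
    (hU : IsOpen U) {γ : ℝ} (h0 : ∀ n : ℤ, (n : ℝ) + γ = 0 → c n = 0) {z : ℂ} (hz : ‖z‖ ∈ U)
    (hs : z ∈ slitPlane) :
    HasDerivAt (fun z => z ^ (γ : ℂ) * laurent (fun n => c n / (n + γ)) z)
      (z ^ (γ : ℂ) * laurent c z / z) z := by
  have hz0 : z ≠ 0 := slitPlane_ne_zero hs
  refine ((hasDerivAt_id z).cpow_const hs |>.mul (h.hasDerivAt_div hU h0 hz)).congr_deriv ?_
  rw [id, cpow_sub _ _ hz0, cpow_one]
  field_simp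
  ring

theorem hasDerivAt_w0 (hB : B.NoZero) {z : ℂ} (hs : z ∈ slitPlane) (h1 : ‖z‖ < 1) :
    HasDerivAt B.w0 (z ^ (β : ℂ) * laurent B.c0 z / z) z :=
  B.conv0.hasDerivAt_cpow_mul isOpen_Ioo hB.zero ⟨norm_pos_iff.2 (slitPlane_ne_zero hs), h1⟩ hs

theorem hasDerivAt_wI (hB : B.NoZero) {z : ℂ} (hs : z ∈ slitPlane) (h1 : 1 < ‖z‖) :
    HasDerivAt B.wI (z ^ ((α + β : ℝ) : ℂ) * laurent B.cI z / z) z :=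
  B.convI.hasDerivAt_cpow_mul isOpen_Ioi hB.infty h1 hs

theorem hasDerivAt_w1 (hB : B.NoZero) {z : ℂ} (hs : z - 1 ∈ slitPlane) (h1 : ‖z - 1‖ < 1) :
    HasDerivAt B.w1 ((z - 1) ^ (α : ℂ) * laurent B.c1 (z - 1) / (z - 1)) z :=
  (B.conv1.hasDerivAt_cpow_mul isOpen_Ioo hB.one
    ⟨norm_pos_iff.2 (slitPlane_ne_zero hs), h1⟩ hs).comp_sub_const z 1

theorem slitPlane_of_im_pos {z : ℂ} (hz : 0 < z.im) : z ∈ slitPlane :=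
  mem_slitPlane_iff.2 (Or.inr hz.ne')

theorem hasDerivAt_w0_of_im_pos (hB : B.NoZero) {z : ℂ} (hz : 0 < z.im) (h1 : ‖z‖ < 1) :
    HasDerivAt B.w0 (B.A z) z := by
  have hs := slitPlane_of_im_pos hz
  rw [B.A_eq_zero_expansion hz.le (norm_pos_iff.2 (slitPlane_ne_zero hs)) h1]
  exact B.hasDerivAt_w0 hB hs h1

theorem hasDerivAt_wI_of_im_pos (hB : B.NoZero) {z : ℂ} (hz : 0 < z.im) (h1 : 1 < ‖z‖) :
    HasDerivAt B.wI (B.A z) z := by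
  rw [B.A_eq_infty_expansion hz.le h1]
  exact B.hasDerivAt_wI hB (slitPlane_of_im_pos hz) h1

theorem hasDerivAt_w1_of_im_pos (hB : B.NoZero) {z : ℂ} (hz : 0 < z.im) (h1 : ‖z - 1‖ < 1) :
    HasDerivAt B.w1 (B.A z) z := by
  have hs : z - 1 ∈ slitPlane := slitPlane_of_im_pos (by simpa using hz)
  rw [B.A_eq_one_expansion (norm_pos_iff.2 (slitPlane_ne_zero hs)) h1]
  exact B.hasDerivAt_w1 hB hs h1

theorem continuousWithinAt_w0 {z : ℂ} (h0 : 0 < ‖z‖) (h1 : ‖z‖ < 1) :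
    ContinuousWithinAt B.w0 closedUpper z :=
  (continuousWithinAt_cpow_closedUpper (norm_pos_iff.1 h0) β).mul
    ((B.conv0.div β).differentiableAt isOpen_Ioo ⟨h0, h1⟩).continuousAt.continuousWithinAt

theorem continuousWithinAt_wI {z : ℂ} (h1 : 1 < ‖z‖) :
    ContinuousWithinAt B.wI closedUpper z :=
  (continuousWithinAt_cpow_closedUpper (norm_pos_iff.1 (zero_lt_one.trans h1)) (α + β)).mul
    ((B.convI.div (α + β)).differentiableAt isOpen_Ioi h1).continuousAt.continuousWithinAt

theorem continuousWithinAt_w1 {z : ℂ} (h0 : 0 < ‖z - 1‖) (h1 : ‖z - 1‖ < 1) :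
    ContinuousWithinAt B.w1 closedUpper z := by
  have hsub : ContinuousWithinAt (fun z : ℂ => z - 1) closedUpper z := by fun_prop
  refine ContinuousWithinAt.comp (f := fun z : ℂ => z - 1) (t := closedUpper)
    (g := fun z => z ^ (α : ℂ) * laurent (fun n => B.c1 n / (n + α)) z) ?_ hsub
    (fun y hy => sub_one_mem_closedUpper hy)
  exact (continuousWithinAt_cpow_closedUpper (norm_pos_iff.1 h0) α).mul
    ((B.conv1.div α).differentiableAt isOpen_Ioo ⟨h0, h1⟩).continuousAt.continuousWithinAt

theorem continuousWithinAt_A {z : ℂ} (h0 : z ≠ 0) (h1 : z ≠ 1) :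
    ContinuousWithinAt B.A closedUpper z := by
  have hsub : ContinuousWithinAt (fun z : ℂ => z - 1) closedUpper z := by fun_prop
  have ha : ContinuousAt B.a z := by
    refine (B.diff.differentiableAt ?_).continuousAt
    exact (isOpen_ne.inter isOpen_ne).mem_nhds ⟨h0, h1⟩
  exact ((ContinuousWithinAt.comp (f := fun z : ℂ => z - 1) (t := closedUpper)
    (g := fun z : ℂ => z ^ (α : ℂ)) (continuousWithinAt_cpow_closedUpper (sub_ne_zero.2 h1) α)
    hsub (fun y hy => sub_one_mem_closedUpper hy)).mul
    (continuousWithinAt_cpow_closedUpper h0 β)).mul ha.continuousWithinAt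

theorem differentiableAt_A {z : ℂ} (hz : 0 < z.im) : DifferentiableAt ℂ B.A z := by
  have ha : DifferentiableAt ℂ B.a z := B.diff.differentiableAt
    ((isOpen_ne.inter isOpen_ne).mem_nhds ⟨fun h => by simp [h] at hz, fun h => by simp [h] at hz⟩)
  have hs : z - 1 ∈ slitPlane := slitPlane_of_im_pos (by simpa using hz)
  exact (((differentiableAt_id.sub_const 1).cpow_const hs).mul
    (differentiableAt_id.cpow_const (slitPlane_of_im_pos hz))).mul ha

/-- Rewriting both powers through -z and -(z - 1) moves their cuts to the right, so that the
negative axis becomes a set of regular points. -/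
theorem differentiableOn_A : DifferentiableOn ℂ B.A upperLeft := by
  have hne : ∀ z ∈ upperLeft, z ≠ 0 ∧ z ≠ 1 := by
    rintro z (hz | ⟨-, hz⟩) <;> refine ⟨fun h => ?_, fun h => ?_⟩ <;> norm_num [h] at hz
  have hsub : ∀ z ∈ upperLeft, z - 1 ∈ upperLeft := by
    rintro z (hz | ⟨hz, hz'⟩)
    · left; simpa using hz
    · right; refine ⟨by simpa using hz, by simp; linarith⟩
  have heq : ∀ z ∈ upperLeft, B.A z = exp (Real.pi * I * α) * (-(z - 1)) ^ (α : ℂ) *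
      (exp (Real.pi * I * β) * (-z) ^ (β : ℂ)) * B.a z := fun z hz => by
    rw [A, cpow_of_upperLeft hz, cpow_of_upperLeft (hsub z hz)]
  intro z hz
  refine DifferentiableWithinAt.congr ?_ heq (heq z hz)
  have ha : DifferentiableAt ℂ B.a z :=
    B.diff.differentiableAt ((isOpen_ne.inter isOpen_ne).mem_nhds (hne z hz))
  have h1 := neg_mem_slitPlane_of_upperLeft hz
  have h2 := neg_mem_slitPlane_of_upperLeft (hsub z hz)
  have h3 : DifferentiableAt ℂ (fun z : ℂ => -(z - 1)) z := by fun_prop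
  exact ((((h3.cpow_const h2).const_mul _).mul ((differentiableAt_id.neg.cpow_const h1).const_mul
    _)).mul ha).differentiableWithinAt

end TriBlock

/-! ### A common primitive in the upper half-plane -/

/-- This is the image under exp of the half-strip Re > 0, 0 < Im < π, which is convex. -/
theorem isPreconnected_upper_one_lt : IsPreconnected {z : ℂ | 0 < z.im ∧ 1 < ‖z‖} := by
  have hconv : Convex ℝ {w : ℂ | 0 < w.re ∧ 0 < w.im ∧ w.im < Real.pi} :=
    (convex_halfSpace_re_gt 0).inter ((convex_halfSpace_im_gt 0).inter (convex_halfSpace_im_lt _))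
  have := hconv.isPreconnected.image exp continuous_exp.continuousOn
  convert this using 1
  ext z
  constructor
  · rintro ⟨h1, h2⟩
    have hz0 : z ≠ 0 := fun h => by simp [h] at h1
    refine ⟨log z, ⟨?_, ?_, ?_⟩, exp_log hz0⟩
    · rw [log_re]; exact Real.log_pos h2
    · rw [log_im]
      exact lt_of_le_of_ne (arg_nonneg_iff.2 h1.le) fun h =>
        h1.ne' (arg_eq_zero_iff.1 h.symm).2.symm.symm
    · rw [log_im]
      exact lt_of_le_of_ne (arg_le_pi z) fun h => h1.ne' (arg_eq_pi_iff.1 h).2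
  · rintro ⟨w, ⟨h1, h2, h3⟩, rfl⟩
    refine ⟨?_, ?_⟩
    · rw [exp_im]
      exact mul_pos (Real.exp_pos _) (Real.sin_pos_of_pos_of_lt_pi h2 h3)
    · rw [norm_exp]; exact Real.one_lt_exp_iff.2 h1

/-- Two primitives of the same function on a preconnected open set differ by a constant. -/
theorem sub_eq_sub_of_hasDerivAt {U : Set ℂ} (hU : IsOpen U) (hc : IsPreconnected U)
    {f g a : ℂ → ℂ} (hf : ∀ z ∈ U, HasDerivAt f (a z) z) (hg : ∀ z ∈ U, HasDerivAt g (a z) z)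
    {z w : ℂ} (hz : z ∈ U) (hw : w ∈ U) : f z - g z = f w - g w := by
  have hd : ∀ z ∈ U, HasDerivAt (f - g) 0 z := fun z hz => by
    simpa using (hf z hz).sub (hg z hz)
  exact hU.is_const_of_deriv_eq_zero hc
    (fun z hz => (hd z hz).differentiableAt.differentiableWithinAt)
    (fun z hz => (hd z hz).deriv) hz hw

namespace TriBlock

variable {α β : ℝ} (B : TriBlock α β)

/-- A primitive of the principal branch, continuous on the closed upper half-plane. -/
structure IsPrimitive (F : ℂ → ℂ) : Prop where
  continuousWithinAt : ∀ z ∈ closedUpper, z ≠ 0 → z ≠ 1 → ContinuousWithinAt F closedUpper z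
  hasDerivAt : ∀ z : ℂ, 0 < z.im → HasDerivAt F (B.A z) z
  infty : ∀ z ∈ closedUpper, 1 < ‖z‖ → F z = B.wI z
  zero : ∀ z ∈ closedUpper, 0 < ‖z‖ → ‖z‖ < 1 → F z = B.w0 z + B.D
  one : ∀ z ∈ closedUpper, 0 < ‖z - 1‖ → ‖z - 1‖ < 1 → F z = B.w1 z + B.C

theorem norm_one_add_I_half : 1 < ‖(1 + I / 2 : ℂ)‖ := by
  rw [← one_lt_sq_iff₀ (norm_nonneg _), Complex.sq_norm, normSq_apply]
  norm_num

theorem norm_I_half : ‖(1 + I / 2 : ℂ) - 1‖ < 1 := by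
  rw [← sq_lt_one_iff₀ (norm_nonneg _), Complex.sq_norm, normSq_apply]
  norm_num

theorem norm_half_add_I_half : ‖(1 / 2 + I / 2 : ℂ)‖ < 1 := by
  rw [← sq_lt_one_iff₀ (norm_nonneg _), Complex.sq_norm, normSq_apply]
  norm_num

theorem norm_half_add_I_half_sub_one : ‖(1 / 2 + I / 2 : ℂ) - 1‖ < 1 := by
  rw [← sq_lt_one_iff₀ (norm_nonneg _), Complex.sq_norm, normSq_apply]
  norm_num

/-- The primitive is built on the convex set `upperLeft` and normalised by ω_∞ at 1 + i/2, which
lies in the regions of the expansions at ∞ and at 1. On each connected region it differs from the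
termwise primitive by a constant. The negative axis is included because no expansion converges at
-1, so continuity there cannot come from a series; on the positive axis every point except 1 is in
the region of the series at 0 or at ∞. -/
theorem exists_isPrimitive (hB : B.NoZero) : ∃ F, B.IsPrimitive F := by
  obtain ⟨F₀, hF₀⟩ := convex_upperLeft.exists_forall_hasDerivWithinAt B.differentiableOn_A
  set z₁ : ℂ := 1 + I / 2 with hz₁
  set F₁ : ℂ → ℂ := fun z => F₀ z - F₀ z₁ + B.wI z₁ with hF₁
  have hop : IsOpen {z : ℂ | 0 < z.im} := isOpen_lt continuous_const continuous_im
  have hd : ∀ z : ℂ, 0 < z.im → HasDerivAt F₁ (B.A z) z := fun z hz => by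
    have h1 : upperLeft ∈ 𝓝 z := mem_of_superset (hop.mem_nhds hz) fun y hy => Or.inl hy
    exact (((hF₀ z (Or.inl hz)).hasDerivAt h1).sub_const _).add_const _
  have hz₁i : 0 < z₁.im := by rw [hz₁]; norm_num
  have h1F : F₁ z₁ = B.wI z₁ := by simp [hF₁]
  have hball : ∀ c : ℂ, Convex ℝ {z : ℂ | 0 < z.im ∧ ‖z - c‖ < 1} := fun c => by
    have h1 : Convex ℝ {z : ℂ | ‖z - c‖ < 1} := by
      have heq : {z : ℂ | ‖z - c‖ < 1} = Metric.ball c 1 := by ext z; simp [dist_eq_norm]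
      rw [heq]
      exact convex_ball c 1
    exact (convex_halfSpace_im_gt 0).inter h1
  have hballo : ∀ c : ℂ, IsOpen {z : ℂ | 0 < z.im ∧ ‖z - c‖ < 1} := fun c =>
    hop.inter (isOpen_lt (by fun_prop : Continuous fun z : ℂ => ‖z - c‖) continuous_const)
  have hI : ∀ z : ℂ, 0 < z.im → 1 < ‖z‖ → F₁ z = B.wI z := by
    intro z hz h1
    have := sub_eq_sub_of_hasDerivAt (hop.inter (isOpen_lt continuous_const continuous_norm))
      isPreconnected_upper_one_lt (f := F₁) (g := B.wI) (fun z hz => hd z hz.1)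
      (fun z hz => B.hasDerivAt_wI_of_im_pos hB hz.1 hz.2) (z := z) (w := z₁) ⟨hz, h1⟩
      ⟨hz₁i, norm_one_add_I_half⟩
    rw [h1F, sub_self, sub_eq_zero] at this
    exact this
  have h1 : ∀ z : ℂ, 0 < z.im → ‖z - 1‖ < 1 → F₁ z = B.w1 z + B.C := by
    intro z hz h1
    have := sub_eq_sub_of_hasDerivAt (hballo 1) (hball 1).isPreconnected (f := F₁) (g := B.w1)
      (fun z hz => hd z hz.1) (fun z hz => B.hasDerivAt_w1_of_im_pos hB hz.1 hz.2) (z := z)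
      (w := z₁) ⟨hz, h1⟩ ⟨hz₁i, norm_I_half⟩
    rw [h1F] at this
    rw [C]
    linear_combination this
  have h0 : ∀ z : ℂ, 0 < z.im → ‖z‖ < 1 → F₁ z = B.w0 z + B.D := by
    intro z hz h0
    have hi : (0 : ℝ) < (1 / 2 + I / 2 : ℂ).im := by norm_num
    have := sub_eq_sub_of_hasDerivAt (hballo 0) (hball 0).isPreconnected (f := F₁) (g := B.w0)
      (fun z hz => hd z hz.1) (fun z hz => B.hasDerivAt_w0_of_im_pos hB hz.1 (by
        simpa using hz.2)) (z := z) (w := 1 / 2 + I / 2) ⟨hz, by simpa using h0⟩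
      ⟨hi, by simpa using norm_half_add_I_half⟩
    rw [h1 _ hi norm_half_add_I_half_sub_one] at this
    rw [D]
    linear_combination this
  classical
  -- On the positive real axis the boundary values are defined by the series that converges there.
  set F : ℂ → ℂ := fun z => if z ∈ upperLeft then F₁ z else
    if ‖z‖ < 1 then B.w0 z + B.D else B.wI z with hF
  have hFu : ∀ z : ℂ, 0 < z.im → F z = F₁ z := fun z hz => if_pos (Or.inl hz)
  have hright : ∀ z ∈ closedUpper, z ≠ 0 → z ∉ upperLeft → z.im = 0 ∧ 0 < z.re := by
    intro z hz hz0 hzu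
    simp only [upperLeft, Set.mem_ofPred_eq, not_or, not_lt, not_and] at hzu
    have hi : z.im = 0 := le_antisymm hzu.1 hz
    exact ⟨hi, lt_of_le_of_ne (hzu.2 hi) fun h => hz0 (Complex.ext h.symm hi)⟩
  have hcont : ∀ z ∈ closedUpper, z ≠ 0 → z ≠ 1 → ContinuousWithinAt F closedUpper z := by
    intro z hz hz0 hz1
    by_cases hzu : z ∈ upperLeft
    · have hn : ∀ᶠ y in 𝓝[closedUpper] z, y ∈ upperLeft := by
        rcases hzu with h | ⟨h, h'⟩
        · exact nhdsWithin_le_nhds (mem_of_superset (hop.mem_nhds h) fun y hy => Or.inl hy)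
        · have ho : IsOpen {z : ℂ | z.re < 0} := isOpen_lt continuous_re continuous_const
          filter_upwards [self_mem_nhdsWithin, nhdsWithin_le_nhds (ho.mem_nhds h')] with y hy hy'
          rcases eq_or_lt_of_le (show 0 ≤ y.im from hy) with hyi | hyi
          · exact Or.inr ⟨hyi.symm, hy'⟩
          · exact Or.inl hyi
      have hF₁c : ContinuousWithinAt F₁ upperLeft z :=
        ((hF₀ z hzu).continuousWithinAt.sub continuousWithinAt_const).add continuousWithinAt_const
      refine ContinuousWithinAt.congr_of_eventuallyEq (f := F₁) ?_ ?_ (if_pos hzu)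
      · exact hF₁c.mono_of_mem_nhdsWithin hn
      · filter_upwards [hn] with y hy using if_pos hy
    · obtain ⟨hi, hr⟩ := hright z hz hz0 hzu
      have hor : IsOpen {z : ℂ | 0 < z.re} := isOpen_lt continuous_const continuous_re
      rcases lt_or_ge ‖z‖ 1 with hlt | hge
      · have hev : ∀ᶠ y in 𝓝[closedUpper] z, F y = B.w0 y + B.D := by
          filter_upwards [self_mem_nhdsWithin, nhdsWithin_le_nhds (hor.mem_nhds hr),
            nhdsWithin_le_nhds ((isOpen_lt continuous_norm continuous_const).mem_nhds hlt)]
            with y hy hyr hyn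
          rcases eq_or_lt_of_le (show 0 ≤ y.im from hy) with hyi | hyi
          · have : y ∉ upperLeft := by
              rintro (h | h)
              · exact h.ne hyi
              · exact lt_asymm h.2 hyr
            rw [hF]; simp only [this, if_false]
            exact if_pos hyn
          · rw [hFu y hyi, h0 y hyi hyn]
        refine ContinuousWithinAt.congr_of_eventuallyEq ((B.continuousWithinAt_w0
          (norm_pos_iff.2 hz0) hlt).add (continuousWithinAt_const (b := B.D))) hev ?_
        exact hev.self_of_nhdsWithin hz
      · have hgt : 1 < ‖z‖ := by
          -- The only positive real number of modulus 1 is the excluded point 1.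
          refine lt_of_le_of_ne hge fun h => hz1 ?_
          have hzr : z = (z.re : ℂ) := Complex.ext rfl (by simpa using hi)
          rw [hzr, norm_real, Real.norm_of_nonneg hr.le] at h
          rw [hzr, ← h, ofReal_one]
        have hev : ∀ᶠ y in 𝓝[closedUpper] z, F y = B.wI y := by
          filter_upwards [self_mem_nhdsWithin, nhdsWithin_le_nhds (hor.mem_nhds hr),
            nhdsWithin_le_nhds ((isOpen_lt continuous_const continuous_norm).mem_nhds hgt)]
            with y hy hyr hyn
          rcases eq_or_lt_of_le (show 0 ≤ y.im from hy) with hyi | hyi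
          · have : y ∉ upperLeft := by
              rintro (h | h)
              · exact h.ne hyi
              · exact lt_asymm h.2 hyr
            rw [hF]; simp only [this, if_false]
            exact if_neg (not_lt.2 (le_of_lt hyn))
          · rw [hFu y hyi, hI y hyi hyn]
        exact ContinuousWithinAt.congr_of_eventuallyEq (B.continuousWithinAt_wI hgt) hev
          (hev.self_of_nhdsWithin hz)
  refine ⟨F, hcont, fun z hz => ?_, fun z hz h => ?_, fun z hz h h' => ?_, fun z hz h h' => ?_⟩
  · refine (hd z hz).congr_of_eventuallyEq ?_
    filter_upwards [hop.mem_nhds hz] with y hy using hFu y hy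
  · refine eq_of_continuousWithinAt_closedUpper hz (hcont z hz ?_ ?_) (B.continuousWithinAt_wI h)
      ((isOpen_lt continuous_const continuous_norm).mem_nhds h)
      fun y hy hyi => by rw [hFu y hyi, hI y hyi hy]
    · rintro rfl; norm_num at h
    · rintro rfl; norm_num at h
  · refine eq_of_continuousWithinAt_closedUpper hz (hcont z hz ?_ ?_)
      ((B.continuousWithinAt_w0 h h').add continuousWithinAt_const)
      ((isOpen_lt continuous_norm continuous_const).mem_nhds h')
      fun y hy hyi => by rw [hFu y hyi, h0 y hyi hy]; rfl
    · rintro rfl; norm_num at h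
    · rintro rfl; norm_num at h'
  · refine eq_of_continuousWithinAt_closedUpper hz (hcont z hz ?_ ?_)
      ((B.continuousWithinAt_w1 h h').add continuousWithinAt_const)
      ((isOpen_lt (by fun_prop : Continuous fun z : ℂ => ‖z - 1‖) continuous_const).mem_nhds h')
      fun y hy hyi => by rw [hFu y hyi, h1 y hyi hy]; rfl
    · rintro rfl; norm_num at h'
    · rintro rfl; norm_num at h

end TriBlock

/-! ### Complex conjugation of blocks and the monodromy relation -/

theorem conj_cpow_ofReal {z : ℂ} (hz : z ∈ slitPlane) (γ : ℝ) :
    conj (z ^ (γ : ℂ)) = conj z ^ (γ : ℂ) := by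
  rw [conj_cpow _ _ (slitPlane_arg_ne_pi hz), conj_ofReal]

theorem conj_ofReal_cpow_of_pos {x : ℝ} (hx : 0 < x) (γ : ℝ) :
    conj ((x : ℂ) ^ (γ : ℂ)) = (x : ℂ) ^ (γ : ℂ) := by
  rw [← ofReal_cpow hx.le, conj_ofReal]

theorem conj_ofReal_cpow_of_neg {x : ℝ} (hx : x < 0) (γ : ℝ) :
    conj ((x : ℂ) ^ (γ : ℂ)) = exp (-2 * Real.pi * I * γ) * (x : ℂ) ^ (γ : ℂ) := by
  have hu : (x : ℂ) ∈ upperLeft := Or.inr ⟨by simp, by simpa using hx⟩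
  rw [cpow_of_upperLeft hu, map_mul, ← ofReal_neg, conj_ofReal_cpow_of_pos (by linarith),
    ← exp_conj, ← mul_assoc, ← Complex.exp_add]
  simp only [map_mul, conj_ofReal, conj_I]
  congr 2; ring

theorem conj_laurent (c : ℤ → ℂ) (z : ℂ) :
    conj (laurent c z) = laurent (fun n => conj (c n)) (conj z) := by
  simp [laurent, conj_tsum]

theorem laurent_const_mul (k : ℂ) (c : ℤ → ℂ) (z : ℂ) :
    laurent (fun n => k * c n) z = k * laurent c z := by
  simp only [laurent, mul_assoc, tsum_mul_left]

theorem one_sub_mem_slitPlane {z : ℂ} (hz : ‖z‖ < 1) : 1 - z ∈ slitPlane :=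
  mem_slitPlane_iff.2 (Or.inl (by simpa using (re_le_norm z).trans_lt hz))

namespace TriBlock

variable {α β : ℝ} (B : TriBlock α β)

/-- The block obtained by complex conjugation of the function and of its argument. -/
noncomputable def star : TriBlock α β where
  a z := conj (B.a (conj z))
  -- In the disc at 0 the principal (z - 1)^α is e^(πiα) (1 - z)^α. Conjugation turns the phase into
  -- its inverse, and this factor restores it.
  c0 n := exp (2 * Real.pi * I * α) * conj (B.c0 n)
  cI n := conj (B.cI n)
  c1 n := conj (B.c1 n)
  diff := by
    intro z hz
    have : DifferentiableAt ℂ B.a (conj z) := B.diff.differentiableAt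
      ((isOpen_ne.inter isOpen_ne).mem_nhds ⟨fun h => hz.1 (by simpa using h),
        fun h => hz.2 (by simpa using congrArg conj h)⟩)
    have := this.conj_conj
    rw [conj_conj] at this
    exact this.differentiableWithinAt
  conv0 := B.conv0.of_le (‖exp (2 * Real.pi * I * α)‖) fun n => by simp
  convI := B.convI.conj_coeff
  conv1 := B.conv1.conj_coeff
  eq0 := by
    intro z h0 h1
    have h := congrArg conj (B.eq0 (conj z) (by simpa using h0) (by simpa using h1))
    rw [conj_laurent, conj_conj] at h
    rw [laurent_const_mul, h]
    have hs := one_sub_mem_slitPlane (z := conj z) (by simpa using h1)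
    simp only [map_mul, conj_conj, conj_cpow_ofReal hs, map_sub, map_one, ← exp_conj, conj_ofReal,
      conj_I]
    have : exp (2 * Real.pi * I * α) * exp (Real.pi * -I * α) = exp (Real.pi * I * α) := by
      rw [← Complex.exp_add]; congr 1; ring
    rw [← this]; ring
  eqI := by
    intro z h1
    have h := congrArg conj (B.eqI (conj z) (by simpa using h1))
    rw [conj_laurent, conj_conj] at h
    rw [h]
    have hs := one_sub_mem_slitPlane (z := (conj z)⁻¹) (by
      rw [norm_inv, RCLike.norm_conj]; exact inv_lt_one_of_one_lt₀ h1)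
    simp only [map_mul, conj_conj, conj_cpow_ofReal hs, map_sub, map_one, map_inv₀]
  eq1 := by
    intro z h0 h1
    have h := congrArg conj (B.eq1 (conj z) (by simpa using h0) (by simpa using h1))
    rw [conj_laurent, conj_conj] at h
    rw [h]
    have hs := one_sub_mem_slitPlane (z := -conj z) (by simpa using h1)
    rw [sub_neg_eq_add] at hs
    simp only [map_mul, conj_conj, conj_cpow_ofReal hs, map_add, map_one]

variable {B}

theorem NoZero.star (hB : B.NoZero) : B.star.NoZero where
  zero n hn := by simp [TriBlock.star, hB.zero n hn]
  one n hn := by simp [TriBlock.star, hB.one n hn]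
  infty n hn := by simp [TriBlock.star, hB.infty n hn]

variable (B)

theorem conj_laurent_div (c : ℤ → ℂ) (γ x : ℝ) :
    conj (laurent (fun n => conj (c n) / (n + γ)) x) = laurent (fun n => c n / (n + γ)) x := by
  rw [conj_laurent]
  simp

/-- At real points the conjugate of a primitive of `B.star` is the boundary value of the reflected
primitive from below. The following formulas record its phase relative to the value from above:
e^(-2πiα) where z - 1 is negative, and a further e^(-2πiβ) where z is negative. -/
theorem conj_star_wI_of_pos {x : ℝ} (hx : 0 < x) : conj (B.star.wI x) = B.wI x := by
  rw [wI, wI, map_mul, conj_ofReal_cpow_of_pos hx]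
  congr 1
  exact conj_laurent_div B.cI (α + β) x

theorem conj_star_wI_of_neg {x : ℝ} (hx : x < 0) :
    conj (B.star.wI x) = exp (-2 * Real.pi * I * (α + β)) * B.wI x := by
  rw [wI, wI, map_mul, conj_ofReal_cpow_of_neg hx, mul_assoc, ← ofReal_add]
  congr 2
  exact conj_laurent_div B.cI (α + β) x

theorem conj_star_laurent0 (x : ℝ) :
    conj (laurent (fun n => B.star.c0 n / (n + β)) x) =
      exp (-2 * Real.pi * I * α) * laurent (fun n => B.c0 n / (n + β)) x := by
  have : (fun n : ℤ => B.star.c0 n / (n + β)) =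
      fun n : ℤ => exp (2 * Real.pi * I * α) * (conj (B.c0 n) / (n + β)) := by
    ext n; simp only [star]; ring
  rw [this, laurent_const_mul, map_mul, conj_laurent_div, ← exp_conj]
  simp only [map_mul, conj_ofReal, conj_I, map_ofNat]
  congr 2; ring

theorem conj_star_w0_of_pos {x : ℝ} (hx : 0 < x) :
    conj (B.star.w0 x) = exp (-2 * Real.pi * I * α) * B.w0 x := by
  rw [w0, w0, map_mul, conj_ofReal_cpow_of_pos hx, conj_star_laurent0]
  ring

theorem conj_star_w0_of_neg {x : ℝ} (hx : x < 0) :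
    conj (B.star.w0 x) = exp (-2 * Real.pi * I * (α + β)) * B.w0 x := by
  rw [w0, w0, map_mul, conj_ofReal_cpow_of_neg hx, conj_star_laurent0, mul_add, Complex.exp_add]
  ring

theorem conj_star_w1_of_pos {x : ℝ} (hx : 1 < x) : conj (B.star.w1 x) = B.w1 x := by
  rw [w1, w1, map_mul, ← ofReal_one, ← ofReal_sub, conj_ofReal_cpow_of_pos (by linarith)]
  congr 1
  exact conj_laurent_div B.c1 α _

theorem conj_star_w1_of_neg {x : ℝ} (hx : x < 1) :
    conj (B.star.w1 x) = exp (-2 * Real.pi * I * α) * B.w1 x := by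
  rw [w1, w1, map_mul, ← ofReal_one, ← ofReal_sub, conj_ofReal_cpow_of_neg (by linarith),
    mul_assoc]
  congr 2
  exact conj_laurent_div B.c1 α _

theorem ofReal_mem_closedUpper (x : ℝ) : (x : ℂ) ∈ closedUpper := by simp [closedUpper]

/-- The expansions at ∞ and at 1 overlap on the interval (1, 2), where all branches are continuous
across the axis. Comparison at 3/2 shows that no phase arises. -/
theorem conj_star_C (hB : B.NoZero) : conj B.star.C = B.C := by
  obtain ⟨F, hF⟩ := B.exists_isPrimitive hB
  obtain ⟨G, hG⟩ := B.star.exists_isPrimitive hB.star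
  have hx := ofReal_mem_closedUpper (3 / 2)
  have h1 : 1 < ‖((3 / 2 : ℝ) : ℂ)‖ := by
    rw [norm_real, Real.norm_of_nonneg (by norm_num)]; norm_num
  have h2 : ‖((3 / 2 : ℝ) : ℂ) - 1‖ = 1 / 2 := by
    rw [← ofReal_one, ← ofReal_sub, norm_real]; norm_num
  have e1 := (hF.infty _ hx h1).symm.trans (hF.one _ hx (by rw [h2]; norm_num) (by
    rw [h2]; norm_num))
  have e2 := congrArg conj ((hG.infty _ hx h1).symm.trans (hG.one _ hx (by rw [h2]; norm_num) (by
    rw [h2]; norm_num)))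
  rw [map_add, conj_star_wI_of_pos _ (by norm_num), conj_star_w1_of_pos _ (by norm_num), e1] at e2
  exact (add_left_cancel e2).symm

theorem IsPrimitive.continuousAt_ofReal {F : ℂ → ℂ} (hF : B.IsPrimitive F) {x : ℝ} (h0 : x ≠ 0)
    (h1 : x ≠ 1) : ContinuousAt (fun x : ℝ => F x) x := by
  have := (hF.continuousWithinAt x (ofReal_mem_closedUpper x) (by exact_mod_cast h0)
    (by exact_mod_cast h1)).comp (f := fun x : ℝ => (x : ℂ)) (s := Set.univ)
    continuous_ofReal.continuousWithinAt (fun y _ => ofReal_mem_closedUpper y)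
  rwa [continuousWithinAt_univ] at this

theorem conj_star_eq_of_lt {F G : ℂ → ℂ} (hF : B.IsPrimitive F) (hG : B.star.IsPrimitive G)
    {x : ℝ} (hx : x < -1) : conj (G x) = exp (-2 * Real.pi * I * (α + β)) * F x := by
  have h1 : 1 < ‖(x : ℂ)‖ := by
    rw [norm_real, Real.norm_of_nonpos (by linarith)]; linarith
  rw [hF.infty _ (ofReal_mem_closedUpper x) h1, hG.infty _ (ofReal_mem_closedUpper x) h1,
    conj_star_wI_of_neg _ (by linarith)]

/-- At -1 neither series is available; the relation is carried over from x < -1 by continuity of the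
primitives. -/
theorem conj_star_eq_neg_one {F G : ℂ → ℂ} (hF : B.IsPrimitive F) (hG : B.star.IsPrimitive G) :
    conj (G (-1 : ℝ)) = exp (-2 * Real.pi * I * (α + β)) * F (-1 : ℝ) := by
  have c1 : ContinuousAt (fun x : ℝ => conj (G x)) (-1) :=
    continuous_conj.continuousAt.comp (hG.continuousAt_ofReal _ (by norm_num) (by norm_num))
  have c2 : ContinuousAt (fun x : ℝ => exp (-2 * Real.pi * I * (α + β)) * F x) (-1) :=
    continuousAt_const.mul (hF.continuousAt_ofReal _ (by norm_num) (by norm_num))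
  refine tendsto_nhds_unique_of_eventuallyEq (l := 𝓝[<] (-1))
    (c1.mono_left nhdsWithin_le_nhds) (c2.mono_left nhdsWithin_le_nhds) ?_
  filter_upwards [self_mem_nhdsWithin] with x hx using B.conj_star_eq_of_lt hF hG hx

/-- The combination conj G - e^(-2πi(α+β)) F is continuous at -1 and vanishes there. On (-1, 0) the
expansions at 0 show that it is a constant, the difference of the two sides of the claim. -/
theorem conj_star_D (hB : B.NoZero) :
    conj B.star.D = exp (-2 * Real.pi * I * (α + β)) * B.D := by
  obtain ⟨F, hF⟩ := B.exists_isPrimitive hB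
  obtain ⟨G, hG⟩ := B.star.exists_isPrimitive hB.star
  have c1 : ContinuousAt (fun x : ℝ => conj (G x) - exp (-2 * Real.pi * I * (α + β)) * F x) (-1) :=
    (continuous_conj.continuousAt.comp (hG.continuousAt_ofReal _ (by norm_num)
      (by norm_num))).sub
    (continuousAt_const.mul (hF.continuousAt_ofReal _ (by norm_num) (by norm_num)))
  have h0 : Tendsto (fun x : ℝ => conj (G x) - exp (-2 * Real.pi * I * (α + β)) * F x)
      (𝓝[>] (-1)) (𝓝 0) := by
    have := c1.mono_left (nhdsWithin_le_nhds (s := Set.Ioi (-1)))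
    have he := B.conj_star_eq_neg_one hF hG
    simpa only [he, sub_self] using this
  have h1 : Tendsto (fun x : ℝ => conj (G x) - exp (-2 * Real.pi * I * (α + β)) * F x)
      (𝓝[>] (-1)) (𝓝 (conj B.star.D - exp (-2 * Real.pi * I * (α + β)) * B.D)) := by
    refine tendsto_const_nhds.congr' ?_
    filter_upwards [Ioo_mem_nhdsGT (show (-1 : ℝ) < 0 by norm_num)] with x hx
    have hn : ‖(x : ℂ)‖ = -x := by rw [norm_real, Real.norm_of_nonpos hx.2.le]
    have hn0 : 0 < ‖(x : ℂ)‖ := by rw [hn]; linarith [hx.2]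
    have hn1 : ‖(x : ℂ)‖ < 1 := by rw [hn]; linarith [hx.1]
    rw [hF.zero _ (ofReal_mem_closedUpper x) hn0 hn1, hG.zero _ (ofReal_mem_closedUpper x) hn0 hn1,
      map_add, conj_star_w0_of_neg _ hx.2]
    ring
  exact (sub_eq_zero.1 (tendsto_nhds_unique h0 h1).symm)

/-- The primitives satisfy `conj (F* x) = exp (-2 π i (α + β)) * F x` on the negative axis. -/
theorem conj_star_eq_of_neg (hB : B.NoZero) {F G : ℂ → ℂ} (hF : B.IsPrimitive F)
    (hG : B.star.IsPrimitive G) {x : ℝ} (hx : x < 0) :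
    conj (G x) = exp (-2 * Real.pi * I * (α + β)) * F x := by
  rcases lt_trichotomy x (-1) with h | rfl | h
  · exact B.conj_star_eq_of_lt hF hG h
  · exact B.conj_star_eq_neg_one hF hG
  · have hn : ‖(x : ℂ)‖ = -x := by rw [norm_real, Real.norm_of_nonpos hx.le]
    have hn0 : 0 < ‖(x : ℂ)‖ := by rw [hn]; linarith
    have hn1 : ‖(x : ℂ)‖ < 1 := by rw [hn]; linarith
    rw [hF.zero _ (ofReal_mem_closedUpper x) hn0 hn1, hG.zero _ (ofReal_mem_closedUpper x) hn0 hn1,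
      map_add, conj_star_w0_of_neg _ hx, conj_star_D _ hB]
    ring

/-- The monodromy relation between the two constants. -/
theorem D_mul_eq_C_mul (hB : B.NoZero) :
    B.D * (1 - exp (-2 * Real.pi * I * β)) = B.C * (1 - exp (2 * Real.pi * I * α)) := by
  obtain ⟨F, hF⟩ := B.exists_isPrimitive hB
  obtain ⟨G, hG⟩ := B.star.exists_isPrimitive hB.star
  -- The point 1/2 lies in the discs of convergence at 0 and at 1. Equating ω_0 + D with ω_1 + C
  -- there, once for the block and once for its conjugate, and eliminating the series leaves a
  -- relation between C and D.
  have hx := ofReal_mem_closedUpper (1 / 2)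
  have h1 : ‖((1 / 2 : ℝ) : ℂ)‖ = 1 / 2 := by
    rw [norm_real, Real.norm_of_nonneg (by norm_num)]
  have h2 : ‖((1 / 2 : ℝ) : ℂ) - 1‖ = 1 / 2 := by
    rw [← ofReal_one, ← ofReal_sub, norm_real]; norm_num
  have e1 := (hF.zero _ hx (by rw [h1]; norm_num) (by rw [h1]; norm_num)).symm.trans
    (hF.one _ hx (by rw [h2]; norm_num) (by rw [h2]; norm_num))
  have e2 := congrArg conj ((hG.zero _ hx (by rw [h1]; norm_num)
    (by rw [h1]; norm_num)).symm.trans (hG.one _ hx (by rw [h2]; norm_num) (by rw [h2]; norm_num)))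
  rw [map_add, map_add, conj_star_w0_of_pos _ (by norm_num), conj_star_w1_of_neg _ (by norm_num),
    conj_star_C _ hB, conj_star_D _ hB, mul_add, Complex.exp_add] at e2
  have e3 : exp (2 * Real.pi * I * α) * exp (-2 * Real.pi * I * α) = 1 := by
    rw [← Complex.exp_add, ← Complex.exp_zero]; congr 1; ring
  linear_combination (-exp (2 * Real.pi * I * α)) * e2 + e1 +
    (B.w0 ((1 / 2 : ℝ) : ℂ) - B.w1 ((1 / 2 : ℝ) : ℂ) + B.D * exp (-2 * Real.pi * I * β)) * e3

end TriBlock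

/-! ### Cutoff functions around the three punctures -/

/-- Smooth functions of the squared radius which are `1` near `0`, near `1` and near `∞`
respectively. -/
structure Cutoffs (x₀ y₀ x₁ y₁ xI yI : ℝ) where
  P₀ : ℝ → ℝ
  P₁ : ℝ → ℝ
  PI : ℝ → ℝ
  smooth₀ : ContDiff ℝ 2 P₀
  smooth₁ : ContDiff ℝ 2 P₁
  smoothI : ContDiff ℝ 2 PI
  pos₀ : 0 < x₀
  lt₀ : x₀ < y₀
  pos₁ : 0 < x₁
  lt₁ : x₁ < y₁
  ltI : xI < yI
  add_lt : y₀ + y₁ < 1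
  lt_infty : 1 + y₁ < xI
  eq_one₀ : ∀ N ≤ x₀ ^ 2, P₀ N = 1
  eq_zero₀ : ∀ N, y₀ ^ 2 ≤ N → P₀ N = 0
  eq_one₁ : ∀ N ≤ x₁ ^ 2, P₁ N = 1
  eq_zero₁ : ∀ N, y₁ ^ 2 ≤ N → P₁ N = 0
  eq_zeroI : ∀ N ≤ xI ^ 2, PI N = 0
  eq_oneI : ∀ N, yI ^ 2 ≤ N → PI N = 1

theorem deriv_eq_zero_of_eqOn_Iic {P : ℝ → ℝ} (hP : Differentiable ℝ P) {c x : ℝ}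
    (h : ∀ N ≤ x, P N = c) {N : ℝ} (hN : N ≤ x) : deriv P N = 0 := by
  have h1 : HasDerivWithinAt P (deriv P N) (Set.Iic N) N := (hP N).hasDerivAt.hasDerivWithinAt
  have h2 : HasDerivWithinAt P 0 (Set.Iic N) N :=
    (hasDerivWithinAt_const N _ c).congr (fun y hy => h y (le_trans hy hN)) (h N hN)
  exact (uniqueDiffWithinAt_Iic N).eq_deriv _ h1 h2

theorem deriv_eq_zero_of_eqOn_Ici {P : ℝ → ℝ} (hP : Differentiable ℝ P) {c x : ℝ}
    (h : ∀ N, x ≤ N → P N = c) {N : ℝ} (hN : x ≤ N) : deriv P N = 0 := by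
  have h1 : HasDerivWithinAt P (deriv P N) (Set.Ici N) N := (hP N).hasDerivAt.hasDerivWithinAt
  have h2 : HasDerivWithinAt P 0 (Set.Ici N) N :=
    (hasDerivWithinAt_const N _ c).congr (fun y hy => h y (le_trans hN hy)) (h N hN)
  exact (uniqueDiffWithinAt_Ici N).eq_deriv _ h1 h2

theorem sq_dist_ofReal (z : ℂ) (e : ℝ) : (z.re - e) ^ 2 + z.im ^ 2 = ‖z - e‖ ^ 2 := by
  rw [Complex.sq_norm, normSq_apply]; simp; ring

theorem one_sub_norm_le_norm_sub_one (z : ℂ) : 1 - ‖z‖ ≤ ‖z - 1‖ := by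
  have := norm_sub_norm_le (1 : ℂ) z
  rwa [norm_one, norm_sub_rev] at this

theorem norm_sub_one_le_norm_sub_one (z : ℂ) : ‖z‖ - 1 ≤ ‖z - 1‖ := by
  simpa using norm_sub_norm_le z 1

namespace Cutoffs

variable {x₀ y₀ x₁ y₁ xI yI : ℝ}

theorem y₀_pos (Q : Cutoffs x₀ y₀ x₁ y₁ xI yI) : 0 < y₀ := Q.pos₀.trans Q.lt₀
theorem y₁_pos (Q : Cutoffs x₀ y₀ x₁ y₁ xI yI) : 0 < y₁ := Q.pos₁.trans Q.lt₁
theorem y₀_lt_one (Q : Cutoffs x₀ y₀ x₁ y₁ xI yI) : y₀ < 1 := by linarith [Q.add_lt, Q.y₁_pos]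
theorem y₁_lt_one (Q : Cutoffs x₀ y₀ x₁ y₁ xI yI) : y₁ < 1 := by linarith [Q.add_lt, Q.y₀_pos]
theorem one_lt_xI (Q : Cutoffs x₀ y₀ x₁ y₁ xI yI) : 1 < xI := by linarith [Q.lt_infty, Q.y₁_pos]

variable (Q : Cutoffs x₀ y₀ x₁ y₁ xI yI)

theorem one₀ {z : ℂ} (h : ‖z‖ ≤ x₀) : Q.P₀ (‖z‖ ^ 2) = 1 :=
  Q.eq_one₀ _ (pow_le_pow_left₀ (norm_nonneg z) h 2)
theorem zero₀ {z : ℂ} (h : y₀ ≤ ‖z‖) : Q.P₀ (‖z‖ ^ 2) = 0 :=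
  Q.eq_zero₀ _ (pow_le_pow_left₀ Q.y₀_pos.le h 2)
theorem one₁ {z : ℂ} (h : ‖z‖ ≤ x₁) : Q.P₁ (‖z‖ ^ 2) = 1 :=
  Q.eq_one₁ _ (pow_le_pow_left₀ (norm_nonneg z) h 2)
theorem zero₁ {z : ℂ} (h : y₁ ≤ ‖z‖) : Q.P₁ (‖z‖ ^ 2) = 0 :=
  Q.eq_zero₁ _ (pow_le_pow_left₀ Q.y₁_pos.le h 2)
theorem zeroI {z : ℂ} (h : ‖z‖ ≤ xI) : Q.PI (‖z‖ ^ 2) = 0 :=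
  Q.eq_zeroI _ (pow_le_pow_left₀ (norm_nonneg z) h 2)
theorem oneI {z : ℂ} (h : yI ≤ ‖z‖) : Q.PI (‖z‖ ^ 2) = 1 :=
  Q.eq_oneI _ (pow_le_pow_left₀ (by linarith [Q.one_lt_xI, Q.ltI]) h 2)

theorem deriv₀ {z : ℂ} (h : ‖z‖ ≤ x₀ ∨ y₀ ≤ ‖z‖) : deriv Q.P₀ (‖z‖ ^ 2) = 0 := by
  rcases h with h | h
  · exact deriv_eq_zero_of_eqOn_Iic (Q.smooth₀.differentiable two_ne_zero) Q.eq_one₀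
      (pow_le_pow_left₀ (norm_nonneg z) h 2)
  · exact deriv_eq_zero_of_eqOn_Ici (Q.smooth₀.differentiable two_ne_zero) Q.eq_zero₀
      (pow_le_pow_left₀ Q.y₀_pos.le h 2)
theorem deriv₁ {z : ℂ} (h : ‖z‖ ≤ x₁ ∨ y₁ ≤ ‖z‖) : deriv Q.P₁ (‖z‖ ^ 2) = 0 := by
  rcases h with h | h
  · exact deriv_eq_zero_of_eqOn_Iic (Q.smooth₁.differentiable two_ne_zero) Q.eq_one₁
      (pow_le_pow_left₀ (norm_nonneg z) h 2)
  · exact deriv_eq_zero_of_eqOn_Ici (Q.smooth₁.differentiable two_ne_zero) Q.eq_zero₁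
      (pow_le_pow_left₀ Q.y₁_pos.le h 2)
theorem derivI {z : ℂ} (h : ‖z‖ ≤ xI ∨ yI ≤ ‖z‖) : deriv Q.PI (‖z‖ ^ 2) = 0 := by
  rcases h with h | h
  · exact deriv_eq_zero_of_eqOn_Iic (Q.smoothI.differentiable two_ne_zero) Q.eq_zeroI
      (pow_le_pow_left₀ (norm_nonneg z) h 2)
  · exact deriv_eq_zero_of_eqOn_Ici (Q.smoothI.differentiable two_ne_zero) Q.eq_oneI
      (pow_le_pow_left₀ (by linarith [Q.one_lt_xI, Q.ltI]) h 2)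

/-- The part of the partition of unity away from `0`, `1`, `∞`. -/
noncomputable def mid (z : ℂ) : ℝ := 1 - Q.P₀ (‖z‖ ^ 2) - Q.P₁ (‖z - 1‖ ^ 2) - Q.PI (‖z‖ ^ 2)

theorem mid_eq_zero {z : ℂ} (h : ‖z‖ ≤ x₀ ∨ ‖z - 1‖ ≤ x₁ ∨ yI ≤ ‖z‖) : Q.mid z = 0 := by
  have e1 := one_sub_norm_le_norm_sub_one z
  have e2 := norm_sub_one_le_norm_sub_one z
  have f1 := Q.lt₀
  have f2 := Q.lt₁
  have f3 := Q.ltI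
  have f4 := Q.add_lt
  have f5 := Q.lt_infty
  have f6 := Q.y₀_pos
  have f7 := Q.y₁_pos
  rw [mid]
  rcases h with h | h | h
  · rw [Q.one₀ h, Q.zero₁ (by linarith), Q.zeroI (by linarith)]; norm_num
  · rw [Q.zero₀ (by linarith), Q.one₁ h, Q.zeroI (by linarith)]; norm_num
  · rw [Q.zero₀ (by linarith), Q.zero₁ (by linarith), Q.oneI h]; norm_num

theorem continuous_mid : Continuous fun z : ℂ => (Q.mid z : ℂ) := by
  have h0 := Q.smooth₀.continuous
  have h1 := Q.smooth₁.continuous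
  have hI := Q.smoothI.continuous
  unfold mid
  fun_prop

end Cutoffs

theorem exists_cutoff {x y : ℝ} (hxy : x < y) : ∃ P : ℝ → ℝ, ContDiff ℝ 2 P ∧
    (∀ N ≤ x, P N = 0) ∧ ∀ N, y ≤ N → P N = 1 := by
  have hpos : 0 < y - x := sub_pos.2 hxy
  refine ⟨fun N => Real.smoothTransition ((N - x) / (y - x)),
    Real.smoothTransition.contDiff.comp (by fun_prop), fun N hN => ?_, fun N hN => ?_⟩
  · exact Real.smoothTransition.zero_of_nonpos
      (div_nonpos_of_nonpos_of_nonneg (by linarith) hpos.le)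
  · exact Real.smoothTransition.one_of_one_le ((one_le_div hpos).2 (by linarith))

theorem exists_cutoffs {x₀ y₀ x₁ y₁ xI yI : ℝ} (pos₀ : 0 < x₀) (lt₀ : x₀ < y₀) (pos₁ : 0 < x₁)
    (lt₁ : x₁ < y₁) (ltI : xI < yI) (add_lt : y₀ + y₁ < 1) (lt_infty : 1 + y₁ < xI) :
    Nonempty (Cutoffs x₀ y₀ x₁ y₁ xI yI) := by
  obtain ⟨P₀, a1, a2, a3⟩ := exists_cutoff (pow_lt_pow_left₀ lt₀ pos₀.le two_ne_zero)
  obtain ⟨P₁, b1, b2, b3⟩ := exists_cutoff (pow_lt_pow_left₀ lt₁ pos₁.le two_ne_zero)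
  obtain ⟨PI, c1, c2, c3⟩ := exists_cutoff (pow_lt_pow_left₀ ltI (by linarith) two_ne_zero)
  exact ⟨{
    P₀ := fun N => 1 - P₀ N
    P₁ := fun N => 1 - P₁ N
    PI := PI
    smooth₀ := contDiff_const.sub a1
    smooth₁ := contDiff_const.sub b1
    smoothI := c1
    pos₀ := pos₀
    lt₀ := lt₀
    pos₁ := pos₁
    lt₁ := lt₁
    ltI := ltI
    add_lt := add_lt
    lt_infty := lt_infty
    eq_one₀ := fun N hN => by simp [a2 N hN]
    eq_zero₀ := fun N hN => by simp [a3 N hN]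
    eq_one₁ := fun N hN => by simp [b2 N hN]
    eq_zero₁ := fun N hN => by simp [b3 N hN]
    eq_zeroI := c2
    eq_oneI := c3 }⟩

/-! ### The remainder away from the punctures -/

/-- The part of the integrand of an annulus which contains the derivative of the cutoff. -/
noncomputable def radialTerm (c d : ℤ → ℂ) (γ : ℝ) (P : ℝ → ℝ) (z : ℂ) : ℂ :=
  deriv P (‖z‖ ^ 2) * (((‖z‖ ^ (2 * γ) : ℝ) : ℂ) *
    (laurent (fun n => c n / (n + γ)) z * conj (laurent d z)))

theorem continuousOn_radialTerm {c d : ℤ → ℂ} {U : Set ℝ} (hU : IsOpen U)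
    (hc : LaurentConv c U) (hd : LaurentConv d U) (γ : ℝ) {P : ℝ → ℝ} (hP : ContDiff ℝ 2 P) :
    ContinuousOn (radialTerm c d γ P) {z | ‖z‖ ∈ U} := by
  intro z hz
  have hz0 : ‖z‖ ≠ 0 := (hc.1 hz).ne'
  have hP' : Continuous (deriv P) := hP.continuous_deriv one_le_two
  have h2 := ((hc.div γ).differentiableAt hU hz).continuousAt
  have h3 := (hd.differentiableAt hU hz).continuousAt
  have h4 : ContinuousAt (fun z : ℂ => ((‖z‖ ^ (2 * γ) : ℝ) : ℂ)) z :=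
    continuous_ofReal.continuousAt.comp (continuous_norm.continuousAt.rpow_const (Or.inl hz0))
  have h6 : ContinuousAt (fun z : ℂ => ((deriv P (‖z‖ ^ 2) : ℝ) : ℂ)) z :=
    (continuous_ofReal.comp (hP'.comp (continuous_norm.pow 2))).continuousAt
  exact (h6.mul (h4.mul (h2.mul (continuous_conj.continuousAt.comp h3)))).continuousWithinAt

theorem isCompact_annulus (x y : ℝ) : IsCompact {z : ℂ | x ≤ ‖z‖ ∧ ‖z‖ ≤ y} := by
  refine Metric.isCompact_of_isClosed_isBounded ?_ ?_
  · exact (isClosed_le continuous_const continuous_norm).inter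
      (isClosed_le continuous_norm continuous_const)
  · exact (Metric.isBounded_closedBall (x := (0 : ℂ)) (r := y)).subset fun z hz => by
      simpa using hz.2

theorem integrable_radialTerm {c d : ℤ → ℂ} {U : Set ℝ} (hU : IsOpen U)
    (hc : LaurentConv c U) (hd : LaurentConv d U) (γ : ℝ) {P : ℝ → ℝ} (hP : ContDiff ℝ 2 P)
    {x y : ℝ} (hxy : Set.Icc x y ⊆ U)
    (h0 : ∀ z : ℂ, ‖z‖ ≤ x ∨ y ≤ ‖z‖ → deriv P (‖z‖ ^ 2) = 0) :
    Integrable (radialTerm c d γ P) := by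
  rw [← integrableOn_iff_integrable_of_support_subset (s := {z : ℂ | x ≤ ‖z‖ ∧ ‖z‖ ≤ y})]
  · exact ContinuousOn.integrableOn_compact (isCompact_annulus x y)
      ((continuousOn_radialTerm hU hc hd γ hP).mono fun z hz => hxy hz)
  · intro z hz
    by_contra hnot
    refine hz ?_
    rw [radialTerm, h0 z ?_, ofReal_zero, zero_mul]
    by_contra hcon
    rw [not_or, not_le, not_le] at hcon
    exact hnot ⟨hcon.1.le, hcon.2.le⟩

namespace TriBlock

variable {α β : ℝ} (B B' : TriBlock α β)

/-- The phases of the powers cancel, so the product is independent of the branches, although each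
factor jumps across its cuts. -/
theorem A_mul_conj {z : ℂ} :
    B.A z * conj (B'.A z) =
      ((‖z - 1‖ ^ (2 * α) * ‖z‖ ^ (2 * β) : ℝ) : ℂ) * (B.a z * conj (B'.a z)) := by
  have h : ∀ (w : ℂ) (γ : ℝ), w ^ (γ : ℂ) * conj (w ^ (γ : ℂ)) = ((‖w‖ ^ (2 * γ) : ℝ) : ℂ) := by
    intro w γ
    rw [mul_conj, normSq_eq_norm_sq, norm_cpow_real, mul_comm 2 γ, Real.rpow_mul (norm_nonneg w),
      Real.rpow_two]
  rw [A, A, ofReal_mul, ← h, ← h]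
  simp only [map_mul]
  ring

theorem continuousAt_A_mul_conj {z : ℂ} (h0 : z ≠ 0) (h1 : z ≠ 1) :
    ContinuousAt (fun z => B.A z * conj (B'.A z)) z := by
  simp only [A_mul_conj]
  have hn : {z : ℂ | z ≠ 0 ∧ z ≠ 1} ∈ 𝓝 z := (isOpen_ne.inter isOpen_ne).mem_nhds ⟨h0, h1⟩
  have ha := (B.diff.differentiableAt hn).continuousAt
  have ha' := (B'.diff.differentiableAt hn).continuousAt
  have e1 : ContinuousAt (fun z : ℂ => ‖z - 1‖ ^ (2 * α)) z :=
    ContinuousAt.rpow_const (by fun_prop) (Or.inl (norm_ne_zero_iff.2 (sub_ne_zero.2 h1)))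
  have e2 : ContinuousAt (fun z : ℂ => ‖z‖ ^ (2 * β)) z :=
    ContinuousAt.rpow_const (by fun_prop) (Or.inl (norm_ne_zero_iff.2 h0))
  exact (continuous_ofReal.continuousAt.comp (e1.mul e2)).mul
    (ha.mul (continuous_conj.continuousAt.comp ha'))

variable {x₀ y₀ x₁ y₁ xI yI : ℝ} (Q : Cutoffs x₀ y₀ x₁ y₁ xI yI)

/-- What remains of the integrand when the contributions of the annuli are subtracted. -/
noncomputable def rest (z : ℂ) : ℂ :=
  Q.mid z * (B.A z * conj (B'.A z)) - (radialTerm B.c0 B'.c0 β Q.P₀ z +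
    radialTerm B.c1 B'.c1 α Q.P₁ (z - 1) + radialTerm B.cI B'.cI (α + β) Q.PI z)

theorem rest_eq_zero {z : ℂ} (h : ‖z‖ ≤ x₀ ∨ ‖z - 1‖ ≤ x₁ ∨ yI ≤ ‖z‖) : rest B B' Q z = 0 := by
  have e1 := one_sub_norm_le_norm_sub_one z
  have e2 := norm_sub_one_le_norm_sub_one z
  have f1 := Q.lt₀
  have f2 := Q.lt₁
  have f3 := Q.ltI
  have f4 := Q.add_lt
  have f5 := Q.lt_infty
  have f6 := Q.y₀_pos
  have f7 := Q.y₁_pos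
  rw [rest, Q.mid_eq_zero h]
  simp only [radialTerm]
  rcases h with h | h | h
  · rw [Q.deriv₀ (Or.inl h), Q.deriv₁ (Or.inr (by linarith)), Q.derivI (Or.inl (by linarith))]
    simp
  · rw [Q.deriv₀ (Or.inr (by linarith)), Q.deriv₁ (Or.inl h), Q.derivI (Or.inl (by linarith))]
    simp
  · rw [Q.deriv₀ (Or.inr (by linarith)), Q.deriv₁ (Or.inr (by linarith)), Q.derivI (Or.inr h)]
    simp

theorem integrable_rest : Integrable (rest B B' Q) := by
  have i0 : Integrable (radialTerm B.c0 B'.c0 β Q.P₀) :=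
    integrable_radialTerm isOpen_Ioo B.conv0 B'.conv0 β Q.smooth₀
      (fun x hx => ⟨Q.pos₀.trans_le hx.1, hx.2.trans_lt Q.y₀_lt_one⟩) fun z hz => Q.deriv₀ hz
  have i1 : Integrable (radialTerm B.c1 B'.c1 α Q.P₁) :=
    integrable_radialTerm isOpen_Ioo B.conv1 B'.conv1 α Q.smooth₁
      (fun x hx => ⟨Q.pos₁.trans_le hx.1, hx.2.trans_lt Q.y₁_lt_one⟩) fun z hz => Q.deriv₁ hz
  have iI : Integrable (radialTerm B.cI B'.cI (α + β) Q.PI) :=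
    integrable_radialTerm isOpen_Ioi B.convI B'.convI (α + β) Q.smoothI
      (fun x hx => Q.one_lt_xI.trans_le hx.1) fun z hz => Q.derivI hz
  refine Integrable.sub ?_ ((i0.add (i1.comp_sub_right 1)).add iI)
  have hK : IsCompact ({z : ℂ | x₀ ≤ ‖z‖ ∧ ‖z‖ ≤ yI} ∩ {z | x₁ ≤ ‖z - 1‖}) :=
    (isCompact_annulus x₀ yI).inter_right
      (isClosed_le continuous_const (by fun_prop : Continuous fun z : ℂ => ‖z - 1‖))
  rw [← integrableOn_iff_integrable_of_support_subset
    (s := {z : ℂ | x₀ ≤ ‖z‖ ∧ ‖z‖ ≤ yI} ∩ {z | x₁ ≤ ‖z - 1‖})]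
  · refine ContinuousOn.integrableOn_compact hK fun z hz => ?_
    refine (Q.continuous_mid.continuousAt.mul (B.continuousAt_A_mul_conj B' ?_
      ?_)).continuousWithinAt
    · exact norm_pos_iff.1 (Q.pos₀.trans_le hz.1.1)
    · exact sub_ne_zero.1 (norm_pos_iff.1 (Q.pos₁.trans_le hz.2))
  · intro z hz
    by_contra hnot
    refine hz ?_
    beta_reduce
    rw [Q.mid_eq_zero, ofReal_zero, zero_mul]
    by_contra hcon
    simp only [not_or, not_le] at hcon
    exact hnot ⟨⟨hcon.1.le, hcon.2.2.le⟩, hcon.2.1.le⟩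

end TriBlock

/-! ### The remainder as an exact form in the upper half-plane -/

theorem HasPartials.norm_sq {P : ℝ → ℝ} {p : ℝ} {z : ℂ} (h : HasDerivAt P p (‖z‖ ^ 2)) :
    HasPartials (fun z => (P (‖z‖ ^ 2) : ℂ)) (2 * z.re * p) (2 * z.im * p) z := by
  have e : ∀ z : ℂ, ‖z‖ ^ 2 = (z.re - 0) ^ 2 + z.im ^ 2 := fun z => by
    rw [sq_dist_ofReal]; simp
  simp only [e] at h ⊢
  have := HasPartials.radial h
  simpa using this

theorem HasPartials.norm_sub_one_sq {P : ℝ → ℝ} {p : ℝ} {z : ℂ}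
    (h : HasDerivAt P p (‖z - 1‖ ^ 2)) :
    HasPartials (fun z => (P (‖z - 1‖ ^ 2) : ℂ)) (2 * (z.re - 1) * p) (2 * z.im * p) z := by
  have e : ∀ z : ℂ, ‖z - 1‖ ^ 2 = (z.re - 1) ^ 2 + z.im ^ 2 := fun z => by
    rw [sq_dist_ofReal]; simp
  simp only [e] at h ⊢
  have := HasPartials.radial h
  simpa using this

theorem radialTerm_eq (c d : ℤ → ℂ) (γ : ℝ) (P : ℝ → ℝ) {z : ℂ} (hz : z ≠ 0) :
    radialTerm c d γ P z = deriv P (‖z‖ ^ 2) * (conj z *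
      (z ^ (γ : ℂ) * laurent (fun n => c n / (n + γ)) z) *
      conj (z ^ (γ : ℂ) * laurent d z / z)) := by
  have h : z ^ (γ : ℂ) * conj (z ^ (γ : ℂ)) = ((‖z‖ ^ (2 * γ) : ℝ) : ℂ) := by
    rw [mul_conj, normSq_eq_norm_sq, norm_cpow_real, mul_comm 2 γ, Real.rpow_mul (norm_nonneg z),
      Real.rpow_two]
  have hz' : conj z ≠ 0 := by simpa using hz
  rw [radialTerm, ← h]
  simp only [map_mul, map_div₀]
  field_simp

namespace TriBlock

variable {α β : ℝ} (B B' : TriBlock α β) {x₀ y₀ x₁ y₁ xI yI : ℝ}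
  (Q : Cutoffs x₀ y₀ x₁ y₁ xI yI)

/-- The derivative of the cutoff is supported where the expansion at 0 converges, and there the
termwise primitive is F - D. Elsewhere both sides vanish. The analogues at ∞ and at 1 have F and F -
C. -/
theorem radialTerm_zero {F : ℂ → ℂ} (hF : B.IsPrimitive F) {z : ℂ} (hz : z ∈ closedUpper) :
    radialTerm B.c0 B'.c0 β Q.P₀ z =
      deriv Q.P₀ (‖z‖ ^ 2) * (conj z * (F z - B.D) * conj (B'.A z)) := by
  by_cases h : ‖z‖ ≤ x₀ ∨ y₀ ≤ ‖z‖
  · rw [radialTerm, Q.deriv₀ h]; simp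
  · simp only [not_or, not_le] at h
    have h0 : 0 < ‖z‖ := Q.pos₀.trans h.1
    have h1 : ‖z‖ < 1 := h.2.trans Q.y₀_lt_one
    rw [radialTerm_eq _ _ _ _ (norm_pos_iff.1 h0), hF.zero z hz h0 h1, add_sub_cancel_right,
      B'.A_eq_zero_expansion hz h0 h1, w0]

theorem radialTerm_infty {F : ℂ → ℂ} (hF : B.IsPrimitive F) {z : ℂ} (hz : z ∈ closedUpper) :
    radialTerm B.cI B'.cI (α + β) Q.PI z =
      deriv Q.PI (‖z‖ ^ 2) * (conj z * F z * conj (B'.A z)) := by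
  by_cases h : ‖z‖ ≤ xI ∨ yI ≤ ‖z‖
  · rw [radialTerm, Q.derivI h]; simp
  · simp only [not_or, not_le] at h
    have h1 : 1 < ‖z‖ := Q.one_lt_xI.trans h.1
    rw [radialTerm_eq _ _ _ _ (norm_pos_iff.1 (zero_lt_one.trans h1)), hF.infty z hz h1,
      B'.A_eq_infty_expansion hz h1, wI]

theorem radialTerm_one {F : ℂ → ℂ} (hF : B.IsPrimitive F) {z : ℂ} (hz : z ∈ closedUpper) :
    radialTerm B.c1 B'.c1 α Q.P₁ (z - 1) =
      deriv Q.P₁ (‖z - 1‖ ^ 2) * (conj (z - 1) * (F z - B.C) * conj (B'.A z)) := by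
  by_cases h : ‖z - 1‖ ≤ x₁ ∨ y₁ ≤ ‖z - 1‖
  · rw [radialTerm, Q.deriv₁ h]; simp
  · simp only [not_or, not_le] at h
    have h0 : 0 < ‖z - 1‖ := Q.pos₁.trans h.1
    have h1 : ‖z - 1‖ < 1 := h.2.trans Q.y₁_lt_one
    rw [radialTerm_eq _ _ _ _ (norm_pos_iff.1 h0), hF.one z hz h0 h1, add_sub_cancel_right,
      B'.A_eq_one_expansion h0 h1, w1]

/-- The `dx` component of the 1-form whose differential is `rest`. -/
noncomputable def formX (F G : ℂ → ℂ) (z : ℂ) : ℂ :=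
  Q.mid z * F z * conj (B'.A z) -
    conj (G z) * (2 * z.re * (B.D * deriv Q.P₀ (‖z‖ ^ 2)) +
      2 * (z.re - 1) * (B.C * deriv Q.P₁ (‖z - 1‖ ^ 2)))

/-- The `dy` component of the 1-form whose differential is `rest`. -/
noncomputable def formY (F G : ℂ → ℂ) (z : ℂ) : ℂ :=
  -I * (Q.mid z * F z * conj (B'.A z)) -
    conj (G z) * (2 * z.im * (B.D * deriv Q.P₀ (‖z‖ ^ 2)) +
      2 * z.im * (B.C * deriv Q.P₁ (‖z - 1‖ ^ 2)))

theorem deriv₀_eq_zero {z : ℂ} (h : ‖z‖ ≤ x₀ ∨ ‖z - 1‖ ≤ x₁ ∨ yI ≤ ‖z‖) :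
    deriv Q.P₀ (‖z‖ ^ 2) = 0 ∧ deriv Q.P₁ (‖z - 1‖ ^ 2) = 0 := by
  have e1 := one_sub_norm_le_norm_sub_one z
  have e2 := norm_sub_one_le_norm_sub_one z
  have f1 := Q.lt₀
  have f2 := Q.lt₁
  have f3 := Q.ltI
  have f4 := Q.add_lt
  have f5 := Q.lt_infty
  have f6 := Q.y₀_pos
  have f7 := Q.y₁_pos
  rcases h with h | h | h
  · exact ⟨Q.deriv₀ (Or.inl h), Q.deriv₁ (Or.inr (by linarith))⟩
  · exact ⟨Q.deriv₀ (Or.inr (by linarith)), Q.deriv₁ (Or.inl h)⟩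
  · exact ⟨Q.deriv₀ (Or.inr (by linarith)), Q.deriv₁ (Or.inr (by linarith))⟩

theorem form_eq_zero (F G : ℂ → ℂ) {z : ℂ} (h : ‖z‖ ≤ x₀ ∨ ‖z - 1‖ ≤ x₁ ∨ yI ≤ ‖z‖) :
    formX B B' Q F G z = 0 ∧ formY B B' Q F G z = 0 := by
  obtain ⟨h1, h2⟩ := deriv₀_eq_zero Q h
  rw [formX, formY, Q.mid_eq_zero h, h1, h2]
  simp

/-- The primitives need not be continuous at 0 and 1, but the form vanishes in neighbourhoods of
these points. -/
theorem continuousOn_form {F G : ℂ → ℂ} (hF : B.IsPrimitive F) (hG : B'.IsPrimitive G) :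
    ContinuousOn (formX B B' Q F G) closedUpper ∧ ContinuousOn (formY B B' Q F G) closedUpper := by
  have key : ∀ z ∈ closedUpper, ContinuousWithinAt (formX B B' Q F G) closedUpper z ∧
      ContinuousWithinAt (formY B B' Q F G) closedUpper z := by
    intro z hz
    by_cases hz' : ‖z‖ < x₀ ∨ ‖z - 1‖ < x₁
    · have hev : ∀ᶠ y in 𝓝 z, ‖y‖ ≤ x₀ ∨ ‖y - 1‖ ≤ x₁ ∨ yI ≤ ‖y‖ := by
        rcases hz' with h | h
        · filter_upwards [(isOpen_lt continuous_norm continuous_const).mem_nhds h] with y hy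
          exact Or.inl (le_of_lt hy)
        · filter_upwards [(isOpen_lt (by fun_prop : Continuous fun z : ℂ => ‖z - 1‖)
            continuous_const).mem_nhds h] with y hy
          exact Or.inr (Or.inl (le_of_lt hy))
      constructor
      · refine ContinuousAt.continuousWithinAt ((continuousAt_const (y := (0 : ℂ))).congr ?_)
        filter_upwards [hev] with y hy using (form_eq_zero B B' Q F G hy).1.symm
      · refine ContinuousAt.continuousWithinAt ((continuousAt_const (y := (0 : ℂ))).congr ?_)
        filter_upwards [hev] with y hy using (form_eq_zero B B' Q F G hy).2.symm
    · simp only [not_or, not_lt] at hz'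
      have h0 : z ≠ 0 := norm_pos_iff.1 (Q.pos₀.trans_le hz'.1)
      have h1 : z ≠ 1 := sub_ne_zero.1 (norm_pos_iff.1 (Q.pos₁.trans_le hz'.2))
      have c1 := hF.continuousWithinAt z hz h0 h1
      have c2 := continuous_conj.continuousAt.comp_continuousWithinAt
        (hG.continuousWithinAt z hz h0 h1)
      have c3 := continuous_conj.continuousAt.comp_continuousWithinAt
        (B'.continuousWithinAt_A h0 h1)
      have c4 : ContinuousWithinAt (fun z : ℂ => (Q.mid z : ℂ)) closedUpper z :=
        Q.continuous_mid.continuousWithinAt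
      have d0 : Continuous (deriv Q.P₀) := Q.smooth₀.continuous_deriv one_le_two
      have d1 : Continuous (deriv Q.P₁) := Q.smooth₁.continuous_deriv one_le_two
      have c5 : ContinuousWithinAt (fun z : ℂ => 2 * (z.re : ℂ) * (B.D * deriv Q.P₀ (‖z‖ ^ 2)) +
          2 * (z.re - 1) * (B.C * deriv Q.P₁ (‖z - 1‖ ^ 2))) closedUpper z := by
        refine Continuous.continuousWithinAt ?_
        fun_prop
      have c6 : ContinuousWithinAt (fun z : ℂ => 2 * (z.im : ℂ) * (B.D * deriv Q.P₀ (‖z‖ ^ 2)) +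
          2 * z.im * (B.C * deriv Q.P₁ (‖z - 1‖ ^ 2))) closedUpper z := by
        refine Continuous.continuousWithinAt ?_
        fun_prop
      exact ⟨((c4.mul c1).mul c3).sub (c2.mul c5),
        (continuousWithinAt_const.mul ((c4.mul c1).mul c3)).sub (c2.mul c6)⟩
  exact ⟨fun z hz => (key z hz).1, fun z hz => (key z hz).2⟩

/-- With all radial terms expressed by F, the remainder is ∂_z(mid · F) conj A' plus the terms of C
and D. The former is the differential of mid · F · conj A' d(conj z), since conj A' is
antiholomorphic. The latter is that of -conj G (D dP₀ + C dP₁), since conj G is a primitive of conj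
A' in conj z. -/
theorem integral_upper_rest {F G : ℂ → ℂ} (hF : B.IsPrimitive F) (hG : B'.IsPrimitive G) :
    ∫ z in {z : ℂ | 0 < z.im}, rest B B' Q z = I / 2 * ∫ x in (-yI)..yI, formX B B' Q F G x := by
  have hyI : 0 < yI := by linarith [Q.one_lt_xI, Q.ltI]
  have dd0 : Differentiable ℝ (deriv Q.P₀) := Q.smooth₀.differentiable_deriv_two
  have dd1 : Differentiable ℝ (deriv Q.P₁) := Q.smooth₁.differentiable_deriv_two
  have hd0 : ∀ N, HasDerivAt Q.P₀ (deriv Q.P₀ N) N := fun N =>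
    (Q.smooth₀.differentiable two_ne_zero N).hasDerivAt
  have hd1 : ∀ N, HasDerivAt Q.P₁ (deriv Q.P₁ N) N := fun N =>
    (Q.smooth₁.differentiable two_ne_zero N).hasDerivAt
  have hdI : ∀ N, HasDerivAt Q.PI (deriv Q.PI N) N := fun N =>
    (Q.smoothI.differentiable two_ne_zero N).hasDerivAt
  have hmid : ∀ z : ℂ, HasPartials (fun z => (Q.mid z : ℂ))
      (0 - 2 * z.re * deriv Q.P₀ (‖z‖ ^ 2) - 2 * (z.re - 1) * deriv Q.P₁ (‖z - 1‖ ^ 2) -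
        2 * z.re * deriv Q.PI (‖z‖ ^ 2))
      (0 - 2 * z.im * deriv Q.P₀ (‖z‖ ^ 2) - 2 * z.im * deriv Q.P₁ (‖z - 1‖ ^ 2) -
        2 * z.im * deriv Q.PI (‖z‖ ^ 2)) z := by
    intro z
    have := (((HasPartials.const 1 z).sub (HasPartials.norm_sq (hd0 (‖z‖ ^ 2)))).sub
      (HasPartials.norm_sub_one_sq (hd1 (‖z - 1‖ ^ 2)))).sub
      (HasPartials.norm_sq (hdI (‖z‖ ^ 2)))
    simp only [Cutoffs.mid, ofReal_sub, ofReal_one]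
    exact this
  have hM : ∀ z : ℂ, 0 < z.im → _ := fun z hz => ((hmid z).mul
    (HasPartials.of_hasDerivAt (hF.hasDerivAt z hz))).mul
    (HasPartials.of_hasDerivAt (B'.differentiableAt_A hz).hasDerivAt).conj_partials
  have hG' : ∀ z : ℂ, 0 < z.im → _ := fun z hz =>
    (HasPartials.of_hasDerivAt (hG.hasDerivAt z hz)).conj_partials
  have h0 : ∀ z : ℂ, _ := fun z => (HasPartials.const B.D z).mul
    (HasPartials.norm_sq (dd0 (‖z‖ ^ 2)).hasDerivAt)
  have h1 : ∀ z : ℂ, _ := fun z => (HasPartials.const B.C z).mul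
    (HasPartials.norm_sub_one_sq (dd1 (‖z - 1‖ ^ 2)).hasDerivAt)
  have hx : ∀ z : ℂ, _ := fun z => (HasPartials.const 2 z).mul (HasPartials.re z)
  have hx1 : ∀ z : ℂ, _ := fun z => (HasPartials.const 2 z).mul
    ((HasPartials.re z).sub (HasPartials.const 1 z))
  have hy : ∀ z : ℂ, _ := fun z => (HasPartials.const 2 z).mul (HasPartials.im z)
  refine integral_upperHalfPlane_eq hyI (continuousOn_form B B' Q hF hG).1
    (continuousOn_form B B' Q hF hG).2
    (fun z hz => (form_eq_zero B B' Q F G (Or.inr (Or.inr hz))).1)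
    (fun z hz => (form_eq_zero B B' Q F G (Or.inr (Or.inr hz))).2)
    (fun z hz => (hM z hz).sub ((hG' z hz).mul (((hx z).mul (h0 z)).add ((hx1 z).mul (h1 z)))))
    (fun z hz => ((HasPartials.const (-I) z).mul (hM z hz)).sub
      ((hG' z hz).mul (((hy z).mul (h0 z)).add ((hy z).mul (h1 z)))))
    (fun z hz => ?_)
    (fun z hz => rest_eq_zero B B' Q (Or.inr (Or.inr hz))) (integrable_rest B B' Q)
  rw [rest, radialTerm_zero B B' Q hF hz.le, radialTerm_one B B' Q hF hz.le,
    radialTerm_infty B B' Q hF hz.le]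
  have hzc : conj z = z.re - z.im * I := by
    apply Complex.ext <;> simp
  simp only [map_mul, map_sub, map_one, conj_I, hzc]
  linear_combination (2 * (z.im : ℂ) * conj (B'.A z) * (F z * (((deriv Q.P₀ (‖z‖ ^ 2) : ℝ) : ℂ) +
    ((deriv Q.P₁ (‖z - 1‖ ^ 2) : ℝ) : ℂ) + ((deriv Q.PI (‖z‖ ^ 2) : ℝ) : ℂ)) -
    B.D * ((deriv Q.P₀ (‖z‖ ^ 2) : ℝ) : ℂ) - B.C * ((deriv Q.P₁ (‖z - 1‖ ^ 2) : ℝ) : ℂ))) * I_sq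

end TriBlock

/-! ### Reflection in the real axis and the boundary integral -/

/-- The unimodular k allows for the phase e^(2πiα) in `TriBlock.star`. It occurs in one series and
conjugated in the other, and drops out. -/
theorem radialTerm_conj {c d : ℤ → ℂ} {k : ℂ} (hk : k * conj k = 1) (γ : ℝ) (P : ℝ → ℝ) (z : ℂ) :
    radialTerm c d γ P (conj z) =
      conj (radialTerm (fun n => k * conj (c n)) (fun n => k * conj (d n)) γ P z) := by
  have h1 : laurent (fun n : ℤ => k * conj (c n) / (n + γ)) z =
      k * laurent (fun n : ℤ => conj (c n) / (n + γ)) z := by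
    rw [← laurent_const_mul]
    simp only [mul_div_assoc]
  simp only [radialTerm, laurent_const_mul, h1, map_mul, conj_ofReal, RCLike.norm_conj,
    conj_laurent, conj_conj, map_div₀, map_add, map_intCast]
  linear_combination (-(deriv P (‖z‖ ^ 2) : ℝ) * ((‖z‖ ^ (2 * γ) : ℝ) : ℂ) *
    laurent (fun n : ℤ => c n / (n + γ)) (conj z) * laurent (fun n => conj (d n)) z) * hk

theorem conj_intervalIntegral (f : ℝ → ℂ) (a b : ℝ) :
    ∫ x in a..b, conj (f x) = conj (∫ x in a..b, f x) := by
  simp only [intervalIntegral, integral_conj, map_sub]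

theorem integral_eq_upper_add_conj {f g : ℂ → ℂ} (hf : Integrable f)
    (h : ∀ z, f (conj z) = conj (g z)) :
    ∫ z, f z = (∫ z in {z : ℂ | 0 < z.im}, f z) + conj (∫ z in {z : ℂ | 0 < z.im}, g z) := by
  have hm : MeasurableSet {z : ℂ | 0 < z.im} := (isOpen_lt continuous_const continuous_im).measurableSet
  rw [← integral_add_compl hm hf, ← integral_conj]
  congr 1
  have hnull : volume {z : ℂ | z.im = 0} = 0 := by
    have := Measure.addHaar_submodule (volume : Measure ℂ) (LinearMap.ker imLm) (by
      intro h
      have : I ∈ LinearMap.ker imLm := by rw [h]; trivial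
      simp at this)
    convert this using 2
    ext z; simp
  have hae : ({z : ℂ | 0 < z.im}ᶜ : Set ℂ) =ᵐ[volume] {z : ℂ | z.im < 0} := by
    have : ∀ᵐ z : ℂ, z.im ≠ 0 := by
      rw [ae_iff]; simpa using hnull
    filter_upwards [this] with z hz
    apply propext
    change ¬ (0 < z.im) ↔ z.im < 0
    rw [not_lt]
    exact ⟨fun h => lt_of_le_of_ne h hz, le_of_lt⟩
  rw [setIntegral_congr_set hae]
  have := (conjLIE.measurePreserving).setIntegral_preimage_emb
    conjLIE.toHomeomorph.measurableEmbedding f {z : ℂ | z.im < 0}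
  rw [← this]
  have hpre : conjLIE ⁻¹' {z : ℂ | z.im < 0} = {z : ℂ | 0 < z.im} := by
    ext z; simp
  rw [hpre]
  refine setIntegral_congr_fun hm fun z _ => ?_
  simpa using h z

namespace TriBlock

variable {α β : ℝ} (B B' : TriBlock α β) {x₀ y₀ x₁ y₁ xI yI : ℝ}
  (Q : Cutoffs x₀ y₀ x₁ y₁ xI yI)

theorem rest_conj (z : ℂ) : rest B B' Q (conj z) = conj (rest B.star B'.star Q z) := by
  have h0 : exp (2 * Real.pi * I * α) * conj (exp (2 * Real.pi * I * α)) = 1 := by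
    rw [← exp_conj, ← Complex.exp_add, ← Complex.exp_zero]
    congr 1
    simp only [map_mul, conj_ofReal, conj_I, map_ofNat]
    ring
  have hn : ‖conj z - 1‖ = ‖z - 1‖ := by
    rw [← RCLike.norm_conj (z - 1), map_sub, map_one]
  have e0 := radialTerm_conj (c := B.c0) (d := B'.c0) h0 β Q.P₀ z
  have e1 := radialTerm_conj (c := B.c1) (d := B'.c1) (k := 1) (by simp) α Q.P₁ (z - 1)
  have eI := radialTerm_conj (c := B.cI) (d := B'.cI) (k := 1) (by simp) (α + β) Q.PI z
  simp only [one_mul] at e1 eI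
  rw [map_sub, map_one] at e1
  rw [rest, rest, e0, e1, eI, A_mul_conj, A_mul_conj]
  simp only [star, map_sub, map_add, map_mul, conj_ofReal, conj_conj, Cutoffs.mid, hn,
    RCLike.norm_conj]

theorem A_star_of_neg {x : ℝ} (hx : x < 0) :
    conj (B.star.A x) = exp (-2 * Real.pi * I * (α + β)) * B.A x := by
  rw [A, A, map_mul, map_mul, ← ofReal_one, ← ofReal_sub, conj_ofReal_cpow_of_neg hx,
    conj_ofReal_cpow_of_neg (by linarith), mul_add, Complex.exp_add]
  simp only [star, conj_conj, conj_ofReal]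
  ring

theorem A_star_of_mem {x : ℝ} (h0 : 0 < x) (h1 : x < 1) :
    conj (B.star.A x) = exp (-2 * Real.pi * I * α) * B.A x := by
  rw [A, A, map_mul, map_mul, ← ofReal_one, ← ofReal_sub, conj_ofReal_cpow_of_pos h0,
    conj_ofReal_cpow_of_neg (by linarith)]
  simp only [star, conj_conj, conj_ofReal]
  ring

theorem A_star_of_one_lt {x : ℝ} (h1 : 1 < x) : conj (B.star.A x) = B.A x := by
  rw [A, A, map_mul, map_mul, ← ofReal_one, ← ofReal_sub, conj_ofReal_cpow_of_pos (by linarith),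
    conj_ofReal_cpow_of_pos (by linarith)]
  simp only [star, conj_conj, conj_ofReal]

theorem conj_star_eq_of_one_lt {F G : ℂ → ℂ} (hF : B.IsPrimitive F)
    (hG : B.star.IsPrimitive G) {x : ℝ} (hx : 1 < x) : conj (G x) = F x := by
  have h1 : 1 < ‖(x : ℂ)‖ := by
    rw [norm_real, Real.norm_of_nonneg (by linarith)]; linarith
  rw [hF.infty _ (ofReal_mem_closedUpper x) h1, hG.infty _ (ofReal_mem_closedUpper x) h1,
    conj_star_wI_of_pos _ (by linarith)]

theorem conj_star_eq_of_mem (hB : B.NoZero) {F G : ℂ → ℂ} (hF : B.IsPrimitive F)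
    (hG : B.star.IsPrimitive G) {x : ℝ} (h0 : 0 < x) (h1 : x < 1) :
    conj (G x) = exp (-2 * Real.pi * I * α) *
      (F x - B.D * (1 - exp (-2 * Real.pi * I * β))) := by
  have hn : ‖(x : ℂ)‖ = x := by rw [norm_real, Real.norm_of_nonneg h0.le]
  rw [hF.zero _ (ofReal_mem_closedUpper x) (by rwa [hn]) (by rwa [hn]),
    hG.zero _ (ofReal_mem_closedUpper x) (by rwa [hn]) (by rwa [hn]), map_add,
    conj_star_w0_of_pos _ h0, conj_star_D _ hB, mul_add, Complex.exp_add]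
  ring

theorem conj_exp_two_pi (γ : ℝ) :
    conj (exp (-2 * Real.pi * I * γ)) = exp (2 * Real.pi * I * γ) := by
  rw [← exp_conj]
  simp only [map_mul, map_neg, conj_ofReal, conj_I, map_ofNat]
  congr 1; ring

theorem exp_mul_exp_two_pi (γ : ℂ) :
    exp (2 * Real.pi * I * γ) * exp (-2 * Real.pi * I * γ) = 1 := by
  rw [← Complex.exp_add, ← Complex.exp_zero]; congr 1; ring

/-- For x < 0, passing to the other side multiplies F and D by e^(-2πi(α+β)) and the conjugates of
A' and G by the inverse factor. The term with C is absent because P₁ is flat at distance at least 1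
from the point 1. -/
theorem formX_star_of_neg (hB : B.NoZero) (hB' : B'.NoZero) {F F' G G' : ℂ → ℂ}
    (hF : B.IsPrimitive F) (hF' : B.star.IsPrimitive F') (hG : B'.IsPrimitive G)
    (hG' : B'.star.IsPrimitive G') {x : ℝ} (hx : x < 0) :
    conj (formX B.star B'.star Q F' G' x) = formX B B' Q F G x := by
  have hd : deriv Q.P₁ (‖(x : ℂ) - 1‖ ^ 2) = 0 := by
    refine Q.deriv₁ (Or.inr ?_)
    rw [← ofReal_one, ← ofReal_sub, norm_real, Real.norm_of_nonpos (by linarith)]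
    linarith [Q.y₁_lt_one]
  have e1 := B.conj_star_eq_of_neg hB hF hF' hx
  have e2 := congrArg conj (B'.conj_star_eq_of_neg hB' hG hG' hx)
  have e3 := congrArg conj (B'.A_star_of_neg hx)
  have e4 := exp_mul_exp_two_pi (α + β)
  have e5 : conj (exp (-2 * Real.pi * I * (α + β))) = exp (2 * Real.pi * I * (α + β)) := by
    exact_mod_cast conj_exp_two_pi (α + β)
  rw [conj_conj, map_mul, e5] at e2 e3
  rw [formX, formX, hd, e2, e3]
  simp only [map_sub, map_mul, conj_ofReal, map_ofNat, conj_star_D _ hB, e1, ofReal_zero,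
    mul_zero, add_zero, conj_conj, ofReal_re]
  linear_combination (Q.mid x * F x * conj (B'.A x) -
    conj (G x) * 2 * x * B.D * (deriv Q.P₀ (‖(x : ℂ)‖ ^ 2) : ℝ)) * e4

theorem formX_star_of_one_lt (hB : B.NoZero) {F F' G G' : ℂ → ℂ}
    (hF : B.IsPrimitive F) (hF' : B.star.IsPrimitive F') (hG : B'.IsPrimitive G)
    (hG' : B'.star.IsPrimitive G') {x : ℝ} (hx : 1 < x) :
    conj (formX B.star B'.star Q F' G' x) = formX B B' Q F G x := by
  have hd : deriv Q.P₀ (‖(x : ℂ)‖ ^ 2) = 0 := by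
    refine Q.deriv₀ (Or.inr ?_)
    rw [norm_real, Real.norm_of_nonneg (by linarith)]
    linarith [Q.y₀_lt_one]
  have e1 := B.conj_star_eq_of_one_lt hF hF' hx
  have e2 := congrArg conj (B'.conj_star_eq_of_one_lt hG hG' hx)
  have e3 := congrArg conj (B'.A_star_of_one_lt hx)
  rw [conj_conj] at e2 e3
  rw [formX, formX, hd, e2, e3]
  simp only [map_sub, map_mul, conj_ofReal, map_ofNat, map_one, conj_star_C _ hB, e1, ofReal_zero,
    mul_zero, zero_add, conj_conj, ofReal_re]

/-- A primitive along the real axis of the difference of the form and of its conjugate. -/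
noncomputable def axisPrimitive (G : ℂ → ℂ) (x : ℝ) : ℂ :=
  B.D * (1 - exp (-2 * Real.pi * I * β)) * (Q.mid x * conj (G x)) -
    conj (B'.D * (1 - exp (-2 * Real.pi * I * β))) *
      (exp (-2 * Real.pi * I * β) * B.D * Q.P₀ (‖(x : ℂ)‖ ^ 2) +
        exp (2 * Real.pi * I * α) * B.C * Q.P₁ (‖(x : ℂ) - 1‖ ^ 2))

/-- On (0, 1) the values from the two sides differ not only by phases but also by the additive
constants D (1 - e^(-2πiβ)), for F and likewise for G. The monodromy relation replaces C (1 -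
e^(2πiα)) by the same constant, which makes the first group of terms a total derivative. -/
theorem formX_sub_of_mem (hB : B.NoZero) (hB' : B'.NoZero) {F F' G G' : ℂ → ℂ}
    (hF : B.IsPrimitive F) (hF' : B.star.IsPrimitive F') (hG : B'.IsPrimitive G)
    (hG' : B'.star.IsPrimitive G') {x : ℝ} (h0 : 0 < x) (h1 : x < 1) :
    formX B B' Q F G x - conj (formX B.star B'.star Q F' G' x) =
      B.D * (1 - exp (-2 * Real.pi * I * β)) * (Q.mid x * conj (B'.A x) - conj (G x) *
        (2 * x * (deriv Q.P₀ (‖(x : ℂ)‖ ^ 2) : ℝ) +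
          2 * (x - 1) * (deriv Q.P₁ (‖(x : ℂ) - 1‖ ^ 2) : ℝ))) -
      conj (B'.D * (1 - exp (-2 * Real.pi * I * β))) *
        (exp (-2 * Real.pi * I * β) * B.D * (2 * x * (deriv Q.P₀ (‖(x : ℂ)‖ ^ 2) : ℝ)) +
          exp (2 * Real.pi * I * α) * B.C * (2 * (x - 1) *
            (deriv Q.P₁ (‖(x : ℂ) - 1‖ ^ 2) : ℝ))) := by
  have e1 := B.conj_star_eq_of_mem hB hF hF' h0 h1
  have e2 := congrArg conj (B'.conj_star_eq_of_mem hB' hG hG' h0 h1)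
  have e3 := congrArg conj (B'.A_star_of_mem h0 h1)
  have e4 := exp_mul_exp_two_pi α
  have e6 := B.D_mul_eq_C_mul hB
  rw [conj_conj, map_mul, conj_exp_two_pi] at e2 e3
  rw [formX, formX, e2, e3]
  simp only [map_sub, map_mul, map_add, conj_ofReal, map_ofNat, map_one, conj_star_D _ hB,
    conj_star_C _ hB, e1, conj_conj, conj_exp_two_pi, ofReal_re, mul_add, Complex.exp_add]
  generalize exp (-2 * Real.pi * I * α) = q' at *
  generalize exp (2 * Real.pi * I * α) = q at *
  generalize exp (-2 * Real.pi * I * β) = p' at *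
  generalize exp (2 * Real.pi * I * β) = p at *
  generalize (Q.mid x : ℂ) = m
  generalize ((deriv Q.P₀ (‖(x : ℂ)‖ ^ 2) : ℝ) : ℂ) = u
  generalize ((deriv Q.P₁ (‖(x : ℂ) - 1‖ ^ 2) : ℝ) : ℂ) = v
  generalize conj (B'.A x) = a at *
  generalize conj (G x) = g
  generalize conj B'.D = d
  generalize B.D = D at *
  generalize B.C = C at *
  generalize F x = f
  linear_combination (-m * a * (f - D * (1 - p')) + 2 * x * g * D * u * p' -
    2 * x * d * (1 - p) * p' * D * u) * e4 + 2 * (x - 1) * g * v * e6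

theorem hasDerivAt_axisPrimitive (hB : B.NoZero) (hB' : B'.NoZero) {F F' G G' : ℂ → ℂ}
    (hF : B.IsPrimitive F) (hF' : B.star.IsPrimitive F') (hG : B'.IsPrimitive G)
    (hG' : B'.star.IsPrimitive G') {x : ℝ} (h0 : 0 ≤ x) (h1 : x ≤ 1) :
    HasDerivAt (axisPrimitive B B' Q G)
      (formX B B' Q F G x - conj (formX B.star B'.star Q F' G' x)) x := by
  have n0 : ∀ x : ℝ, ‖(x : ℂ)‖ ^ 2 = x ^ 2 := fun x => by simp
  have n1 : ∀ x : ℝ, ‖(x : ℂ) - 1‖ ^ 2 = (x - 1) ^ 2 := fun x => by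
    rw [← ofReal_one, ← ofReal_sub, n0]
  have hP₀ : HasDerivAt (fun x : ℝ => (Q.P₀ (‖(x : ℂ)‖ ^ 2) : ℂ))
      (2 * x * (deriv Q.P₀ (‖(x : ℂ)‖ ^ 2) : ℝ)) x := by
    simp only [n0]
    refine (((Q.smooth₀.differentiable two_ne_zero (x ^ 2)).hasDerivAt.comp x
      (hasDerivAt_pow 2 x)).ofReal_comp).congr_deriv ?_
    push_cast; ring
  have hP₁ : HasDerivAt (fun x : ℝ => (Q.P₁ (‖(x : ℂ) - 1‖ ^ 2) : ℂ))
      (2 * (x - 1) * (deriv Q.P₁ (‖(x : ℂ) - 1‖ ^ 2) : ℝ)) x := by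
    simp only [n1]
    refine (((Q.smooth₁.differentiable two_ne_zero ((x - 1) ^ 2)).hasDerivAt.comp x
      (((hasDerivAt_id x).sub_const 1).pow 2)).ofReal_comp).congr_deriv ?_
    push_cast; simp; ring
  have hPI : HasDerivAt (fun x : ℝ => (Q.PI (‖(x : ℂ)‖ ^ 2) : ℂ)) 0 x := by
    refine (hasDerivAt_const x (0 : ℂ)).congr_of_eventuallyEq ?_
    filter_upwards [Ioo_mem_nhds (show -1 < x by linarith) (h1.trans_lt Q.one_lt_xI)] with y hy
    rw [Q.zeroI, ofReal_zero]
    rw [norm_real, Real.norm_eq_abs, abs_le]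
    exact ⟨by linarith [hy.1, Q.one_lt_xI], hy.2.le⟩
  have hmid : HasDerivAt (fun x : ℝ => (Q.mid x : ℂ)) (0 -
      2 * x * (deriv Q.P₀ (‖(x : ℂ)‖ ^ 2) : ℝ) -
      2 * (x - 1) * (deriv Q.P₁ (‖(x : ℂ) - 1‖ ^ 2) : ℝ) - 0) x := by
    simp only [Cutoffs.mid, ofReal_sub, ofReal_one]
    exact (((hasDerivAt_const x (1 : ℂ)).sub hP₀).sub hP₁).sub hPI
  have hlast := ((hP₀.const_mul (exp (-2 * Real.pi * I * β) * B.D)).add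
    (hP₁.const_mul (exp (2 * Real.pi * I * α) * B.C))).const_mul
    (conj (B'.D * (1 - exp (-2 * Real.pi * I * β))))
  -- Near the endpoints F and G are not controlled, but mid and the derivatives of the cutoffs
  -- vanish there. In between, the expansion at 0 supplies the derivative of G along the axis.
  by_cases hx : x < x₀ ∨ |x - 1| < x₁
  · have hev : ∀ᶠ y : ℝ in 𝓝 x, ‖(y : ℂ)‖ ≤ x₀ ∨ ‖(y : ℂ) - 1‖ ≤ x₁ ∨ yI ≤ ‖(y : ℂ)‖ := by
      rcases hx with hx | hx
      · filter_upwards [Ioo_mem_nhds (show -x₀ < x by linarith [Q.pos₀]) hx] with y hy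
        left
        rw [norm_real, Real.norm_eq_abs, abs_le]
        exact ⟨hy.1.le, hy.2.le⟩
      · filter_upwards [(isOpen_lt (by fun_prop : Continuous fun x : ℝ => |x - 1|)
          continuous_const).mem_nhds hx] with y hy
        right; left
        rw [← ofReal_one, ← ofReal_sub, norm_real]
        exact le_of_lt hy
    have hz := hev.self_of_nhds
    obtain ⟨d0, d1⟩ := deriv₀_eq_zero Q hz
    rw [(form_eq_zero B B' Q F G hz).1, (form_eq_zero B.star B'.star Q F' G' hz).1, map_zero,
      sub_zero]
    have hm : HasDerivAt (fun x : ℝ => (Q.mid x : ℂ) * conj (G x)) 0 x := by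
      refine (hasDerivAt_const x (0 : ℂ)).congr_of_eventuallyEq ?_
      filter_upwards [hev] with y hy
      rw [Q.mid_eq_zero hy, ofReal_zero, zero_mul]
    refine ((hm.const_mul (B.D * (1 - exp (-2 * Real.pi * I * β)))).sub hlast).congr_deriv ?_
    rw [d0, d1]
    simp
  · rw [not_or, not_lt, not_lt] at hx
    have hx0 : 0 < x := Q.pos₀.trans_le hx.1
    have hx1 : x < 1 := lt_of_le_of_ne h1 fun h => by
      rw [h, sub_self, abs_zero] at hx
      exact absurd hx.2 (not_le.2 Q.pos₁)
    have hn : ‖(x : ℂ)‖ = x := by rw [norm_real, Real.norm_of_nonneg hx0.le]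
    have hG1 : HasDerivAt (fun x : ℝ => conj (G x)) (conj (B'.A x)) x := by
      have hw : HasDerivAt (fun z => B'.w0 z + B'.D) (B'.A x) (x : ℂ) := by
        rw [B'.A_eq_zero_expansion (ofReal_mem_closedUpper x) (by rwa [hn]) (by rwa [hn])]
        exact (B'.hasDerivAt_w0 hB' (by simpa using hx0) (by rwa [hn])).add_const _
      refine (hw.comp_ofReal.star).congr_of_eventuallyEq ?_
      filter_upwards [Ioo_mem_nhds hx0 hx1] with y hy
      have hny : ‖(y : ℂ)‖ = y := by rw [norm_real, Real.norm_of_nonneg hy.1.le]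
      rw [hG.zero _ (ofReal_mem_closedUpper y) (by rw [hny]; exact hy.1)
        (by rw [hny]; exact hy.2)]
      rfl
    rw [formX_sub_of_mem B B' Q hB hB' hF hF' hG hG' hx0 hx1]
    refine (((hmid.mul hG1).const_mul (B.D * (1 - exp (-2 * Real.pi * I * β)))).sub
      hlast).congr_deriv ?_
    ring

theorem integral_formX_sub (hB : B.NoZero) (hB' : B'.NoZero) {F F' G G' : ℂ → ℂ}
    (hF : B.IsPrimitive F) (hF' : B.star.IsPrimitive F') (hG : B'.IsPrimitive G)
    (hG' : B'.star.IsPrimitive G') :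
    ∫ x : ℝ in (-yI)..yI, (formX B B' Q F G x - conj (formX B.star B'.star Q F' G' x)) =
      axisPrimitive B B' Q G 1 - axisPrimitive B B' Q G 0 := by
  have hyI : 1 < yI := Q.one_lt_xI.trans Q.ltI
  have hzero : ∀ x : ℝ, x = 0 ∨ x = 1 →
      formX B B' Q F G x - conj (formX B.star B'.star Q F' G' x) = 0 := by
    intro x hx
    have hx' : ‖(x : ℂ)‖ ≤ x₀ ∨ ‖(x : ℂ) - 1‖ ≤ x₁ ∨ yI ≤ ‖(x : ℂ)‖ := by
      rcases hx with rfl | rfl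
      · left; simpa using Q.pos₀.le
      · right; left; simpa using Q.pos₁.le
    rw [(form_eq_zero B B' Q F G hx').1, (form_eq_zero B.star B'.star Q F' G' hx').1]
    simp
  have hcont : Continuous fun x : ℝ =>
      formX B B' Q F G x - conj (formX B.star B'.star Q F' G' x) := by
    have h : ∀ f : ℂ → ℂ, ContinuousOn f closedUpper → Continuous fun x : ℝ => f x :=
      fun f hf => hf.comp_continuous continuous_ofReal ofReal_mem_closedUpper
    exact (h _ (continuousOn_form B B' Q hF hG).1).sub
      (continuous_conj.comp (h _ (continuousOn_form B.star B'.star Q hF' hG').1))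
  rw [← intervalIntegral.integral_add_adjacent_intervals (b := 0)
    (hcont.intervalIntegrable _ _) (hcont.intervalIntegrable _ _),
    ← intervalIntegral.integral_add_adjacent_intervals (a := 0) (b := 1)
    (hcont.intervalIntegrable _ _) (hcont.intervalIntegrable _ _)]
  have e1 : ∫ x : ℝ in (-yI)..0,
      (formX B B' Q F G x - conj (formX B.star B'.star Q F' G' x)) = 0 := by
    refine intervalIntegral.integral_zero_ae (Eventually.of_forall fun x hx => ?_)
    rw [Set.uIoc_of_le (by linarith)] at hx
    rcases eq_or_lt_of_le hx.2 with h | h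
    · exact hzero x (Or.inl h)
    · rw [formX_star_of_neg B B' Q hB hB' hF hF' hG hG' h, sub_self]
  have e2 : ∫ x : ℝ in (1 : ℝ)..yI,
      (formX B B' Q F G x - conj (formX B.star B'.star Q F' G' x)) = 0 := by
    refine intervalIntegral.integral_zero_ae (Eventually.of_forall fun x hx => ?_)
    rw [Set.uIoc_of_le hyI.le] at hx
    rw [formX_star_of_one_lt B B' Q hB hF hF' hG hG' hx.1, sub_self]
  rw [e1, e2, zero_add, add_zero]
  refine intervalIntegral.integral_eq_sub_of_hasDerivAt (fun x hx => ?_)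
    (hcont.intervalIntegrable _ _)
  rw [Set.uIcc_of_le zero_le_one] at hx
  exact hasDerivAt_axisPrimitive B B' Q hB hB' hF hF' hG hG' hx.1 hx.2

/-- Only [0, 1] contributes. There mid vanishes at both ends, P₀ falls from 1 to 0 and P₁ rises from
0 to 1, which leaves conj(D' (1 - e^(-2πiβ))) (e^(-2πiβ) D - e^(2πiα) C). By the monodromy relation
the last factor is D - C, and the conjugate relation for the second block separates the two
products. -/
theorem integral_rest (hB : B.NoZero) (hB' : B'.NoZero) :
    ∫ z, rest B B' Q z = I / 2 * (B.C * conj B'.C * (-1 + exp (-2 * Real.pi * I * α)) +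
      B.D * conj B'.D * (1 - exp (2 * Real.pi * I * β))) := by
  obtain ⟨F, hF⟩ := B.exists_isPrimitive hB
  obtain ⟨F', hF'⟩ := B.star.exists_isPrimitive hB.star
  obtain ⟨G, hG⟩ := B'.exists_isPrimitive hB'
  obtain ⟨G', hG'⟩ := B'.star.exists_isPrimitive hB'.star
  have hcont : ∀ f : ℂ → ℂ, ContinuousOn f closedUpper → Continuous fun x : ℝ => f x :=
    fun f hf => hf.comp_continuous continuous_ofReal ofReal_mem_closedUpper
  have c1 := hcont _ (continuousOn_form B B' Q hF hG).1
  have c3 : Continuous fun x : ℝ => conj (formX B.star B'.star Q F' G' x) :=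
    continuous_conj.comp (hcont _ (continuousOn_form B.star B'.star Q hF' hG').1)
  rw [integral_eq_upper_add_conj (integrable_rest B B' Q) (rest_conj B B' Q),
    integral_upper_rest B B' Q hF hG, integral_upper_rest B.star B'.star Q hF' hG', map_mul,
    ← conj_intervalIntegral]
  have e := integral_formX_sub B B' Q hB hB' hF hF' hG hG'
  rw [intervalIntegral.integral_sub (c1.intervalIntegrable _ _)
    (c3.intervalIntegrable _ _)] at e
  have hc : conj (I / 2 : ℂ) = -(I / 2) := by rw [map_div₀, conj_I, map_ofNat, neg_div]
  rw [hc, neg_mul, ← sub_eq_add_neg, ← mul_sub, e]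
  congr 1
  have h1 := B.D_mul_eq_C_mul hB
  have h2 := congrArg conj (B'.D_mul_eq_C_mul hB')
  have h3 : conj (exp (2 * Real.pi * I * α)) = exp (-2 * Real.pi * I * α) := by
    rw [← conj_exp_two_pi, conj_conj]
  rw [map_mul, map_mul, map_sub, map_sub, map_one, conj_exp_two_pi, h3] at h2
  have m0 : Q.mid (0 : ℝ) = 0 := Q.mid_eq_zero (Or.inl (by simpa using Q.pos₀.le))
  have m1 : Q.mid (1 : ℝ) = 0 := Q.mid_eq_zero (Or.inr (Or.inl (by simpa using Q.pos₁.le)))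
  have a0 : Q.P₀ (‖((0 : ℝ) : ℂ)‖ ^ 2) = 1 := Q.one₀ (by simpa using Q.pos₀.le)
  have a1 : Q.P₀ (‖((1 : ℝ) : ℂ)‖ ^ 2) = 0 := Q.zero₀ (by simpa using Q.y₀_lt_one.le)
  have b0 : Q.P₁ (‖((0 : ℝ) : ℂ) - 1‖ ^ 2) = 0 := Q.zero₁ (by simpa using Q.y₁_lt_one.le)
  have b1 : Q.P₁ (‖((1 : ℝ) : ℂ) - 1‖ ^ 2) = 1 := Q.one₁ (by simpa using Q.pos₁.le)
  rw [ofReal_zero] at m0 a0 b0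
  rw [ofReal_one] at m1 a1 b1
  simp only [axisPrimitive, ofReal_zero, ofReal_one, m0, m1, a0, a1, b0, b1, map_mul, map_sub, map_one, conj_exp_two_pi]
  linear_combination (-B.C) * h2 - conj B'.D * (1 - exp (2 * Real.pi * I * β)) * h1

end TriBlock

/-! ### Assembling the integral over the worldsheet -/

theorem annulusIntegrand_eq (c d : ℤ → ℂ) (γ : ℝ) (P : ℝ → ℝ) (z : ℂ) :
    annulusIntegrand c d γ P z = P (‖z‖ ^ 2) * (((‖z‖ ^ (2 * γ) : ℝ) : ℂ) *
      (laurent c z * conj (laurent d z) / ((‖z‖ ^ 2 : ℝ) : ℂ))) + radialTerm c d γ P z := by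
  rw [annulusIntegrand, radialTerm]
  ring

theorem measurableSet_annulus (x y : ℝ) : MeasurableSet {z : ℂ | x < ‖z‖ ∧ ‖z‖ < y} :=
  ((isOpen_lt continuous_const continuous_norm).inter
    (isOpen_lt continuous_norm continuous_const)).measurableSet

/-- The integrand of an annulus, extended by zero. -/
noncomputable def annulusPart (c d : ℤ → ℂ) (γ : ℝ) (P : ℝ → ℝ) (x y : ℝ) : ℂ → ℂ :=
  Set.indicator {z | x < ‖z‖ ∧ ‖z‖ < y} (annulusIntegrand c d γ P)

theorem integrable_annulusPart {c d : ℤ → ℂ} {U : Set ℝ} (hU : IsOpen U)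
    (hc : LaurentConv c U) (hd : LaurentConv d U) (γ : ℝ) {P : ℝ → ℝ} (hP : ContDiff ℝ 2 P)
    {x y : ℝ} (hxy : Set.Icc x y ⊆ U) : Integrable (annulusPart c d γ P x y) :=
  (integrable_indicator_iff (measurableSet_annulus x y)).2
    (integrableOn_annulusIntegrand hU hc hd γ (hP.of_le one_le_two) hxy)

theorem integral_annulusPart {c d : ℤ → ℂ} {U : Set ℝ} (hU : IsOpen U)
    (hc : LaurentConv c U) (hd : LaurentConv d U) {γ : ℝ}
    (h0 : ∀ n : ℤ, (n : ℝ) + γ = 0 → c n = 0) {P : ℝ → ℝ} (hP : ContDiff ℝ 2 P)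
    {x y : ℝ} (hxy : x ≤ y) (hsub : Set.Icc x y ⊆ U) :
    ∫ z, annulusPart c d γ P x y z =
      P (y ^ 2) * localSeries c d γ (y ^ 2) - P (x ^ 2) * localSeries c d γ (x ^ 2) := by
  rw [← integral_annulusIntegrand hU hc hd h0 (hP.of_le one_le_two) hxy hsub,
    ← integral_indicator (measurableSet_annulus x y)]
  rfl

theorem cpow_mul_conj_cpow (w : ℂ) (γ : ℝ) :
    w ^ (γ : ℂ) * conj (w ^ (γ : ℂ)) = ((‖w‖ ^ (2 * γ) : ℝ) : ℂ) := by
  rw [mul_conj, normSq_eq_norm_sq, norm_cpow_real, mul_comm 2 γ, Real.rpow_mul (norm_nonneg w),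
    Real.rpow_two]

theorem mul_conj_div_norm_sq {z : ℂ} (hz : z ≠ 0) (a b : ℂ) :
    z * a * conj (z * b) / ((‖z‖ ^ 2 : ℝ) : ℂ) = a * conj b := by
  have h : z * conj z = ((‖z‖ ^ 2 : ℝ) : ℂ) := by rw [mul_conj, normSq_eq_norm_sq]
  have h0 : ((‖z‖ ^ 2 : ℝ) : ℂ) ≠ 0 := by
    exact_mod_cast pow_ne_zero 2 (norm_ne_zero_iff.2 hz)
  rw [div_eq_iff h0, ← h, map_mul]
  ring

theorem conj_exp_pi_mul (α : ℝ) :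
    exp (Real.pi * I * α) * conj (exp (Real.pi * I * α)) = 1 := by
  rw [← exp_conj, ← Complex.exp_add, ← Complex.exp_zero]
  congr 1
  simp only [map_mul, conj_ofReal, conj_I]
  ring

namespace TriBlock

variable {α β : ℝ} (B B' : TriBlock α β)

/-- The identity `eq0` holds in the whole punctured disc, not only above the axis; the phase e^(πiα)
cancels against its conjugate. This makes the annulus contributions usable on both half-planes at
once. -/
theorem laurent_zero_mul_conj {z : ℂ} (h0 : 0 < ‖z‖) (h1 : ‖z‖ < 1) :
    ((‖z‖ ^ (2 * β) : ℝ) : ℂ) *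
      (laurent B.c0 z * conj (laurent B'.c0 z) / ((‖z‖ ^ 2 : ℝ) : ℂ)) = B.A z * conj (B'.A z) := by
  rw [B.eq0 z h0 h1, B'.eq0 z h0 h1, mul_conj_div_norm_sq (norm_pos_iff.1 h0), A_mul_conj,
    norm_sub_rev, ofReal_mul, ← cpow_mul_conj_cpow (1 - z)]
  simp only [map_mul]
  linear_combination (((‖z‖ ^ (2 * β) : ℝ) : ℂ) * (1 - z) ^ (α : ℂ) * conj ((1 - z) ^ (α : ℂ)) *
    B.a z * conj (B'.a z)) * conj_exp_pi_mul α

theorem laurent_infty_mul_conj {z : ℂ} (h1 : 1 < ‖z‖) :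
    ((‖z‖ ^ (2 * (α + β)) : ℝ) : ℂ) *
      (laurent B.cI z * conj (laurent B'.cI z) / ((‖z‖ ^ 2 : ℝ) : ℂ)) = B.A z * conj (B'.A z) := by
  have h0 : 0 < ‖z‖ := zero_lt_one.trans h1
  have hz : z ≠ 0 := norm_pos_iff.1 h0
  have hn : ‖z - 1‖ = ‖z‖ * ‖1 - z⁻¹‖ := by
    rw [← norm_mul]; congr 1; field_simp
  rw [B.eqI z h1, B'.eqI z h1, mul_conj_div_norm_sq hz, A_mul_conj, hn,
    Real.mul_rpow h0.le (norm_nonneg _), mul_add, Real.rpow_add h0]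
  simp only [ofReal_mul]
  rw [← cpow_mul_conj_cpow (1 - z⁻¹)]
  simp only [map_mul]
  ring

theorem laurent_one_mul_conj {z : ℂ} (h0 : 0 < ‖z - 1‖) (h1 : ‖z - 1‖ < 1) :
    ((‖z - 1‖ ^ (2 * α) : ℝ) : ℂ) * (laurent B.c1 (z - 1) * conj (laurent B'.c1 (z - 1)) /
      ((‖z - 1‖ ^ 2 : ℝ) : ℂ)) = B.A z * conj (B'.A z) := by
  rw [B.eq1 _ h0 h1, B'.eq1 _ h0 h1, mul_conj_div_norm_sq (norm_pos_iff.1 h0), A_mul_conj,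
    add_sub_cancel, ofReal_mul, ← cpow_mul_conj_cpow z]
  simp only [map_mul]
  ring

variable {x₀ y₀ x₁ y₁ xI yI : ℝ} (Q : Cutoffs x₀ y₀ x₁ y₁ xI yI)

theorem annulusPart_zero {z : ℂ} (h : x₀ < ‖z‖) :
    annulusPart B.c0 B'.c0 β Q.P₀ x₀ y₀ z =
      Q.P₀ (‖z‖ ^ 2) * (B.A z * conj (B'.A z)) + radialTerm B.c0 B'.c0 β Q.P₀ z := by
  by_cases h' : ‖z‖ < y₀
  · rw [annulusPart, Set.indicator_of_mem (by exact ⟨h, h'⟩), annulusIntegrand_eq,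
      laurent_zero_mul_conj B B' (Q.pos₀.trans h) (h'.trans Q.y₀_lt_one)]
  · rw [annulusPart, Set.indicator_of_notMem (fun hz => h' hz.2), radialTerm, Q.zero₀ (not_lt.1 h'),
      Q.deriv₀ (Or.inr (not_lt.1 h'))]
    simp

theorem annulusPart_one {z : ℂ} (h : x₁ < ‖z - 1‖) :
    annulusPart B.c1 B'.c1 α Q.P₁ x₁ y₁ (z - 1) =
      Q.P₁ (‖z - 1‖ ^ 2) * (B.A z * conj (B'.A z)) + radialTerm B.c1 B'.c1 α Q.P₁ (z - 1) := by
  by_cases h' : ‖z - 1‖ < y₁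
  · rw [annulusPart, Set.indicator_of_mem (by exact ⟨h, h'⟩), annulusIntegrand_eq,
      laurent_one_mul_conj B B' (Q.pos₁.trans h) (h'.trans Q.y₁_lt_one)]
  · rw [annulusPart, Set.indicator_of_notMem (fun hz => h' hz.2), radialTerm, Q.zero₁ (not_lt.1 h'),
      Q.deriv₁ (Or.inr (not_lt.1 h'))]
    simp

theorem annulusPart_infty {z : ℂ} (h : ‖z‖ < yI) :
    annulusPart B.cI B'.cI (α + β) Q.PI xI yI z =
      Q.PI (‖z‖ ^ 2) * (B.A z * conj (B'.A z)) + radialTerm B.cI B'.cI (α + β) Q.PI z := by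
  by_cases h' : xI < ‖z‖
  · rw [annulusPart, Set.indicator_of_mem (by exact ⟨h', h⟩), annulusIntegrand_eq,
      laurent_infty_mul_conj B B' (Q.one_lt_xI.trans h')]
  · rw [annulusPart, Set.indicator_of_notMem (fun hz => h' hz.1), radialTerm, Q.zeroI (not_lt.1 h'),
      Q.derivI (Or.inl (not_lt.1 h'))]
    simp

/-- On the worldsheet the four weights add up to 1 and the radial terms, subtracted in `rest`,
reappear in the annulus parts. Off the worldsheet all four summands vanish. -/
theorem indicator_A_mul_conj (z : ℂ) :
    Set.indicator (worldsheet 1 x₀ x₁ yI) (fun z => B.A z * conj (B'.A z)) z =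
      rest B B' Q z + annulusPart B.c0 B'.c0 β Q.P₀ x₀ y₀ z +
        annulusPart B.c1 B'.c1 α Q.P₁ x₁ y₁ (z - 1) +
        annulusPart B.cI B'.cI (α + β) Q.PI xI yI z := by
  by_cases h : z ∈ worldsheet 1 x₀ x₁ yI
  · rw [Set.indicator_of_mem h, annulusPart_zero B B' Q h.1, annulusPart_one B B' Q h.2.2,
      annulusPart_infty B B' Q h.2.1, rest, Cutoffs.mid]
    push_cast
    ring
  · have e1 := one_sub_norm_le_norm_sub_one z
    have e2 := norm_sub_one_le_norm_sub_one z
    have f1 := Q.lt₀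
    have f2 := Q.lt₁
    have f3 := Q.ltI
    have f4 := Q.add_lt
    have f5 := Q.lt_infty
    have f6 := Q.y₀_pos
    have f7 := Q.y₁_pos
    have hz : ‖z‖ ≤ x₀ ∨ ‖z - 1‖ ≤ x₁ ∨ yI ≤ ‖z‖ := by
      by_contra hcon
      simp only [not_or, not_le] at hcon
      exact h ⟨hcon.1, hcon.2.2, hcon.2.1⟩
    rw [Set.indicator_of_notMem h, rest_eq_zero B B' Q hz, annulusPart, annulusPart, annulusPart,
      Set.indicator_of_notMem, Set.indicator_of_notMem, Set.indicator_of_notMem]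
    · norm_num
    · rintro ⟨h1, h2⟩
      rcases hz with hz | hz | hz <;> linarith
    · rintro ⟨h1, h2⟩
      rcases hz with hz | hz | hz <;> linarith
    · rintro ⟨h1, h2⟩
      rcases hz with hz | hz | hz <;> linarith

theorem measurableSet_worldsheet (t : ℂ) (r s R : ℝ) : MeasurableSet (worldsheet t r s R) :=
  ((isOpen_lt continuous_const continuous_norm).inter
    ((isOpen_lt continuous_norm continuous_const).inter (isOpen_lt continuous_const
      (by fun_prop : Continuous fun z : ℂ => ‖z - t‖)))).measurableSet

/-- The integral over the worldsheet of the product of a chiral and an antichiral function. -/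
theorem integral_worldsheet {r s R : ℝ} (hr : 0 < r) (hs : 0 < s) (hrs : r + s < 1)
    (hR : 1 + s < R) (hB : B.NoZero) (hB' : B'.NoZero) :
    IntegrableOn (fun z => B.A z * conj (B'.A z)) (worldsheet 1 r s R) ∧
    ∫ z in worldsheet 1 r s R, B.A z * conj (B'.A z) =
      localSeries B.cI B'.cI (α + β) (R ^ 2) - localSeries B.c1 B'.c1 α (s ^ 2) -
        localSeries B.c0 B'.c0 β (r ^ 2) +
      I / 2 * (B.C * conj B'.C * (-1 + exp (-2 * Real.pi * I * α)) +
        B.D * conj B'.D * (1 - exp (2 * Real.pi * I * β))) := by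
  -- Two collars of width δ must fit into each of the gaps 1 - r - s and R - 1 - s, with something
  -- to spare.
  obtain ⟨δ, hδ, hδ1, hδ2⟩ : ∃ δ : ℝ, 0 < δ ∧ 3 * δ ≤ 1 - r - s ∧ 3 * δ ≤ R - 1 - s :=
    ⟨min (1 - r - s) (R - 1 - s) / 3, div_pos (lt_min (by linarith) (by linarith)) three_pos,
      by linarith [min_le_left (1 - r - s) (R - 1 - s)],
      by linarith [min_le_right (1 - r - s) (R - 1 - s)]⟩
  obtain ⟨Q⟩ := exists_cutoffs (y₀ := r + δ) (y₁ := s + δ) (xI := R - δ) (yI := R) hr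
    (by linarith) hs (by linarith) (by linarith) (by linarith) (by linarith)
  have s0 : Set.Icc r (r + δ) ⊆ Set.Ioo 0 1 := fun x hx =>
    ⟨hr.trans_le hx.1, by linarith [hx.2]⟩
  have s1 : Set.Icc s (s + δ) ⊆ Set.Ioo 0 1 := fun x hx =>
    ⟨hs.trans_le hx.1, by linarith [hx.2]⟩
  have sI : Set.Icc (R - δ) R ⊆ Set.Ioi 1 := fun x hx => by
    have := hx.1
    rw [Set.mem_Ioi]; linarith
  have i0 := integrable_annulusPart isOpen_Ioo B.conv0 B'.conv0 β Q.smooth₀ s0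
  have i1 := (integrable_annulusPart isOpen_Ioo B.conv1 B'.conv1 α Q.smooth₁ s1).comp_sub_right 1
  have iI := integrable_annulusPart isOpen_Ioi B.convI B'.convI (α + β) Q.smoothI sI
  have iR := integrable_rest B B' Q
  have hfun := funext (indicator_A_mul_conj B B' Q)
  have hm := measurableSet_worldsheet 1 r s R
  constructor
  · rw [← integrable_indicator_iff hm, hfun]
    exact ((iR.add i0).add i1).add iI
  · rw [← integral_indicator hm, hfun]
    refine (integral_add ((iR.add i0).add i1) iI).trans ?_
    rw [integral_add' (iR.add i0) i1, integral_add' iR i0,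
      integral_sub_right_eq_self (annulusPart B.c1 B'.c1 α Q.P₁ s (s + δ)) 1,
      integral_annulusPart isOpen_Ioo B.conv0 B'.conv0 hB.zero Q.smooth₀ (by linarith) s0,
      integral_annulusPart isOpen_Ioo B.conv1 B'.conv1 hB.one Q.smooth₁ (by linarith) s1,
      integral_annulusPart isOpen_Ioi B.convI B'.convI hB.infty Q.smoothI (by linarith) sI,
      Q.eq_one₀ _ le_rfl, Q.eq_zero₀ _ le_rfl, Q.eq_one₁ _ le_rfl, Q.eq_zero₁ _ le_rfl,
      Q.eq_zeroI _ le_rfl, Q.eq_oneI _ le_rfl, integral_rest B B' Q hB hB']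
    push_cast
    ring

end TriBlock

/-! ### Integral exponents -/

theorem exp_two_pi_eq_one_iff (γ : ℝ) :
    exp (2 * Real.pi * I * γ) = 1 ↔ ∃ n : ℤ, γ = n := by
  rw [Complex.exp_eq_one_iff]
  refine exists_congr fun n => ?_
  have h : (2 * Real.pi * I : ℂ) ≠ 0 := two_pi_I_ne_zero
  rw [mul_comm (n : ℂ), mul_right_inj' h]
  exact_mod_cast Iff.rfl

theorem exp_neg_two_pi_eq_one_iff (γ : ℝ) :
    exp (-2 * Real.pi * I * γ) = 1 ↔ ∃ n : ℤ, γ = n := by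
  rw [← exp_two_pi_eq_one_iff]
  have h := TriBlock.exp_mul_exp_two_pi γ
  constructor <;> intro h'
  · rwa [h', mul_one] at h
  · rwa [h', one_mul] at h

namespace TriBlock

variable {α β : ℝ} (B B' : TriBlock α β)

theorem D_eq_zero (hB : B.NoZero) (hα : ∃ n : ℤ, α = n) (hβ : ¬ ∃ n : ℤ, β = n) : B.D = 0 := by
  have h := B.D_mul_eq_C_mul hB
  rw [(exp_two_pi_eq_one_iff α).2 hα, sub_self, mul_zero] at h
  exact (mul_eq_zero.1 h).resolve_right
    (sub_ne_zero.2 fun h => hβ ((exp_neg_two_pi_eq_one_iff β).1 h.symm))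

theorem C_eq_zero (hB : B.NoZero) (hα : ¬ ∃ n : ℤ, α = n) (hβ : ∃ n : ℤ, β = n) : B.C = 0 := by
  have h := B.D_mul_eq_C_mul hB
  rw [(exp_neg_two_pi_eq_one_iff β).2 hβ, sub_self, mul_zero] at h
  exact (mul_eq_zero.1 h.symm).resolve_right
    (sub_ne_zero.2 fun h => hα ((exp_two_pi_eq_one_iff α).1 h.symm))

/-- If α + β is an integer, the two factors in the monodromy relation coincide, and they are nonzero
for nonintegral α. -/
theorem C_eq_D (hB : B.NoZero) (hα : ¬ ∃ n : ℤ, α = n) (h : ∃ n : ℤ, α + β = n) :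
    B.C = B.D ∧ exp (-2 * Real.pi * I * α) = exp (2 * Real.pi * I * β) := by
  have h1 := (exp_two_pi_eq_one_iff (α + β)).2 h
  rw [ofReal_add, mul_add, Complex.exp_add] at h1
  have h2 := exp_mul_exp_two_pi α
  have h3 := exp_mul_exp_two_pi β
  have h4 : exp (-2 * Real.pi * I * β) = exp (2 * Real.pi * I * α) := by
    linear_combination (-exp (-2 * Real.pi * I * β)) * h1 + exp (2 * Real.pi * I * α) * h3
  refine ⟨?_, by
    linear_combination (-exp (-2 * Real.pi * I * α)) * h1 + exp (2 * Real.pi * I * β) * h2⟩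
  have h5 := B.D_mul_eq_C_mul hB
  rw [h4] at h5
  exact (mul_right_cancel₀
    (sub_ne_zero.2 fun h => hα ((exp_two_pi_eq_one_iff α).1 h.symm)) h5).symm

/-- The contribution of the constants vanishes if one of the three exponents is an integer. -/
theorem constants_eq_zero (hB : B.NoZero) (hB' : B'.NoZero)
    (h : (∃ n : ℤ, α = n) ∨ (∃ n : ℤ, β = n) ∨ ∃ n : ℤ, α + β = n) :
    B.C * conj B'.C * (-1 + exp (-2 * Real.pi * I * α)) +
      B.D * conj B'.D * (1 - exp (2 * Real.pi * I * β)) = 0 := by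
  by_cases hα : ∃ n : ℤ, α = n
  · rw [(exp_neg_two_pi_eq_one_iff α).2 hα]
    by_cases hβ : ∃ n : ℤ, β = n
    · rw [(exp_two_pi_eq_one_iff β).2 hβ]; ring
    · rw [B.D_eq_zero hB hα hβ]; ring
  · by_cases hβ : ∃ n : ℤ, β = n
    · rw [(exp_two_pi_eq_one_iff β).2 hβ, B.C_eq_zero hB hα hβ]; ring
    · have hs : ∃ n : ℤ, α + β = n := (h.resolve_left hα).resolve_left hβ
      obtain ⟨h1, h2⟩ := B.C_eq_D hB hα hs
      rw [h1, (B'.C_eq_D hB' hα hs).1, h2]; ring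

end TriBlock

/-! ### Blocks from expansions in the upper half-plane -/

theorem LaurentConv.differentiableOn {c : ℤ → ℂ} {U : Set ℝ} (h : LaurentConv c U)
    (hU : IsOpen U) : DifferentiableOn ℂ (laurent c) {z | ‖z‖ ∈ U} := fun _ hz =>
  (h.differentiableAt hU hz).differentiableWithinAt

theorem isPreconnected_punctured_disc : IsPreconnected {z : ℂ | 0 < ‖z‖ ∧ ‖z‖ < 1} := by
  have h : {z : ℂ | 0 < ‖z‖ ∧ ‖z‖ < 1} = exp '' {z | z.re < 0} := by
    ext z
    constructor
    · rintro ⟨h0, h1⟩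
      refine ⟨log z, ?_, exp_log (norm_pos_iff.1 h0)⟩
      rw [Set.mem_ofPred_eq, log_re]
      exact Real.log_neg h0 h1
    · rintro ⟨w, hw, rfl⟩
      rw [Set.mem_ofPred_eq, norm_exp]
      exact ⟨Real.exp_pos _, Real.exp_zero ▸ Real.exp_lt_exp.2 hw⟩
  rw [h]
  exact (convex_halfSpace_re_lt 0).isPreconnected.image _ continuous_exp.continuousOn

theorem isPreconnected_exterior : IsPreconnected {z : ℂ | 1 < ‖z‖} := by
  have h : {z : ℂ | 1 < ‖z‖} = exp '' {z | 0 < z.re} := by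
    ext z
    constructor
    · intro h1
      refine ⟨log z, ?_, exp_log (norm_pos_iff.1 (zero_lt_one.trans h1))⟩
      rw [Set.mem_ofPred_eq, log_re]
      exact Real.log_pos h1
    · rintro ⟨w, hw, rfl⟩
      rw [Set.mem_ofPred_eq, norm_exp]
      exact Real.one_lt_exp_iff.2 hw
  rw [h]
  exact (convex_halfSpace_re_gt 0).isPreconnected.image _ continuous_exp.continuousOn

theorem eqOn_of_differentiableOn {U V : Set ℂ} (hU : IsOpen U) (hc : IsPreconnected U)
    {f g : ℂ → ℂ} (hf : DifferentiableOn ℂ f U) (hg : DifferentiableOn ℂ g U) (hV : IsOpen V)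
    {p : ℂ} (hpV : p ∈ V) (hVU : V ⊆ U) (h : ∀ z ∈ V, f z = g z) : Set.EqOn f g U := by
  refine (hf.analyticOnNhd hU).eqOn_of_preconnected_of_eventuallyEq (hg.analyticOnNhd hU) hc
    (hVU hpV) ?_
  filter_upwards [hV.mem_nhds hpV] with z hz using h z hz

theorem summable_of_hasSum_cpow {c : ℤ → ℂ} {γ : ℝ} {y s : ℂ} (hy : y ≠ 0)
    (h : HasSum (fun n : ℤ => c n * y ^ ((n + γ - 1 : ℝ) : ℂ)) s) :
    Summable fun n : ℤ => ‖c n‖ * ‖y‖ ^ n := by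
  have h1 := h.summable.norm.mul_right (‖y‖ ^ (γ - 1))⁻¹
  refine h1.congr fun n => ?_
  have hy' : 0 < ‖y‖ := norm_pos_iff.2 hy
  have hne : ‖y‖ ^ (γ - 1) ≠ 0 := (Real.rpow_pos_of_pos hy' _).ne'
  rw [norm_mul, norm_cpow_real, add_sub_assoc, Real.rpow_add hy', Real.rpow_intCast, ← mul_assoc,
    mul_assoc _ _ (_)⁻¹, mul_inv_cancel₀ hne, mul_one]

theorem tsum_cpow_eq {c : ℤ → ℂ} {γ : ℝ} {y : ℂ} (hy : y ≠ 0) :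
    ∑' n : ℤ, c n * y ^ ((n + γ - 1 : ℝ) : ℂ) = y ^ (γ : ℂ) * laurent c y / y := by
  rw [laurent, mul_div_right_comm, ← tsum_mul_left]
  refine tsum_congr fun n => ?_
  rw [show ((n + γ - 1 : ℝ) : ℂ) = (n : ℂ) + (γ - 1) by push_cast; ring, cpow_add _ _ hy,
    cpow_intCast, cpow_sub _ _ hy, cpow_one]
  ring

theorem norm_ofReal_mul_I {ρ : ℝ} (hρ : 0 < ρ) : ‖(ρ : ℂ) * I‖ = ρ := by
  rw [norm_mul, norm_I, mul_one, norm_real, Real.norm_of_nonneg hρ.le]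

/-- A block from expansions which are known to hold in the upper half-plane. -/
noncomputable def TriBlock.ofUpper {α β : ℝ} (a : ℂ → ℂ) (c0 cI c1 : ℤ → ℂ)
    (diff : DifferentiableOn ℂ a {z | z ≠ 0 ∧ z ≠ 1})
    (h0 : ∀ y : ℂ, 0 < y.im → ‖y‖ < 1 → HasSum (fun n : ℤ => c0 n * y ^ ((n + β - 1 : ℝ) : ℂ))
      ((y - 1) ^ (α : ℂ) * y ^ (β : ℂ) * a y))
    (hI : ∀ y : ℂ, 0 < y.im → 1 < ‖y‖ →
      HasSum (fun n : ℤ => cI n * y ^ ((n + (α + β) - 1 : ℝ) : ℂ))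
      ((y - 1) ^ (α : ℂ) * y ^ (β : ℂ) * a y))
    (h1 : ∀ y : ℂ, 0 < y.im → ‖y - 1‖ < 1 →
      HasSum (fun n : ℤ => c1 n * (y - 1) ^ ((n + α - 1 : ℝ) : ℂ))
      ((y - 1) ^ (α : ℂ) * y ^ (β : ℂ) * a y)) : TriBlock α β :=
  -- Absolute convergence depends only on the modulus, so the point iρ of the half-plane suffices
  -- for each radius.
  have conv0 : LaurentConv c0 (Set.Ioo 0 1) := ⟨fun _ h => h.1, fun ρ hρ => by
    have hn := norm_ofReal_mul_I hρ.1
    have := summable_of_hasSum_cpow (norm_pos_iff.1 (hn.symm ▸ hρ.1))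
      (h0 (ρ * I) (by simpa using hρ.1) (hn.symm ▸ hρ.2))
    rwa [hn] at this⟩
  have convI : LaurentConv cI (Set.Ioi 1) := ⟨fun _ h => Set.mem_Ioi.2 (zero_lt_one.trans (Set.mem_Ioi.1 h)), fun ρ hρ => by
    have hρ0 : 0 < ρ := zero_lt_one.trans hρ
    have hn := norm_ofReal_mul_I hρ0
    have := summable_of_hasSum_cpow (norm_pos_iff.1 (hn.symm ▸ hρ0))
      (hI (ρ * I) (by simpa using hρ0) (hn.symm ▸ hρ))
    rwa [hn] at this⟩
  have conv1 : LaurentConv c1 (Set.Ioo 0 1) := ⟨fun _ h => h.1, fun ρ hρ => by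
    have hn := norm_ofReal_mul_I hρ.1
    have h := h1 (1 + ρ * I) (by simpa using hρ.1) (by
      rw [add_sub_cancel_left]; exact hn.symm ▸ hρ.2)
    rw [add_sub_cancel_left] at h
    have := summable_of_hasSum_cpow (norm_pos_iff.1 (hn.symm ▸ hρ.1)) h
    rwa [hn] at this⟩
  { a := a
    c0 := c0
    cI := cI
    c1 := c1
    diff := diff
    conv0 := conv0
    convI := convI
    conv1 := conv1
    eq0 := fun z hz hz1 => by
      have hop : IsOpen {z : ℂ | 0 < ‖z‖ ∧ ‖z‖ < 1} :=
        (isOpen_lt continuous_const continuous_norm).inter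
          (isOpen_lt continuous_norm continuous_const)
      -- Once y^β is removed, both sides are single-valued and holomorphic in the punctured disc;
      -- they agree in its upper half and hence everywhere by the identity theorem.
      refine eqOn_of_differentiableOn (V := {z : ℂ | 0 < z.im ∧ ‖z‖ < 1}) hop
        isPreconnected_punctured_disc (conv0.differentiableOn isOpen_Ioo)
        (g := fun z => z * (exp (Real.pi * I * α) * (1 - z) ^ (α : ℂ) * a z)) ?_
        ((isOpen_lt continuous_const continuous_im).inter
          (isOpen_lt continuous_norm continuous_const))
        (p := 1 / 2 * I) ⟨by norm_num, by norm_num⟩ ?_ ?_ ⟨hz, hz1⟩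
      · intro z hz
        have hs : 1 - z ∈ slitPlane := one_sub_mem_slitPlane hz.2
        have ha : DifferentiableAt ℂ a z := diff.differentiableAt
          ((isOpen_ne.inter isOpen_ne).mem_nhds ⟨norm_pos_iff.1 hz.1, fun h => by
            have := hz.2; rw [h, norm_one] at this; exact lt_irrefl _ this⟩)
        have hp : DifferentiableAt ℂ (fun z : ℂ => (1 - z) ^ (α : ℂ)) z :=
          DifferentiableAt.cpow_const (by fun_prop) hs
        exact (differentiableAt_id.mul ((hp.const_mul _).mul ha)).differentiableWithinAt
      · exact fun z hz => ⟨norm_pos_iff.2 fun h => by simp [h] at hz, hz.2⟩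
      · intro y hy
        have hy0 : y ≠ 0 := fun h => by simp [h] at hy
        have h := (h0 y hy.1 hy.2).tsum_eq
        rw [tsum_cpow_eq hy0, TriBlock.sub_one_cpow hy.1.le (Or.inl hy.1.ne')] at h
        have hb : y ^ (β : ℂ) ≠ 0 := by simp [cpow_eq_zero_iff, hy0]
        rw [div_eq_iff hy0] at h
        refine mul_left_cancel₀ hb (h.trans ?_)
        ring
    eqI := fun z hz => by
      refine eqOn_of_differentiableOn (V := {z : ℂ | 0 < z.im ∧ 1 < ‖z‖})
        (isOpen_lt continuous_const continuous_norm)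
        isPreconnected_exterior (convI.differentiableOn isOpen_Ioi)
        (g := fun z => z * ((1 - z⁻¹) ^ (α : ℂ) * a z)) ?_
        ((isOpen_lt continuous_const continuous_im).inter
          (isOpen_lt continuous_const continuous_norm))
        (p := 2 * I) ⟨by norm_num, by norm_num⟩ (fun z hz => hz.2) ?_ hz
      · intro z hz
        have hz0 : z ≠ 0 := norm_pos_iff.1 (zero_lt_one.trans hz)
        have hs : 1 - z⁻¹ ∈ slitPlane := one_sub_mem_slitPlane (by
          rw [norm_inv]; exact inv_lt_one_of_one_lt₀ hz)
        have ha : DifferentiableAt ℂ a z := diff.differentiableAt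
          ((isOpen_ne.inter isOpen_ne).mem_nhds ⟨hz0, fun h => by
            rw [h, Set.mem_ofPred_eq, norm_one] at hz; exact lt_irrefl _ hz⟩)
        have hp : DifferentiableAt ℂ (fun z : ℂ => (1 - z⁻¹) ^ (α : ℂ)) z :=
          DifferentiableAt.cpow_const ((differentiableAt_const _).sub (differentiableAt_inv hz0)) hs
        exact (differentiableAt_id.mul (hp.mul ha)).differentiableWithinAt
      · intro y hy
        have hy0 : y ≠ 0 := fun h => by simp [h] at hy
        have h := (hI y hy.1 hy.2).tsum_eq
        rw [tsum_cpow_eq hy0, TriBlock.sub_one_cpow_of_one_lt hy.1.le hy.2] at h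
        have hb : y ^ ((α + β : ℝ) : ℂ) ≠ 0 := by simp [cpow_eq_zero_iff, hy0]
        rw [div_eq_iff hy0] at h
        refine mul_left_cancel₀ hb (h.trans ?_)
        rw [ofReal_add, cpow_add _ _ hy0]
        ring
    eq1 := fun z hz hz1 => by
      have hop : IsOpen {z : ℂ | 0 < ‖z‖ ∧ ‖z‖ < 1} :=
        (isOpen_lt continuous_const continuous_norm).inter
          (isOpen_lt continuous_norm continuous_const)
      refine eqOn_of_differentiableOn (V := {z : ℂ | 0 < z.im ∧ ‖z‖ < 1}) hop
        isPreconnected_punctured_disc (conv1.differentiableOn isOpen_Ioo)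
        (g := fun z => z * ((1 + z) ^ (β : ℂ) * a (1 + z))) ?_
        ((isOpen_lt continuous_const continuous_im).inter
          (isOpen_lt continuous_norm continuous_const))
        (p := 1 / 2 * I) ⟨by norm_num, by norm_num⟩ ?_ ?_ ⟨hz, hz1⟩
      · intro z hz
        have hs : 1 + z ∈ slitPlane := by
          have := one_sub_mem_slitPlane (z := -z) (by simpa using hz.2)
          rwa [sub_neg_eq_add] at this
        have ha : DifferentiableAt ℂ a (1 + z) := diff.differentiableAt
          ((isOpen_ne.inter isOpen_ne).mem_nhds ⟨slitPlane_ne_zero hs, fun h => by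
            have := hz.1; rw [add_eq_left.1 h, norm_zero] at this; exact lt_irrefl _ this⟩)
        have ha' : DifferentiableAt ℂ (fun z => a (1 + z)) z :=
          ha.comp z (by fun_prop)
        have hp : DifferentiableAt ℂ (fun z : ℂ => (1 + z) ^ (β : ℂ)) z :=
          DifferentiableAt.cpow_const (by fun_prop) hs
        exact (differentiableAt_id.mul (hp.mul ha')).differentiableWithinAt
      · exact fun z hz => ⟨norm_pos_iff.2 fun h => by simp [h] at hz, hz.2⟩
      · intro y hy
        have hy0 : y ≠ 0 := fun h => by simp [h] at hy
        have h := (h1 (1 + y) (by simpa using hy.1) (by simpa using hy.2)).tsum_eq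
        rw [add_sub_cancel_left, tsum_cpow_eq hy0] at h
        have hb : y ^ (α : ℂ) ≠ 0 := by simp [cpow_eq_zero_iff, hy0]
        rw [div_eq_iff hy0] at h
        refine mul_left_cancel₀ hb (h.trans ?_)
        ring }

/-! ### Uniqueness of coefficients and linearity of the constants -/

/-- By Parseval's identity on the single circle of radius ρ, the sum of |c_n|² ρ^(2n) is zero. -/
theorem LaurentConv.eq_zero {c : ℤ → ℂ} {U : Set ℝ} (h : LaurentConv c U) {ρ : ℝ} (hρ : ρ ∈ U)
    (h0 : ∀ z : ℂ, ‖z‖ = ρ → laurent c z = 0) (n : ℤ) : c n = 0 := by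
  have hρ0 : 0 < ρ := h.1 hρ
  have hp := integral_laurent_mul_conj hρ0 (h.2 ρ hρ) (h.2 ρ hρ)
  have hz : ∀ θ : ℝ, laurent c (ρ * exp (θ * I)) = 0 := fun θ => h0 _ (by
    rw [norm_mul, norm_exp_ofReal_mul_I, mul_one, norm_real, Real.norm_of_nonneg hρ0.le])
  simp only [hz, zero_mul, integral_zero] at hp
  have hp' := (mul_eq_zero.1 hp.symm).resolve_left
    (mul_ne_zero two_ne_zero (by exact_mod_cast Real.pi_ne_zero))
  have hV : LaurentConv (fun n => c n * conj (c n)) {ρ ^ 2} :=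
    h.mul_conj h fun x hx => by
      rw [Set.mem_singleton_iff] at hx
      rw [hx]
      exact ⟨pow_pos hρ0 2, by rwa [Real.sqrt_sq hρ0.le]⟩
  have hsum := hV.2 (ρ ^ 2) rfl
  have e : ∀ n : ℤ, c n * conj (c n) * ((ρ ^ 2 : ℝ) : ℂ) ^ n =
      ((‖c n * conj (c n)‖ * (ρ ^ 2) ^ n : ℝ) : ℂ) := fun n => by
    rw [Complex.mul_conj, norm_real, Real.norm_of_nonneg (normSq_nonneg _)]
    push_cast; rfl
  rw [laurent, tsum_congr e, ← ofReal_tsum, ofReal_eq_zero] at hp'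
  have hn := (hasSum_zero_iff_of_nonneg fun n => by positivity).1 (hp' ▸ hsum.hasSum)
  have hn' := congrFun hn n
  have hne : (ρ ^ 2) ^ n ≠ 0 := (zpow_pos (pow_pos hρ0 2) n).ne'
  simpa [hne, hρ0.ne'] using hn'

theorem LaurentConv.laurent_mul_add {c d e : ℤ → ℂ} {U : Set ℝ} (hc : LaurentConv c U)
    (hd : LaurentConv d U) {k : ℂ} (h : ∀ n, e n = k * c n + d n) (γ : ℝ) {z : ℂ} (hz : ‖z‖ ∈ U) :
    laurent (fun n => e n / (n + γ)) z =
      k * laurent (fun n => c n / (n + γ)) z + laurent (fun n => d n / (n + γ)) z := by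
  have := (((hc.div γ).hasSum hz).mul_left k).add ((hd.div γ).hasSum hz)
  rw [← this.tsum_eq, laurent]
  refine tsum_congr fun n => ?_
  rw [h]; ring

namespace TriBlock

variable {α β : ℝ} (B : TriBlock α β)

theorem coeff_eq_zero (h : ∀ y, y ≠ 0 → y ≠ 1 → B.a y = 0) :
    (∀ n, B.c0 n = 0) ∧ (∀ n, B.cI n = 0) ∧ ∀ n, B.c1 n = 0 := by
  refine ⟨B.conv0.eq_zero (ρ := 1 / 2) ⟨by norm_num, by norm_num⟩ fun z hz => ?_,
    B.convI.eq_zero (ρ := 2) (by norm_num [Set.mem_Ioi]) fun z hz => ?_,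
    B.conv1.eq_zero (ρ := 1 / 2) ⟨by norm_num, by norm_num⟩ fun z hz => ?_⟩
  · rw [B.eq0 z (by rw [hz]; norm_num) (by rw [hz]; norm_num), h z, mul_zero, mul_zero]
    · rintro rfl; norm_num at hz
    · rintro rfl; norm_num at hz
  · rw [B.eqI z (by rw [hz]; norm_num), h z, mul_zero, mul_zero]
    · rintro rfl; norm_num at hz
    · rintro rfl; norm_num at hz
  · rw [B.eq1 z (by rw [hz]; norm_num) (by rw [hz]; norm_num), h (1 + z), mul_zero, mul_zero]
    · intro h0
      rw [eq_neg_of_add_eq_zero_right h0] at hz; norm_num at hz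
    · intro h0
      rw [add_eq_left.1 h0] at hz; norm_num at hz

theorem eq_zero_of_c0 (h : ∀ n, B.c0 n = 0) {y : ℂ} (hy0 : y ≠ 0) (hy1 : y ≠ 1) : B.a y = 0 := by
  have hc : IsPreconnected {z : ℂ | z ≠ 0 ∧ z ≠ 1} := by
    have := (Set.Countable.isConnected_compl_of_one_lt_rank (by simp)
      ((Set.finite_singleton (1 : ℂ)).insert 0).countable).isPreconnected
    convert this using 1
    ext z; simp
  have h1 : ∀ z : ℂ, 0 < ‖z‖ → ‖z‖ < 1 → B.a z = 0 := by
    intro z hz0 hz1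
    have := B.eq0 z hz0 hz1
    have hl : laurent B.c0 z = 0 := by simp [laurent, h]
    have hp : (1 - z) ^ (α : ℂ) ≠ 0 := by
      rw [Ne, cpow_eq_zero_iff]
      exact fun h' => slitPlane_ne_zero (one_sub_mem_slitPlane hz1) h'.1
    simpa [hl, norm_pos_iff.1 hz0, hp] using this
  exact eqOn_of_differentiableOn (isOpen_ne.inter isOpen_ne) hc B.diff
    (g := fun _ => 0) (differentiableOn_const _) (V := {z : ℂ | 0 < ‖z‖ ∧ ‖z‖ < 1})
    ((isOpen_lt continuous_const continuous_norm).inter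
      (isOpen_lt continuous_norm continuous_const)) (p := 1 / 2)
    ⟨by norm_num, by norm_num⟩ (fun z hz => ⟨norm_pos_iff.1 hz.1, fun h => by
      have := hz.2; rw [h, norm_one] at this; exact lt_irrefl _ this⟩)
    (fun z hz => h1 z hz.1 hz.2) ⟨hy0, hy1⟩

theorem constants_eq_zero_of_coeff (h : (∀ n, B.c0 n = 0) ∧ (∀ n, B.cI n = 0) ∧ ∀ n, B.c1 n = 0) :
    B.C = 0 ∧ B.D = 0 := by
  simp [C, D, w0, w1, wI, laurent, h.1, h.2.1, h.2.2]

/-- The constants depend linearly on the coefficients. -/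
theorem constants_mul_add {B₁ B₂ B₃ : TriBlock α β} {k : ℂ}
    (h0 : ∀ n, B₃.c0 n = k * B₁.c0 n + B₂.c0 n) (hI : ∀ n, B₃.cI n = k * B₁.cI n + B₂.cI n)
    (h1 : ∀ n, B₃.c1 n = k * B₁.c1 n + B₂.c1 n) :
    B₃.C = k * B₁.C + B₂.C ∧ B₃.D = k * B₁.D + B₂.D := by
  have n0 : ∀ z : ℂ, 0 < z.im → ‖z‖ < 1 → B₃.w0 z = k * B₁.w0 z + B₂.w0 z := fun z hz hz1 => by
    rw [w0, w0, w0, B₁.conv0.laurent_mul_add B₂.conv0 h0 β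
      ⟨norm_pos_iff.2 (slitPlane_ne_zero (slitPlane_of_im_pos hz)), hz1⟩]
    ring
  have nI : ∀ z : ℂ, 1 < ‖z‖ → B₃.wI z = k * B₁.wI z + B₂.wI z := fun z hz1 => by
    rw [wI, wI, wI, B₁.convI.laurent_mul_add B₂.convI hI (α + β) hz1]
    ring
  have n1 : ∀ z : ℂ, 0 < z.im → ‖z - 1‖ < 1 → B₃.w1 z = k * B₁.w1 z + B₂.w1 z :=
    fun z hz hz1 => by
    rw [w1, w1, w1, B₁.conv1.laurent_mul_add B₂.conv1 h1 α
      ⟨norm_pos_iff.2 (slitPlane_ne_zero (slitPlane_of_im_pos (by simpa using hz))), hz1⟩]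
    ring
  have hi : (0 : ℝ) < (1 + I / 2 : ℂ).im := by norm_num
  have hi' : (0 : ℝ) < (1 / 2 + I / 2 : ℂ).im := by norm_num
  have hC : B₃.C = k * B₁.C + B₂.C := by
    rw [C, C, C, nI _ norm_one_add_I_half, n1 _ hi norm_I_half]
    ring
  refine ⟨hC, ?_⟩
  rw [D, D, D, hC, n1 _ hi' norm_half_add_I_half_sub_one, n0 _ hi' norm_half_add_I_half]
  ring

end TriBlock

/-! ### Functionals and projections on a graded space -/

section Graded

variable {W : Type*} [AddCommGroup W] [Module ℂ W] {gr : ℝ × ℝ → Submodule ℂ W}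

open Classical in
/-- Projection to a weight space. -/
noncomputable def weightProj (hgr : DirectSum.IsInternal gr) (h : ℝ × ℝ) : W →ₗ[ℂ] W :=
  (gr h).subtype ∘ₗ DirectSum.component ℂ (ℝ × ℝ) (fun i => gr i) h ∘ₗ
    (LinearEquiv.ofBijective (DirectSum.coeLinearMap gr) hgr).symm.toLinearMap

open Classical in
theorem weightProj_apply (hgr : DirectSum.IsInternal gr) (h : ℝ × ℝ) (x : W) :
    weightProj hgr h x =
      ((LinearEquiv.ofBijective (DirectSum.coeLinearMap gr) hgr).symm x h : W) := rfl

open Classical in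
theorem symm_of_mem (hgr : DirectSum.IsInternal gr) {h : ℝ × ℝ} {x : W} (hx : x ∈ gr h) :
    (LinearEquiv.ofBijective (DirectSum.coeLinearMap gr) hgr).symm x =
      DirectSum.lof ℂ (ℝ × ℝ) (fun i => gr i) h ⟨x, hx⟩ := by
  rw [LinearEquiv.symm_apply_eq]
  exact (DirectSum.coeLinearMap_lof gr h ⟨x, hx⟩).symm

theorem weightProj_of_mem (hgr : DirectSum.IsInternal gr) {h : ℝ × ℝ} {x : W} (hx : x ∈ gr h) :
    weightProj hgr h x = x := by
  classical
  rw [weightProj_apply, symm_of_mem hgr hx, DirectSum.lof_apply]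

theorem weightProj_of_ne (hgr : DirectSum.IsInternal gr) {h k : ℝ × ℝ} (hk : k ≠ h) {x : W}
    (hx : x ∈ gr k) : weightProj hgr h x = 0 := by
  classical
  rw [weightProj_apply, symm_of_mem hgr hx, DirectSum.lof_eq_of,
    DirectSum.of_eq_of_ne _ _ _ hk.symm]
  rfl

theorem isOfWeight_comp (hgr : DirectSum.IsInternal gr) (h : ℝ × ℝ) (f : Module.Dual ℂ W) :
    IsOfWeight gr h (f ∘ₗ weightProj hgr h) := fun k hk x hx => by
  rw [LinearMap.comp_apply, weightProj_of_ne hgr hk hx, map_zero]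

theorem mem_of_weightProj (hgr : DirectSum.IsInternal gr) {h : ℝ × ℝ} {y : W}
    (hy : ∀ k, k ≠ h → weightProj hgr k y = 0) : y ∈ gr h := by
  classical
  set e := LinearEquiv.ofBijective (DirectSum.coeLinearMap gr) hgr
  have h1 : e.symm y = DirectSum.lof ℂ (ℝ × ℝ) (fun i => gr i) h (e.symm y h) := by
    refine DFinsupp.ext fun k => ?_
    by_cases hk : k = h
    · subst hk; rw [DirectSum.lof_apply]
    · rw [DirectSum.lof_eq_of, DirectSum.of_eq_of_ne _ _ _ hk]
      exact Subtype.ext (hy k hk)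
  have h2 : e (e.symm y) = (e.symm y h : W) := by
    rw [h1]
    refine (DirectSum.coeLinearMap_lof gr h _).trans ?_
    rw [DirectSum.lof_apply]
  rw [← e.apply_symm_apply y, h2]
  exact (e.symm y h).2

theorem mem_of_isOfWeight (hgr : DirectSum.IsInternal gr) {h : ℝ × ℝ} {y : W}
    (hy : ∀ k, k ≠ h → ∀ f, IsOfWeight gr k f → f y = 0) : y ∈ gr h :=
  mem_of_weightProj hgr fun k hk =>
    (Module.forall_dual_apply_eq_zero_iff ℂ _).1 fun f => hy k hk _ (isOfWeight_comp hgr k f)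

/-- A property of vectors holds if it holds for homogeneous ones and is additive. -/
theorem graded_induction (hgr : DirectSum.IsInternal gr) {p : W → Prop}
    (mem : ∀ h, ∀ x ∈ gr h, p x) (zero : p 0) (add : ∀ x y, p x → p y → p (x + y)) (x : W) :
    p x := by
  classical
  refine Submodule.iSup_induction gr (motive := p) ?_ mem zero add
  rw [hgr.submodule_iSup_eq_top]
  trivial

end Graded

/-! ### Finite-dimensional subspaces and functionals on the dual -/

section Dual

variable {W : Type*} [AddCommGroup W] [Module ℂ W]

/-- A family of functionals which gives the coordinates on a finite dimensional subspace. -/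
theorem exists_dual_family (S : Submodule ℂ W) [FiniteDimensional ℂ S] :
    ∃ (d : ℕ) (e : Fin d → W) (g : Fin d → Module.Dual ℂ W), (∀ i, e i ∈ S) ∧
      ∀ x ∈ S, x = ∑ i, g i x • e i := by
  set b := Module.finBasis ℂ S
  choose g hg using fun i => LinearMap.exists_extend (b.coord i)
  refine ⟨_, fun i => b i, g, fun i => (b i).2, fun x hx => ?_⟩
  have h := congrArg (Subtype.val) (b.sum_repr ⟨x, hx⟩)
  have h1 : ∀ i, g i x = b.repr ⟨x, hx⟩ i := fun i => by
    have := LinearMap.congr_fun (hg i) ⟨x, hx⟩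
    simpa using this
  rw [AddSubmonoidClass.coe_finsetSum] at h
  exact h.symm.trans (Finset.sum_congr rfl fun i _ => by rw [h1]; rfl)

/-- Functionals on the dual which vanish on the annihilator of a finite dimensional space are
evaluations. -/
theorem exists_eval (S : Submodule ℂ W) [FiniteDimensional ℂ S] (Θ : Module.Dual ℂ W →ₗ[ℂ] ℂ)
    (h : ∀ f : Module.Dual ℂ W, (∀ s ∈ S, f s = 0) → Θ f = 0) :
    ∃ y ∈ S, ∀ f, f y = Θ f := by
  obtain ⟨d, e, g, he, hg⟩ := exists_dual_family S
  refine ⟨∑ i, Θ (g i) • e i, Submodule.sum_mem _ fun i _ => S.smul_mem _ (he i), fun f => ?_⟩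
  have h0 := h (f - ∑ i, f (e i) • g i) fun s hs => by
    conv_lhs => rw [LinearMap.sub_apply]; arg 1; rw [hg s hs]
    simp [mul_comm]
  rw [map_sub, sub_eq_zero] at h0
  rw [h0]
  simp [mul_comm]

theorem mem_of_dual (S : Submodule ℂ W) {x : W}
    (h : ∀ f : Module.Dual ℂ W, (∀ s ∈ S, f s = 0) → f x = 0) : x ∈ S := by
  by_contra hx
  obtain ⟨f, hf, hS⟩ := Submodule.exists_le_ker_of_notMem hx
  exact hf (h f fun s hs => hS hs)

end Dual

/-! ### Polynomial growth forces finite-dimensional spans -/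

section Growth

/-- A weight function on the sphere which grows at `0`, `t` and `∞`. -/
noncomputable def poleWeight (t z : ℂ) : ℝ := 1 + ‖z‖ + ‖z‖⁻¹ + ‖z - t‖⁻¹

theorem one_le_poleWeight (t z : ℂ) : 1 ≤ poleWeight t z := by
  have := norm_nonneg z
  have : 0 ≤ ‖z‖⁻¹ := by positivity
  have : 0 ≤ ‖z - t‖⁻¹ := by positivity
  rw [poleWeight]; linarith

theorem MeromorphicAt.exists_norm_le {g : ℂ → ℂ} {p : ℂ} (h : MeromorphicAt g p) :
    ∃ (N : ℕ) (δ : ℝ), 0 < δ ∧ ∀ z, z ≠ p → ‖z - p‖ < δ → ‖g z‖ ≤ N * (‖z - p‖⁻¹) ^ N := by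
  obtain ⟨n, hn⟩ := h
  have hc : ContinuousAt (fun z => ‖(z - p) ^ n • g z‖) p := hn.continuousAt.norm
  obtain ⟨M, hM⟩ := exists_nat_gt (‖(p - p) ^ n • g p‖)
  obtain ⟨δ, hδ, hδ'⟩ := Metric.mem_nhds_iff.1 (hc.eventually_lt_const hM)
  refine ⟨max M n, min δ 1, lt_min hδ one_pos, fun z hz hzp => ?_⟩
  have h1 : ‖(z - p) ^ n • g z‖ < M := hδ' (by
    rw [Metric.mem_ball, dist_eq_norm]; exact hzp.trans_le (min_le_left _ _))
  have hpos : 0 < ‖z - p‖ := norm_pos_iff.2 (sub_ne_zero.2 hz)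
  have hinv : 1 ≤ ‖z - p‖⁻¹ := one_le_inv_iff₀.2 ⟨hpos, (hzp.trans_le (min_le_right _ _)).le⟩
  rw [norm_smul, norm_pow] at h1
  have h2 : ‖g z‖ = ‖z - p‖ ^ n * ‖g z‖ * (‖z - p‖⁻¹) ^ n := by
    rw [inv_pow, mul_right_comm, mul_inv_cancel₀ (pow_ne_zero n hpos.ne'), one_mul]
  rw [h2]
  calc ‖z - p‖ ^ n * ‖g z‖ * (‖z - p‖⁻¹) ^ n ≤ M * (‖z - p‖⁻¹) ^ n := by gcongr
    _ ≤ ((max M n : ℕ) : ℝ) * (‖z - p‖⁻¹) ^ (max M n) := by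
      have h3 : (M : ℝ) ≤ ((max M n : ℕ) : ℝ) := by exact_mod_cast le_max_left M n
      exact mul_le_mul h3 (pow_le_pow_right₀ hinv (le_max_right _ _)) (by positivity)
        (by positivity)

/-- A function which is meromorphic on the sphere has polynomial growth. -/
theorem MeromorphicOnSphere.exists_norm_le {t : ℂ} {g : ℂ → ℂ} (h : MeromorphicOnSphere t g) :
    ∃ N : ℕ, ∀ z, z ≠ 0 → z ≠ t → ‖g z‖ ≤ N * poleWeight t z ^ N := by
  obtain ⟨hd, h0, ht, hI⟩ := h
  obtain ⟨N₀, δ₀, hδ₀, e0⟩ := h0.exists_norm_le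
  obtain ⟨N₁, δ₁, hδ₁, e1⟩ := ht.exists_norm_le
  obtain ⟨N₂, δ₂, hδ₂, e2⟩ := hI.exists_norm_le
  have hK : IsCompact ({z : ℂ | δ₀ ≤ ‖z‖ ∧ ‖z‖ ≤ δ₂⁻¹} ∩ {z | δ₁ ≤ ‖z - t‖}) :=
    (isCompact_annulus δ₀ δ₂⁻¹).inter_right
      (isClosed_le continuous_const (by fun_prop : Continuous fun z : ℂ => ‖z - t‖))
  have hcont : ContinuousOn g ({z : ℂ | δ₀ ≤ ‖z‖ ∧ ‖z‖ ≤ δ₂⁻¹} ∩ {z | δ₁ ≤ ‖z - t‖}) :=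
    hd.continuousOn.mono fun z hz => ⟨norm_pos_iff.1 (hδ₀.trans_le hz.1.1),
      sub_ne_zero.1 (norm_pos_iff.1 (hδ₁.trans_le hz.2))⟩
  obtain ⟨M, hM⟩ := hK.exists_bound_of_continuousOn hcont
  obtain ⟨N₃, hN₃⟩ := exists_nat_ge M
  -- One number serves as constant and as exponent, so that the bounds form a countable increasing
  -- family that a diagonal argument can beat.
  set N := max (max N₀ N₁) (max N₂ N₃) with hN
  have key : ∀ (n : ℕ) (a x : ℝ) (z : ℂ), n ≤ N → 0 ≤ a → a ≤ poleWeight t z → x ≤ n * a ^ n →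
      x ≤ N * poleWeight t z ^ N := by
    intro n a x z hn ha haw hx
    refine hx.trans ?_
    have := one_le_poleWeight t z
    calc (n : ℝ) * a ^ n ≤ N * poleWeight t z ^ n := by gcongr
      _ ≤ _ := by gcongr
  refine ⟨N, fun z hz0 hzt => ?_⟩
  have p1 : 0 ≤ ‖z‖ := norm_nonneg z
  have p2 : 0 ≤ ‖z‖⁻¹ := by positivity
  have p3 : 0 ≤ ‖z - t‖⁻¹ := by positivity
  by_cases c0 : ‖z‖ < δ₀
  · have := e0 z hz0 (by simpa using c0)
    rw [sub_zero] at this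
    exact key N₀ _ _ z ((le_max_left _ _).trans (le_max_left _ _)) p2
      (by rw [poleWeight]; linarith) this
  by_cases c1 : ‖z - t‖ < δ₁
  · exact key N₁ _ _ z ((le_max_right _ _).trans (le_max_left _ _)) p3
      (by rw [poleWeight]; linarith) (e1 z hzt c1)
  by_cases c2 : δ₂⁻¹ < ‖z‖
  · have := e2 z⁻¹ (inv_ne_zero hz0) (by
      rw [sub_zero, norm_inv]; exact inv_lt_of_inv_lt₀ hδ₂ c2)
    rw [sub_zero, norm_inv, inv_inv, inv_inv] at this
    exact key N₂ _ _ z ((le_max_left _ _).trans (le_max_right _ _)) p1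
      (by rw [poleWeight]; linarith) this
  · refine key N₃ 1 _ z ((le_max_right _ _).trans (le_max_right _ _)) zero_le_one
      (one_le_poleWeight t z) ?_
    rw [one_pow, mul_one]
    exact (hM z ⟨⟨not_lt.1 c0, not_lt.1 c2⟩, not_lt.1 c1⟩).trans hN₃

theorem MeromorphicOnSphere.add {t : ℂ} {f g : ℂ → ℂ} (hf : MeromorphicOnSphere t f)
    (hg : MeromorphicOnSphere t g) : MeromorphicOnSphere t (fun z => f z + g z) :=
  ⟨hf.1.add hg.1, hf.2.1.add hg.2.1, hf.2.2.1.add hg.2.2.1, hf.2.2.2.add hg.2.2.2⟩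

theorem MeromorphicOnSphere.zero {t : ℂ} : MeromorphicOnSphere t (fun _ => 0) :=
  ⟨differentiableOn_const _, .const _ _, .const _ _, .const _ _⟩

/-- A family of vectors all of whose matrix elements are meromorphic on the sphere spans a finite
dimensional space. -/
theorem finiteDimensional_span_of_meromorphic {W : Type*} [AddCommGroup W] [Module ℂ W] {t : ℂ}
    {Z : ℂ → W} (hZ : ∀ f : Module.Dual ℂ W, MeromorphicOnSphere t (fun z => f (Z z))) :
    FiniteDimensional ℂ (Submodule.span ℂ (Z '' {z | z ≠ 0 ∧ z ≠ t})) := by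
  obtain ⟨b, hb, hspan, hli⟩ := exists_linearIndependent ℂ (Z '' {z | z ≠ 0 ∧ z ≠ t})
  rw [← hspan]
  refine FiniteDimensional.span_of_finite ℂ ?_
  by_contra hinf
  have : Infinite b := Set.infinite_coe_iff.2 hinf
  have hli' := hli.comp _ (Infinite.natEmbedding b).injective
  choose z hz hzb using fun j : ℕ => hb (Infinite.natEmbedding b j).2
  obtain ⟨L, hL⟩ := LinearMap.exists_leftInverse_of_injective _
    (LinearMap.ker_eq_bot.2 hli')
  -- Given infinitely many independent values Z(z_j), a functional may be prescribed on them at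
  -- will. This one takes the value (j + 1) w(z_j)^j, with w the pole weight, and at j = N violates
  -- the bound N w^N.
  set f : Module.Dual ℂ W :=
    (Finsupp.linearCombination ℂ fun j : ℕ => ((j + 1 : ℝ) * poleWeight t (z j) ^ j : ℂ)) ∘ₗ L
  have hf : ∀ j, f (Z (z j)) = ((j + 1 : ℝ) * poleWeight t (z j) ^ j : ℂ) := fun j => by
    have h1 := LinearMap.congr_fun hL (Finsupp.single j 1)
    rw [LinearMap.comp_apply, Finsupp.linearCombination_single, one_smul] at h1
    rw [hzb]
    refine (congrArg (Finsupp.linearCombination ℂ _) h1).trans ?_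
    simp
  obtain ⟨N, hN⟩ := (hZ f).exists_norm_le
  have h1 := hN (z N) (hz N).1 (hz N).2
  have hp : 0 < poleWeight t (z N) ^ N :=
    pow_pos (zero_lt_one.trans_le (one_le_poleWeight _ _)) _
  rw [hf] at h1
  have h2 : ‖((N + 1 : ℝ) * poleWeight t (z N) ^ N : ℂ)‖ = (N + 1) * poleWeight t (z N) ^ N := by
    rw [← ofReal_pow, ← ofReal_mul, norm_real, Real.norm_of_nonneg (by positivity)]
  rw [h2] at h1
  linarith

end Growth

/-! ### Chiral blocks: matrix elements for arbitrary functionals -/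

namespace Chirality

theorem replace_replace (χ : Chirality) (h : ℝ × ℝ) (a c : ℝ) :
    χ.replace (χ.replace h a) c = χ.replace h c := by cases χ <;> rfl

theorem coord_replace (χ : Chirality) (h : ℝ × ℝ) (c : ℝ) : χ.coord (χ.replace h c) = c := by
  cases χ <;> rfl

end Chirality

namespace ChiralBlock

variable {W : Type*} [AddCommGroup W] [Module ℂ W] {gr : ℝ × ℝ → Submodule ℂ W}
  {χ : Chirality} {t l : ℂ} {side : Set ℂ} {α β : ℝ} {v : W}

/-- The vectors whose matrix elements are the coefficients of the expansion at `0`. -/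
def vec0 (B : ChiralBlock gr χ t l side α β v) (c : ℝ) (n : ℤ) : W →ₗ[ℂ] W := B.Y v c * B.m n

/-- The vectors whose matrix elements are the coefficients of the expansion at `∞`. -/
def vecI (B : ChiralBlock gr χ t l side α β v) (c : ℝ) (n : ℤ) : W →ₗ[ℂ] W :=
  B.m' n * B.Y v (c - (n + α + β))

/-- The vectors whose matrix elements are the coefficients of the expansion at `t`. -/
def vec1 (B : ChiralBlock gr χ t l side α β v) (c : ℝ) (n : ℤ) : W →ₗ[ℂ] W := B.Y (B.m'' n v) c

variable (B : ChiralBlock gr χ t l side α β v)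

theorem vec0_mem (c : ℝ) (n : ℤ) {h : ℝ × ℝ} {x : W} (hx : x ∈ gr h) :
    B.vec0 c n x ∈ gr (χ.replace h c) := by
  have := B.Y_mem v _ c _ (B.m_mem h n x hx)
  rwa [χ.replace_replace] at this

theorem vecI_mem (c : ℝ) (n : ℤ) {h : ℝ × ℝ} {x : W} (hx : x ∈ gr h) :
    B.vecI c n x ∈ gr (χ.replace h c) := by
  have := B.m'_mem _ n _ (B.Y_mem v h (c - (n + α + β)) x hx)
  rwa [χ.replace_replace, χ.coord_replace, sub_add_cancel] at this

theorem vec1_mem (c : ℝ) (n : ℤ) {h : ℝ × ℝ} {x : W} (hx : x ∈ gr h) :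
    B.vec1 c n x ∈ gr (χ.replace h c) := B.Y_mem _ h c x hx

/-- For homogeneous x the vector Z x has one known weight, so an arbitrary functional may be
replaced by its composite with the projection to that weight; then additivity in x applies. The same
device frees the three expansions from the weight condition on f, which is needed because the
functionals of a dual basis are not homogeneous. -/
theorem meromorphic_all (hgr : DirectSum.IsInternal gr) (c : ℝ) (f : Module.Dual ℂ W) (x : W) :
    MeromorphicOnSphere t (fun z => f (B.Z c z x)) := by
  refine graded_induction hgr (p := fun x => MeromorphicOnSphere t (fun z => f (B.Z c z x)))
    (fun k x hx => ?_) ?_ (fun x y hx hy => ?_) x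
  · have h := B.meromorphic _ _ x (isOfWeight_comp hgr (χ.replace k c) f)
    simp only [χ.coord_replace, LinearMap.comp_apply] at h
    simpa only [weightProj_of_mem hgr (B.Z_mem k c _ x hx)] using h
  · simpa only [map_zero] using MeromorphicOnSphere.zero
  · simpa only [map_add] using hx.add hy

theorem hasSum_zero_all (hgr : DirectSum.IsInternal gr) (c : ℝ) (f : Module.Dual ℂ W) (x : W)
    {z : ℂ} (hz : z ∈ side) (h : ‖z‖ < ‖t‖) :
    HasSum (fun n : ℤ => f (B.vec0 c n x) * branchPow t l z (n + β - 1))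
      (branchPow t l (z - t) α * branchPow t l z β * f (B.Z c z x)) := by
  refine graded_induction hgr (p := fun x =>
    HasSum (fun n : ℤ => f (B.vec0 c n x) * branchPow t l z (n + β - 1))
      (branchPow t l (z - t) α * branchPow t l z β * f (B.Z c z x)))
    (fun k x hx => ?_) ?_ (fun x y hx hy => ?_) x
  · have h := B.expand_zero _ _ x (isOfWeight_comp hgr (χ.replace k c) f) z hz h
    have e : ∀ n : ℤ, f (weightProj hgr (χ.replace k c) (B.Y v c (B.m n x))) =
        f (B.vec0 c n x) := fun n => congrArg f (weightProj_of_mem hgr (B.vec0_mem c n hx))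
    simpa only [χ.coord_replace, LinearMap.comp_apply,
      weightProj_of_mem hgr (B.Z_mem k c _ x hx), e] using h
  · simp only [map_zero, zero_mul, mul_zero]
    exact hasSum_zero
  · simpa only [map_add, mul_add, add_mul] using hx.add hy

theorem hasSum_infty_all (hgr : DirectSum.IsInternal gr) (c : ℝ) (f : Module.Dual ℂ W) (x : W)
    {z : ℂ} (hz : z ∈ side) (h : ‖t‖ < ‖z‖) :
    HasSum (fun n : ℤ => f (B.vecI c n x) * branchPow t l z (n + α + β - 1))
      (branchPow t l (z - t) α * branchPow t l z β * f (B.Z c z x)) := by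
  refine graded_induction hgr (p := fun x =>
    HasSum (fun n : ℤ => f (B.vecI c n x) * branchPow t l z (n + α + β - 1))
      (branchPow t l (z - t) α * branchPow t l z β * f (B.Z c z x)))
    (fun k x hx => ?_) ?_ (fun x y hx hy => ?_) x
  · have h := B.expand_infty _ _ x (isOfWeight_comp hgr (χ.replace k c) f) z hz h
    have e : ∀ n : ℤ, f (weightProj hgr (χ.replace k c) (B.m' n (B.Y v (c - (n + α + β)) x))) =
        f (B.vecI c n x) := fun n => congrArg f (weightProj_of_mem hgr (B.vecI_mem c n hx))
    simpa only [χ.coord_replace, LinearMap.comp_apply,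
      weightProj_of_mem hgr (B.Z_mem k c _ x hx), e] using h
  · simp only [map_zero, zero_mul, mul_zero]
    exact hasSum_zero
  · simpa only [map_add, mul_add, add_mul] using hx.add hy

theorem hasSum_t_all (hgr : DirectSum.IsInternal gr) (c : ℝ) (f : Module.Dual ℂ W) (x : W)
    {z : ℂ} (hz : z ∈ side) (h : ‖z - t‖ < ‖t‖) :
    HasSum (fun n : ℤ => f (B.vec1 c n x) * branchPow t l (z - t) (n + α - 1))
      (branchPow t l (z - t) α * branchPow t l z β * f (B.Z c z x)) := by
  refine graded_induction hgr (p := fun x =>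
    HasSum (fun n : ℤ => f (B.vec1 c n x) * branchPow t l (z - t) (n + α - 1))
      (branchPow t l (z - t) α * branchPow t l z β * f (B.Z c z x)))
    (fun k x hx => ?_) ?_ (fun x y hx hy => ?_) x
  · have h := B.expand_t _ _ x (isOfWeight_comp hgr (χ.replace k c) f) z hz h
    have e : ∀ n : ℤ, f (weightProj hgr (χ.replace k c) (B.Y (B.m'' n v) c x)) =
        f (B.vec1 c n x) := fun n => congrArg f (weightProj_of_mem hgr (B.vec1_mem c n hx))
    simpa only [χ.coord_replace, LinearMap.comp_apply,
      weightProj_of_mem hgr (B.Z_mem k c _ x hx), e] using h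
  · simp only [map_zero, zero_mul, mul_zero]
    exact hasSum_zero
  · simpa only [map_add, mul_add, add_mul] using hx.add hy

end ChiralBlock

/-! ### A common treatment of left and right movers -/

section ConjOrId

variable {κ : ℂ →+* ℂ}

/-- The identity or complex conjugation. -/
def IsIdOrConj (κ : ℂ →+* ℂ) : Prop := κ = RingHom.id ℂ ∨ κ = starRingEnd ℂ

namespace IsIdOrConj

theorem apply_apply (h : IsIdOrConj κ) (z : ℂ) : κ (κ z) = z := by
  rcases h with rfl | rfl <;> simp

theorem norm_apply (h : IsIdOrConj κ) (z : ℂ) : ‖κ z‖ = ‖z‖ := by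
  rcases h with rfl | rfl <;> simp

theorem apply_ofReal (h : IsIdOrConj κ) (x : ℝ) : κ x = x := by
  rcases h with rfl | rfl <;> simp

theorem apply_exp (h : IsIdOrConj κ) (z : ℂ) : κ (exp z) = exp (κ z) := by
  rcases h with rfl | rfl
  · rfl
  · exact (exp_conj z).symm

theorem apply_log (h : IsIdOrConj κ) {z : ℂ} (hz : 0 < z.im) : log (κ z) = κ (log z) := by
  rcases h with rfl | rfl
  · rfl
  · exact log_conj z (slitPlane_arg_ne_pi (TriBlock.slitPlane_of_im_pos hz))

theorem continuous (h : IsIdOrConj κ) : Continuous κ := by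
  rcases h with rfl | rfl
  · exact continuous_id
  · exact continuous_conj

theorem hasSum (h : IsIdOrConj κ) {f : ℤ → ℂ} {a : ℂ} (hf : HasSum f a) :
    HasSum (fun n => κ (f n)) (κ a) := hf.map κ h.continuous

theorem map_tsum (h : IsIdOrConj κ) (f : ℤ → ℂ) : κ (∑' n, f n) = ∑' n, κ (f n) := by
  rcases h with rfl | rfl
  · rfl
  · exact conj_tsum f

theorem hasDerivAt (h : IsIdOrConj κ) {F : ℂ → ℂ} {F' z : ℂ} (hF : HasDerivAt F F' (κ z)) :
    HasDerivAt (fun z => κ (F (κ z))) (κ F') z := by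
  rcases h with rfl | rfl
  · exact hF
  · have := hF.conj_conj
    rw [conj_conj] at this
    exact this

end IsIdOrConj

theorem branchPow_mul {t l y : ℂ} (ht : t ≠ 0) (hy : y ≠ 0) (γ : ℝ) :
    branchPow t l (t * y) γ = exp (γ * l) * y ^ (γ : ℂ) := by
  rw [branchPow, mul_div_cancel_left₀ _ ht, cpow_def_of_ne_zero hy, ← Complex.exp_add]
  congr 1; ring

theorem IsIdOrConj.branchPow (h : IsIdOrConj κ) {t l y : ℂ} (ht : t ≠ 0) (hy : 0 < y.im) (γ : ℝ) :
    branchPow (κ t) (κ l) (κ (t * y)) γ = κ (exp (γ * l) * y ^ (γ : ℂ)) := by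
  have hy0 : y ≠ 0 := fun h => by simp [h] at hy
  rw [← branchPow_mul ht hy0, _root_.branchPow, _root_.branchPow, ← map_div₀, h.apply_exp, map_mul,
    map_add, h.apply_ofReal, mul_div_cancel_left₀ _ ht, h.apply_log hy]

/-- The conventions for the branches: `κ` is the identity for left movers and conjugation for
right movers. -/
structure Oriented (κ : ℂ →+* ℂ) (t l : ℂ) (side : Set ℂ) : Prop where
  isIdOrConj : IsIdOrConj κ
  ne_zero : t ≠ 0
  exp_eq : exp l = t
  mem_side : ∀ z, κ z ∈ side ↔ 0 < (z / t).im

end ConjOrId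

section Oriented

variable {κ : ℂ →+* ℂ} {t l : ℂ} {side : Set ℂ}

theorem Oriented.mem (O : Oriented κ t l side) {y : ℂ} (hy : 0 < y.im) : κ (t * y) ∈ side :=
  (O.mem_side _).2 (by rwa [mul_div_cancel_left₀ _ O.ne_zero])

theorem Oriented.norm_mul (O : Oriented κ t l side) (y : ℂ) : ‖κ (t * y)‖ = ‖t‖ * ‖y‖ := by
  rw [O.isIdOrConj.norm_apply, _root_.norm_mul]

theorem Oriented.norm_pos (O : Oriented κ t l side) : 0 < ‖t‖ := norm_pos_iff.2 O.ne_zero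

theorem Oriented.mul_sub (_O : Oriented κ t l side) (y : ℂ) :
    κ (t * y) - κ t = κ (t * (y - 1)) := by rw [← map_sub]; congr 1; ring

theorem Oriented.exp_sub_one (O : Oriented κ t l side) (γ : ℝ) :
    t * exp (((γ - 1 : ℝ) : ℂ) * l) = exp ((γ : ℂ) * l) := by
  rw [← O.exp_eq, ← Complex.exp_add]; congr 1; push_cast; ring

end Oriented

/-! ### Scalar blocks of the matrix elements -/

namespace ChiralBlock

variable {W : Type*} [AddCommGroup W] [Module ℂ W] {gr : ℝ × ℝ → Submodule ℂ W}
  {χ : Chirality} {κ : ℂ →+* ℂ} {t l : ℂ} {side : Set ℂ} {α β : ℝ} {v : W}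

/-- Applying κ turns an antiholomorphic expansion into a holomorphic one, and z = t y splits each
power into e^(e_n l) y^(e_n) with the principal branch in y. The constant factors are absorbed into
the coefficients. -/
theorem hasSum_scaled (O : Oriented κ t l side) {a A b : ℝ} {k : ℤ → ℂ} {e : ℤ → ℝ} {g y y' : ℂ}
    (hy : 0 < y.im) (hy' : 0 < y'.im)
    (h : HasSum (fun n => k n * branchPow (κ t) (κ l) (κ (t * y')) (e n))
      (branchPow (κ t) (κ l) (κ (t * y) - κ t) a * branchPow (κ t) (κ l) (κ (t * y)) b * g))
    (hA : A = a + b) :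
    HasSum (fun n => κ (k n) * exp ((e n : ℂ) * l) * y' ^ (e n : ℂ))
      ((y - 1) ^ (a : ℂ) * y ^ (b : ℂ) * (κ g * exp ((A : ℂ) * l))) := by
  have hy1 : 0 < (y - 1).im := by simpa using hy
  have hκ := O.isIdOrConj
  rw [O.mul_sub, hκ.branchPow O.ne_zero hy, hκ.branchPow O.ne_zero hy1] at h
  simp only [hκ.branchPow O.ne_zero hy'] at h
  have h' := hκ.hasSum h
  simp only [map_mul, hκ.apply_apply] at h'
  subst hA
  rw [ofReal_add, add_mul, Complex.exp_add]
  convert h' using 1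
  · ext n; ring
  · ring

/-- The scalar block of a matrix element, in the coordinate `y = z / t`. -/
noncomputable def tri (hgr : DirectSum.IsInternal gr) (O : Oriented κ t l side)
    (B : ChiralBlock gr χ (κ t) (κ l) side α β v) (c : ℝ) (f : Module.Dual ℂ W) (x : W) :
    TriBlock α β :=
  TriBlock.ofUpper (fun y => κ (f (B.Z c (κ (t * y)) x)) * exp (((α + β : ℝ) : ℂ) * l))
    (fun n => κ (f (B.vec0 c n x)) * exp (((n + β - 1 : ℝ) : ℂ) * l))
    (fun n => κ (f (B.vecI c n x)) * exp (((n + (α + β) - 1 : ℝ) : ℂ) * l))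
    (fun n => κ (f (B.vec1 c n x)) * exp (((n + α - 1 : ℝ) : ℂ) * l))
    (by
      intro y hy
      refine DifferentiableAt.differentiableWithinAt (DifferentiableAt.mul_const ?_ _)
      have hop : IsOpen {z : ℂ | z ≠ 0 ∧ z ≠ κ t} := isOpen_ne.inter isOpen_ne
      have hκ := O.isIdOrConj
      have hne : κ (t * y) ∈ {z : ℂ | z ≠ 0 ∧ z ≠ κ t} := by
        constructor
        · rw [← norm_pos_iff, O.norm_mul]
          exact mul_pos O.norm_pos (norm_pos_iff.2 hy.1)
        · intro h
          rw [← sub_eq_zero, O.mul_sub, ← norm_eq_zero, O.norm_mul] at h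
          exact (mul_pos O.norm_pos (norm_pos_iff.2 (sub_ne_zero.2 hy.2))).ne' h
      have hd := ((B.meromorphic_all hgr c f x).1.differentiableAt
        (hop.mem_nhds hne)).hasDerivAt
      exact ((hκ.hasDerivAt hd).comp y ((hasDerivAt_id y).const_mul t)).differentiableAt)
    (fun y hy hy1 => hasSum_scaled O hy hy (B.hasSum_zero_all hgr c f x (O.mem hy) (by
      rw [O.norm_mul, O.isIdOrConj.norm_apply]
      exact mul_lt_of_lt_one_right O.norm_pos hy1)) rfl)
    (fun y hy hy1 => by
      have := hasSum_scaled O hy hy (B.hasSum_infty_all hgr c f x (O.mem hy) (by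
        rw [O.norm_mul, O.isIdOrConj.norm_apply]
        exact lt_mul_of_one_lt_right O.norm_pos hy1)) rfl
      simpa only [add_assoc] using this)
    (fun y hy hy1 => by
      have hy' : 0 < (y - 1).im := by simpa using hy
      have := B.hasSum_t_all hgr c f x (O.mem hy) (by
        rw [O.mul_sub, O.norm_mul, O.isIdOrConj.norm_apply]
        exact mul_lt_of_lt_one_right O.norm_pos hy1)
      refine hasSum_scaled (k := fun n => f (B.vec1 c n x)) (e := fun n => n + α - 1)
        (g := f (B.Z c (κ (t * y)) x)) O hy hy' ?_ rfl
      simpa only [O.mul_sub y] using this)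

end ChiralBlock

/-! ### The constants C and D as operators -/

/-- A bilinear form on `Dual W × W` which kills the annihilators of finite dimensional spaces is
given by a linear operator. -/
theorem exists_operator {W : Type*} [AddCommGroup W] [Module ℂ W] (S : W → Submodule ℂ W)
    (hS : ∀ x, FiniteDimensional ℂ (S x)) (Θ : W → Module.Dual ℂ W → ℂ)
    (left : ∀ x k f g, Θ x (k • f + g) = k * Θ x f + Θ x g)
    (right : ∀ f k x y, Θ (k • x + y) f = k * Θ x f + Θ y f)
    (ker : ∀ x (f : Module.Dual ℂ W), (∀ s ∈ S x, f s = 0) → Θ x f = 0) :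
    ∃ T : Module.End ℂ W, ∀ x, T x ∈ S x ∧ ∀ f, f (T x) = Θ x f := by
  have key : ∀ x, ∃ y ∈ S x, ∀ f, f y = Θ x f := fun x => by
    have h0 : Θ x 0 = 0 := by simpa using left x 1 0 0
    exact exists_eval (S x)
      { toFun := Θ x
        map_add' := fun f g => by simpa using left x 1 f g
        map_smul' := fun k f => by simpa [h0] using left x k f 0 } (ker x)
  choose T hT hT' using key
  have hlin : ∀ k x y, T (k • x + y) = k • T x + T y := fun k x y => by
    rw [← sub_eq_zero]
    refine (Module.forall_dual_apply_eq_zero_iff ℂ _).1 fun f => ?_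
    rw [map_sub, map_add, map_smul, hT', hT', hT', right, smul_eq_mul, sub_self]
  have h0 : T 0 = 0 := by simpa using hlin 1 0 0
  exact ⟨{ toFun := T
           map_add' := fun x y => by simpa using hlin 1 x y
           map_smul' := fun k x => by simpa [h0] using hlin k x 0 }, fun x => ⟨hT x, hT' x⟩⟩

namespace ChiralBlock

variable {W : Type*} [AddCommGroup W] [Module ℂ W] {gr : ℝ × ℝ → Submodule ℂ W}
  {χ : Chirality} {κ : ℂ →+* ℂ} {t l : ℂ} {side : Set ℂ} {α β : ℝ} {v : W}
  (hgr : DirectSum.IsInternal gr) (O : Oriented κ t l side)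
  (B : ChiralBlock gr χ (κ t) (κ l) side α β v)

theorem noZero_tri {x : W} (hx : B.NoZeroModes x) (c : ℝ) (f : Module.Dual ℂ W) :
    (B.tri hgr O c f x).NoZero where
  zero n hn := by
    change κ (f (B.Y v c (B.m n x))) * _ = 0
    rw [hx.1 n hn, map_zero, map_zero, map_zero, zero_mul]
  one n hn := by
    change κ (f (B.Y (B.m'' n v) c x)) * _ = 0
    rw [hx.2.1 n hn, map_zero, Pi.zero_apply, LinearMap.zero_apply, map_zero, map_zero, zero_mul]
  infty n hn := by
    change κ (f (B.m' n (B.Y v _ x))) * _ = 0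
    rw [hx.2.2 n (by rw [add_assoc]; exact hn), map_zero, map_zero, zero_mul]

/-- The span of the values of the chiral 4-point function on a vector. -/
def values (B : ChiralBlock gr χ (κ t) (κ l) side α β v) (c : ℝ) (x : W) : Submodule ℂ W :=
  Submodule.span ℂ ((fun z => B.Z c z x) '' {z | z ≠ 0 ∧ z ≠ κ t})

theorem finiteDimensional_values (hgr : DirectSum.IsInternal gr)
    (B : ChiralBlock gr χ (κ t) (κ l) side α β v) (c : ℝ) (x : W) : FiniteDimensional ℂ (B.values c x) :=
  finiteDimensional_span_of_meromorphic fun f => B.meromorphic_all hgr c f x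

theorem ne_zero_and_ne {y : ℂ} (O : Oriented κ t l side) (h0 : y ≠ 0) (h1 : y ≠ 1) :
    κ (t * y) ≠ 0 ∧ κ (t * y) ≠ κ t := by
  constructor
  · rw [← norm_pos_iff, O.norm_mul]
    exact mul_pos O.norm_pos (norm_pos_iff.2 h0)
  · intro h
    rw [← sub_eq_zero, O.mul_sub, ← norm_eq_zero, O.norm_mul] at h
    exact (mul_pos O.norm_pos (norm_pos_iff.2 (sub_ne_zero.2 h1))).ne' h

theorem Z_mem_values (c : ℝ) (x : W) {y : ℂ} (O : Oriented κ t l side) (h0 : y ≠ 0) (h1 : y ≠ 1) :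
    B.Z c (κ (t * y)) x ∈ B.values c x :=
  Submodule.subset_span ⟨_, ne_zero_and_ne O h0 h1, rfl⟩

theorem eq_zero_of_apply_mul_exp (hκ : IsIdOrConj κ) {a b : ℂ} (h : κ a * exp b = 0) : a = 0 := by
  have h1 := (mul_eq_zero.1 h).resolve_right (exp_ne_zero _)
  rw [← hκ.apply_apply a, h1, map_zero]

theorem coeff_eq_zero {c : ℝ} {x : W} {f : Module.Dual ℂ W}
    (hf : ∀ s ∈ B.values c x, f s = 0) :
    (∀ n, (B.tri hgr O c f x).c0 n = 0) ∧ (∀ n, (B.tri hgr O c f x).cI n = 0) ∧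
      ∀ n, (B.tri hgr O c f x).c1 n = 0 := by
  refine TriBlock.coeff_eq_zero _ fun y h0 h1 => ?_
  change κ (f (B.Z c (κ (t * y)) x)) * _ = 0
  rw [hf _ (B.Z_mem_values c x O h0 h1), map_zero, zero_mul]

/-- A functional that kills all values of Z on x has the zero block as its matrix element, so it
kills all expansion coefficients; subspaces are determined by their annihilators. -/
theorem vec_mem_values (hgr : DirectSum.IsInternal gr) (O : Oriented κ t l side)
    (B : ChiralBlock gr χ (κ t) (κ l) side α β v) (c : ℝ) (x : W) (n : ℤ) :
    B.vec0 c n x ∈ B.values c x ∧ B.vecI c n x ∈ B.values c x ∧ B.vec1 c n x ∈ B.values c x := by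
  refine ⟨mem_of_dual _ fun f hf => ?_, mem_of_dual _ fun f hf => ?_, mem_of_dual _ fun f hf => ?_⟩
  · exact eq_zero_of_apply_mul_exp O.isIdOrConj ((coeff_eq_zero hgr O B hf).1 n)
  · exact eq_zero_of_apply_mul_exp O.isIdOrConj ((coeff_eq_zero hgr O B hf).2.1 n)
  · exact eq_zero_of_apply_mul_exp O.isIdOrConj ((coeff_eq_zero hgr O B hf).2.2 n)

/-- The values of the 4-point function are combinations of the coefficients at `0`. -/
theorem values_le (hgr : DirectSum.IsInternal gr) (O : Oriented κ t l side)
    (B : ChiralBlock gr χ (κ t) (κ l) side α β v) (c : ℝ) (x : W) :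
    B.values c x ≤ Submodule.span ℂ (Set.range fun n => B.vec0 c n x) := by
  refine Submodule.span_le.2 ?_
  rintro _ ⟨z, ⟨hz0, hz1⟩, rfl⟩
  refine mem_of_dual _ fun f hf => ?_
  have hκ := O.isIdOrConj
  have hz : z = κ (t * (κ z / t)) := by
    rw [mul_div_cancel₀ _ O.ne_zero, hκ.apply_apply]
  have h := TriBlock.eq_zero_of_c0 (B.tri hgr O c f x) (fun n => by
    change κ (f (B.vec0 c n x)) * _ = 0
    rw [hf _ (Submodule.subset_span ⟨n, rfl⟩), map_zero, zero_mul]) (y := κ z / t) ?_ ?_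
  · beta_reduce
    rw [hz]
    exact eq_zero_of_apply_mul_exp hκ h
  · intro h0
    rw [hz, h0, mul_zero, map_zero] at hz0
    exact hz0 rfl
  · intro h1
    rw [hz, h1, mul_one] at hz1
    exact hz1 rfl

/-- For κ = conj the scalar block is antilinear in f and in x, whence κ k. Applying κ to the
constants restores linearity, as needed for an operator. -/
theorem constants_left (c : ℝ) (x : W) (k : ℂ) (f g : Module.Dual ℂ W) :
    (B.tri hgr O c (k • f + g) x).C = κ k * (B.tri hgr O c f x).C + (B.tri hgr O c g x).C ∧
    (B.tri hgr O c (k • f + g) x).D = κ k * (B.tri hgr O c f x).D + (B.tri hgr O c g x).D := by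
  have key : ∀ (y : W) (e : ℂ), κ ((k • f + g) y) * e = κ k * (κ (f y) * e) + κ (g y) * e := by
    intro y e
    rw [LinearMap.add_apply, LinearMap.smul_apply, smul_eq_mul, map_add, map_mul]; ring
  exact TriBlock.constants_mul_add (fun n => key _ _) (fun n => key _ _) (fun n => key _ _)

theorem constants_right (c : ℝ) (f : Module.Dual ℂ W) (k : ℂ) (x y : W) :
    (B.tri hgr O c f (k • x + y)).C = κ k * (B.tri hgr O c f x).C + (B.tri hgr O c f y).C ∧
    (B.tri hgr O c f (k • x + y)).D = κ k * (B.tri hgr O c f x).D + (B.tri hgr O c f y).D := by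
  have key : ∀ (L : W →ₗ[ℂ] W) (e : ℂ),
      κ (f (L (k • x + y))) * e = κ k * (κ (f (L x)) * e) + κ (f (L y)) * e := by
    intro L e
    rw [map_add, map_smul, map_add, map_smul, smul_eq_mul, map_add, map_mul]; ring
  exact TriBlock.constants_mul_add (fun n => key _ _) (fun n => key _ _) (fun n => key _ _)

/-- The constants `C` and `D` are given by operators. -/
theorem exists_constants : ∃ C D : ℝ → Module.End ℂ W,
    (∀ c x, C c x ∈ B.values c x ∧ ∀ f, f (C c x) = κ (t * (B.tri hgr O c f x).C)) ∧
    ∀ c x, D c x ∈ B.values c x ∧ ∀ f, f (D c x) = κ (t * (B.tri hgr O c f x).D) := by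
  have hκ := O.isIdOrConj
  have hC := fun c => exists_operator (B.values c) (B.finiteDimensional_values hgr c)
    (fun x f => κ (t * (B.tri hgr O c f x).C))
    (fun x k f g => by
      rw [(B.constants_left hgr O c x k f g).1, mul_add, map_add, mul_left_comm, map_mul,
        hκ.apply_apply])
    (fun f k x y => by
      rw [(B.constants_right hgr O c f k x y).1, mul_add, map_add, mul_left_comm, map_mul,
        hκ.apply_apply])
    (fun x f hf => by
      rw [(TriBlock.constants_eq_zero_of_coeff _ (coeff_eq_zero hgr O B hf)).1, mul_zero, map_zero])
  have hD := fun c => exists_operator (B.values c) (B.finiteDimensional_values hgr c)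
    (fun x f => κ (t * (B.tri hgr O c f x).D))
    (fun x k f g => by
      rw [(B.constants_left hgr O c x k f g).2, mul_add, map_add, mul_left_comm, map_mul,
        hκ.apply_apply])
    (fun f k x y => by
      rw [(B.constants_right hgr O c f k x y).2, mul_add, map_add, mul_left_comm, map_mul,
        hκ.apply_apply])
    (fun x f hf => by
      rw [(TriBlock.constants_eq_zero_of_coeff _ (coeff_eq_zero hgr O B hf)).2, mul_zero, map_zero])
  choose C hC using hC
  choose D hD using hD
  exact ⟨C, D, hC, hD⟩

theorem apply_A (c : ℝ) (f : Module.Dual ℂ W) (x : W) {y : ℂ} (hy : 0 < y.im) :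
    κ ((B.tri hgr O c f x).A y) = branchPow (κ t) (κ l) (κ (t * y) - κ t) α *
      branchPow (κ t) (κ l) (κ (t * y)) β * f (B.Z c (κ (t * y)) x) := by
  have hy1 : 0 < (y - 1).im := by simpa using hy
  have hκ := O.isIdOrConj
  rw [O.mul_sub, hκ.branchPow O.ne_zero hy, hκ.branchPow O.ne_zero hy1, TriBlock.A]
  change κ (_ * (κ (f (B.Z c (κ (t * y)) x)) * exp (((α + β : ℝ) : ℂ) * l))) = _
  rw [ofReal_add, add_mul, Complex.exp_add]
  simp only [map_mul, hκ.apply_apply]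
  ring

/-- The factor t comes from dz = t dy. Since e^l = t, it raises the exponent n + γ - 1 of the
coefficient to the exponent n + γ of the primitive. -/
theorem apply_primitive (O : Oriented κ t l side) (k : ℤ → ℂ) (γ : ℝ) {y : ℂ} (hy : 0 < y.im) :
    κ (t * (y ^ (γ : ℂ) *
      laurent (fun n => κ (k n) * exp (((n + γ - 1 : ℝ) : ℂ) * l) / (n + γ)) y)) =
    ∑' n : ℤ, k n * (branchPow (κ t) (κ l) (κ (t * y)) (n + γ) / ((n + γ : ℝ) : ℂ)) := by
  have hκ := O.isIdOrConj
  have hy0 : y ≠ 0 := fun h => by simp [h] at hy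
  rw [laurent, ← tsum_mul_left, ← tsum_mul_left, hκ.map_tsum]
  refine tsum_congr fun n => ?_
  rw [hκ.branchPow O.ne_zero hy, ← O.exp_sub_one (n + γ)]
  have e : ((n + γ : ℝ) : ℂ) = (n : ℂ) + γ := by push_cast; rfl
  have e2 : κ ((n : ℂ) + γ) = (n : ℂ) + γ := by rw [← e, hκ.apply_ofReal]
  rw [e, cpow_add _ _ hy0, cpow_intCast]
  simp only [map_mul, map_div₀, hκ.apply_apply, e2]
  ring

end ChiralBlock

namespace ChiralBlock

variable {W : Type*} [AddCommGroup W] [Module ℂ W] {gr : ℝ × ℝ → Submodule ℂ W}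
  {χ : Chirality} {κ : ℂ →+* ℂ} {t l : ℂ} {side : Set ℂ} {α β : ℝ} {v : W}
  (hgr : DirectSum.IsInternal gr) (O : Oriented κ t l side)
  (B : ChiralBlock gr χ (κ t) (κ l) side α β v)

/-- All coefficient vectors have the one weight `χ.replace h c`, so a functional of another weight
sees the zero block. By duality C and D therefore map into that weight space. -/
theorem constants_eq_zero_of_weight {h k : ℝ × ℝ} {c : ℝ} {x : W}
    (hx : x ∈ ⨆ a, gr (χ.replace h a)) (hk : k ≠ χ.replace h c) {f : Module.Dual ℂ W}
    (hf : IsOfWeight gr k f) : (B.tri hgr O c f x).C = 0 ∧ (B.tri hgr O c f x).D = 0 := by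
  have key : ∀ (L : W →ₗ[ℂ] W) (e : ℂ),
      (∀ h x, x ∈ gr h → L x ∈ gr (χ.replace h c)) → κ (f (L x)) * e = 0 := by
    intro L e hL
    have hle : ⨆ a, gr (χ.replace h a) ≤ (gr (χ.replace h c)).comap L := by
      refine iSup_le fun a y hy => ?_
      have := hL _ y hy
      rwa [χ.replace_replace] at this
    rw [hf _ hk.symm _ (hle hx), map_zero, zero_mul]
  exact TriBlock.constants_eq_zero_of_coeff _ ⟨fun n => key _ _ fun h x => B.vec0_mem c n,
    fun n => key _ _ fun h x => B.vecI_mem c n, fun n => key _ _ fun h x => B.vec1_mem c n⟩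

/-- The primitive over the half-plane is z ↦ κ(t G(κ z / t)), with G the primitive of the scalar
block. Its differences to the termwise primitives are κ of t times the scalar constants. -/
theorem isDiscrepancy {C D : ℝ → Module.End ℂ W}
    (hC : ∀ c x f, f (C c x) = κ (t * (B.tri hgr O c f x).C))
    (hD : ∀ c x f, f (D c x) = κ (t * (B.tri hgr O c f x).D)) : B.IsDiscrepancy C D := by
  have hκ := O.isIdOrConj
  refine ⟨fun h c x hx _ => ⟨?_, ?_⟩, fun h f x _ hx => ?_⟩
  · refine mem_of_isOfWeight hgr fun k hk f hf => ?_
    rw [hC, (B.constants_eq_zero_of_weight hgr O hx hk hf).1, mul_zero, map_zero]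
  · refine mem_of_isOfWeight hgr fun k hk f hf => ?_
    rw [hD, (B.constants_eq_zero_of_weight hgr O hx hk hf).2, mul_zero, map_zero]
  set T := B.tri hgr O (χ.coord h) f x
  obtain ⟨G, hG⟩ := T.exists_isPrimitive (B.noZero_tri hgr O hx _ f)
  have hy : ∀ z ∈ side, ∃ y : ℂ, 0 < y.im ∧ z = κ (t * y) := fun z hz => by
    refine ⟨κ z / t, (O.mem_side _).1 (by rwa [hκ.apply_apply]), ?_⟩
    rw [mul_div_cancel₀ _ O.ne_zero, hκ.apply_apply]
  have hF : ∀ y : ℂ, κ (t * G (κ (κ (t * y)) / t)) = κ (t * G y) := fun y => by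
    rw [hκ.apply_apply, mul_div_cancel_left₀ _ O.ne_zero]
  refine ⟨fun z => κ (t * G (κ z / t)), fun z hz => ?_, fun z hz hn => ?_, fun z hz hn => ?_,
    fun z hz hn => ?_⟩ <;> obtain ⟨y, hyi, rfl⟩ := hy z hz
  · rw [← B.apply_A hgr O _ f x hyi]
    have hd : HasDerivAt (fun z => t * G (z / t)) (T.A y) (κ (κ (t * y))) := by
      rw [hκ.apply_apply]
      have h1 : HasDerivAt G (T.A y) (t * y / t) := by
        rw [mul_div_cancel_left₀ _ O.ne_zero]; exact hG.hasDerivAt y hyi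
      refine ((h1.comp (t * y) ((hasDerivAt_id (t * y)).div_const t)).const_mul t).congr_deriv ?_
      have := O.ne_zero
      field_simp
    exact hκ.hasDerivAt hd
  · rw [O.norm_mul, hκ.norm_apply, lt_mul_iff_one_lt_right O.norm_pos] at hn
    beta_reduce
    rw [hF, hG.infty y hyi.le hn]
    refine (apply_primitive O (fun n => f (B.vecI (χ.coord h) n x)) (α + β) hyi).trans ?_
    simp only [← add_assoc]
    rfl
  · have hn1 : ‖y - 1‖ < 1 := by
      rw [O.mul_sub, O.norm_mul, hκ.norm_apply] at hn
      exact (mul_lt_iff_lt_one_right O.norm_pos).1 hn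
    have hy1 : 0 < (y - 1).im := by simpa using hyi
    beta_reduce
    rw [hF, hG.one y hyi.le (norm_pos_iff.2 fun h => by simp [h] at hy1) hn1, hC, mul_add, map_add,
      add_sub_right_comm, sub_eq_zero.2, zero_add]
    refine (apply_primitive O (fun n => f (B.vec1 (χ.coord h) n x)) α hy1).trans ?_
    rw [ωt, O.mul_sub]
    rfl
  · have hn1 : ‖y‖ < 1 := by
      rw [O.norm_mul, hκ.norm_apply] at hn
      exact (mul_lt_iff_lt_one_right O.norm_pos).1 hn
    beta_reduce
    rw [hF, hG.zero y hyi.le (norm_pos_iff.2 fun h => by simp [h] at hyi) hn1, hD, mul_add, map_add,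
      add_sub_right_comm, sub_eq_zero.2, zero_add]
    exact apply_primitive O (fun n => f (B.vec0 (χ.coord h) n x)) β hyi

end ChiralBlock

/-! ### Scaling the puncture from 1 to t -/

theorem oriented_id {t : ℂ} (ht : t ≠ 0) :
    Oriented (RingHom.id ℂ) t (log t) {z | 0 < (z / t).im} :=
  ⟨Or.inl rfl, ht, exp_log ht, fun _ => Iff.rfl⟩

theorem oriented_conj {t : ℂ} (ht : t ≠ 0) :
    Oriented (starRingEnd ℂ) t (log t) {ζ | (ζ / conj t).im < 0} :=
  ⟨Or.inr rfl, ht, exp_log ht, fun z => by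
    rw [Set.mem_ofPred_eq, ← map_div₀, conj_im, neg_lt_zero]⟩

/-- Multiplication by t is dilation by ‖t‖ followed by a rotation, so the Jacobian is ‖t‖². -/
theorem integral_comp_mul_left {t : ℂ} (ht : t ≠ 0) {G : ℂ → ℂ}
    (hG : Integrable fun y => G (t * y)) :
    Integrable G ∧ ∫ z, G z = ((‖t‖ ^ 2 : ℝ) : ℂ) * ∫ y, G (t * y) := by
  have hn : ‖t‖ ≠ 0 := norm_ne_zero_iff.2 ht
  set u : Circle := ⟨t / ‖t‖, mem_sphere_zero_iff_norm.2 (by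
    rw [norm_div, norm_real, norm_norm, div_self hn])⟩ with hu
  have hmul : ∀ y : ℂ, G (t * y) = G (rotation u (‖t‖ • y)) := fun y => by
    rw [rotation_apply, real_smul, hu]
    congr 1
    have : (‖t‖ : ℂ) ≠ 0 := by exact_mod_cast hn
    field_simp
  simp only [hmul] at hG ⊢
  have mp := (rotation u).measurePreserving
  have me := (rotation u).toHomeomorph.measurableEmbedding
  have i1 : Integrable fun y => G (rotation u y) :=
    (integrable_comp_smul_iff volume (fun y => G (rotation u y)) hn).1 hG
  refine ⟨(mp.integrable_comp_emb me).1 i1, ?_⟩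
  rw [Measure.integral_comp_smul volume (fun y => G (rotation u y)), finrank_real_complex,
    mp.integral_comp me, real_smul, abs_of_pos (by positivity), ← mul_assoc, ← ofReal_mul,
    mul_inv_cancel₀ (pow_ne_zero 2 hn), ofReal_one, one_mul]

theorem mem_worldsheet_mul {t : ℂ} (ht : t ≠ 0) (r s R : ℝ) (y : ℂ) :
    t * y ∈ worldsheet t r s R ↔ y ∈ worldsheet 1 (r / ‖t‖) (s / ‖t‖) (R / ‖t‖) := by
  have hn : 0 < ‖t‖ := norm_pos_iff.2 ht
  have e : t * y - t = t * (y - 1) := by ring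
  simp only [worldsheet, Set.mem_ofPred_eq, e, norm_mul, div_lt_iff₀' hn, lt_div_iff₀' hn]

/-- Change of variables between the worldsheet and the one with puncture at `1`. -/
theorem integral_worldsheet_scaled {t : ℂ} (ht : t ≠ 0) (r s R : ℝ) {F F' : ℂ → ℂ}
    (h : ∀ y ∈ worldsheet 1 (r / ‖t‖) (s / ‖t‖) (R / ‖t‖), F (t * y) = F' y)
    (hF : IntegrableOn F' (worldsheet 1 (r / ‖t‖) (s / ‖t‖) (R / ‖t‖))) :
    IntegrableOn F (worldsheet t r s R) ∧ ∫ z in worldsheet t r s R, F z =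
      ((‖t‖ ^ 2 : ℝ) : ℂ) * ∫ y in worldsheet 1 (r / ‖t‖) (s / ‖t‖) (R / ‖t‖), F' y := by
  have hm := TriBlock.measurableSet_worldsheet t r s R
  have hm' := TriBlock.measurableSet_worldsheet 1 (r / ‖t‖) (s / ‖t‖) (R / ‖t‖)
  have e : (fun y => (worldsheet t r s R).indicator F (t * y)) =
      (worldsheet 1 (r / ‖t‖) (s / ‖t‖) (R / ‖t‖)).indicator F' := by
    ext y
    by_cases hy : y ∈ worldsheet 1 (r / ‖t‖) (s / ‖t‖) (R / ‖t‖)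
    · rw [Set.indicator_of_mem hy, Set.indicator_of_mem ((mem_worldsheet_mul ht r s R y).2 hy),
        h y hy]
    · rw [Set.indicator_of_notMem hy,
        Set.indicator_of_notMem (fun h' => hy ((mem_worldsheet_mul ht r s R y).1 h'))]
  have := integral_comp_mul_left ht (G := (worldsheet t r s R).indicator F) (by
    rw [e]; exact (integrable_indicator_iff hm').2 hF)
  rw [e, integral_indicator hm, integral_indicator hm', integrable_indicator_iff hm] at this
  exact this

theorem exp_mul_conj_exp_log {t : ℂ} (ht : t ≠ 0) (γ : ℝ) :
    exp ((γ : ℂ) * log t) * conj (exp ((γ : ℂ) * log t)) = ((‖t‖ ^ (2 * γ) : ℝ) : ℂ) := by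
  rw [← cpow_mul_conj_cpow, cpow_def_of_ne_zero ht, mul_comm (log t)]

/-- The powers of ‖t‖ cancel termwise: 2 from the area element, 2(n + γ - 1) from the two rescaled
coefficients, and -2(n + γ) from the scaled radius ρ/‖t‖. -/
theorem hasSum_localSeries {t : ℂ} (ht : t ≠ 0) {k k' : ℤ → ℂ} {γ ρ : ℝ} {U : Set ℝ} (hρ : 0 < ρ)
    (hk : LaurentConv (fun n : ℤ => k n * exp (((n + γ - 1 : ℝ) : ℂ) * log t)) U)
    (hk' : LaurentConv (fun n : ℤ => conj (k' n) * exp (((n + γ - 1 : ℝ) : ℂ) * log t)) U)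
    (hU : ρ / ‖t‖ ∈ U) :
    HasSum (fun n : ℤ => ((ρ ^ (2 * (n + γ)) : ℝ) : ℂ) *
      (((Real.pi / (n + γ) : ℝ) : ℂ) * (k n * k' n)))
      (((‖t‖ ^ 2 : ℝ) : ℂ) * localSeries
        (fun n : ℤ => k n * exp (((n + γ - 1 : ℝ) : ℂ) * log t))
        (fun n : ℤ => conj (k' n) * exp (((n + γ - 1 : ℝ) : ℂ) * log t)) γ ((ρ / ‖t‖) ^ 2)) := by
  have hn : 0 < ‖t‖ := norm_pos_iff.2 ht
  have hq : 0 < ρ / ‖t‖ := div_pos hρ hn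
  have hV : LaurentConv (fun n : ℤ => k n * exp (((n + γ - 1 : ℝ) : ℂ) * log t) *
      conj (conj (k' n) * exp (((n + γ - 1 : ℝ) : ℂ) * log t))) {(ρ / ‖t‖) ^ 2} :=
    hk.mul_conj hk' fun x hx => by
      rw [Set.mem_singleton_iff] at hx
      rw [hx, Real.sqrt_sq hq.le]
      exact ⟨pow_pos hq 2, hU⟩
  have hs := (hV.div γ).hasSum (z := (((ρ / ‖t‖) ^ 2 : ℝ) : ℂ)) (by
    rw [norm_real, Real.norm_of_nonneg (by positivity)]; rfl)
  rw [localSeries]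
  have hs' := ((hs.mul_left (((((ρ / ‖t‖) ^ 2) ^ γ : ℝ)) : ℂ)).mul_left (Real.pi : ℂ)).mul_left
    (((‖t‖ ^ 2 : ℝ)) : ℂ)
  have hreal : ∀ n : ℤ, ‖t‖ ^ 2 * (((ρ / ‖t‖) ^ 2) ^ γ * (‖t‖ ^ (2 * (n + γ - 1)) *
      ((ρ / ‖t‖) ^ 2) ^ n)) = ρ ^ (2 * (n + γ)) := fun n => by
    have e1 : ((ρ / ‖t‖) ^ 2) ^ γ * ((ρ / ‖t‖) ^ 2) ^ n = (ρ / ‖t‖) ^ (2 * (n + γ)) := by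
      rw [← Real.rpow_intCast, ← Real.rpow_add (pow_pos hq 2), ← Real.rpow_natCast,
        ← Real.rpow_mul hq.le]
      congr 1; push_cast; ring
    have e2 : ‖t‖ ^ 2 * ‖t‖ ^ (2 * (n + γ - 1)) = ‖t‖ ^ (2 * (n + γ)) := by
      rw [← Real.rpow_natCast, ← Real.rpow_add hn]
      congr 1; push_cast; ring
    calc _ = (‖t‖ ^ 2 * ‖t‖ ^ (2 * (n + γ - 1))) *
          (((ρ / ‖t‖) ^ 2) ^ γ * ((ρ / ‖t‖) ^ 2) ^ n) := by ring
      _ = _ := by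
        rw [e1, e2, ← Real.mul_rpow hn.le hq.le, mul_div_cancel₀ _ hn.ne']
  refine Eq.mpr (congrArg (fun f => HasSum f _) (funext fun n => ?_)) hs'
  have hE := exp_mul_conj_exp_log ht (n + γ - 1)
  rw [← hreal n, ofReal_mul (‖t‖ ^ 2), ofReal_mul (((ρ / ‖t‖) ^ 2) ^ γ),
    ofReal_mul (‖t‖ ^ (2 * (n + γ - 1))), ← hE, ofReal_zpow, ofReal_div, ofReal_add,
    ofReal_intCast]
  simp only [map_mul, conj_conj]
  ring

/-! ### Products of chiral and antichiral constituents -/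

namespace BlockPair

variable {W : Type*} [AddCommGroup W] [Module ℂ W] {gr : ℝ × ℝ → Submodule ℂ W}
  {t : ℂ} {α β : ℝ} {v : W}

/-- The scalar blocks of the chiral constituent. -/
noncomputable def triL (P : BlockPair gr t α β v) (hgr : DirectSum.IsInternal gr) (ht : t ≠ 0)
    (c : ℝ) (f : Module.Dual ℂ W) (x : W) : TriBlock α β :=
  ChiralBlock.tri (κ := RingHom.id ℂ) hgr (oriented_id ht) P.L c f x

/-- The complex conjugates of the scalar blocks of the antichiral constituent. -/
noncomputable def triR (P : BlockPair gr t α β v) (hgr : DirectSum.IsInternal gr) (ht : t ≠ 0)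
    (c : ℝ) (f : Module.Dual ℂ W) (x : W) : TriBlock α β :=
  ChiralBlock.tri (κ := starRingEnd ℂ) hgr (oriented_conj ht) P.R c f x

/-- The space spanned by the values of the antichiral constituent on a vector. -/
noncomputable def valuesR (P : BlockPair gr t α β v) (c : ℝ) (x : W) : Submodule ℂ W :=
  ChiralBlock.values (κ := starRingEnd ℂ) P.R c x

variable (P : BlockPair gr t α β v)

theorem commute_apply {A B : Module.End ℂ W} (hA : A ∈ P.L.operators) (hB : B ∈ P.R.operators)
    (x : W) : A (B x) = B (A x) := LinearMap.congr_fun (P.comm A hA B hB).eq x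

theorem m_mem_operators {χ : Chirality} {l : ℂ} {side : Set ℂ}
    (B : ChiralBlock gr χ t l side α β v) (n : ℤ) : B.m n ∈ B.operators :=
  Or.inl (Or.inl (Or.inl (Or.inl ⟨n, rfl⟩)))

theorem m'_mem_operators {χ : Chirality} {l : ℂ} {side : Set ℂ}
    (B : ChiralBlock gr χ t l side α β v) (n : ℤ) : B.m' n ∈ B.operators :=
  Or.inl (Or.inl (Or.inl (Or.inr ⟨n, rfl⟩)))

theorem Y_mem_operators {χ : Chirality} {l : ℂ} {side : Set ℂ}
    (B : ChiralBlock gr χ t l side α β v) (c : ℝ) : B.Y v c ∈ B.operators :=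
  Or.inl (Or.inr ⟨c, rfl⟩)

/-- Commutation is given for modes and components of the fields, not for the values of the 4-point
function. The zero mode conditions are therefore moved past antichiral modes first, and reach the
values because these are combinations of such vectors. -/
theorem noZeroModes_vec0 {w : W} (hw : P.L.NoZeroModes w) (c : ℝ) (n : ℤ) :
    P.L.NoZeroModes (P.R.vec0 c n w) := by
  refine ⟨fun k hk => ?_, hw.2.1, fun k hk a => ?_⟩
  · change P.L.m k (P.R.Y v c (P.R.m n w)) = 0
    rw [P.commute_apply (m_mem_operators _ _) (Y_mem_operators _ _),
      P.commute_apply (m_mem_operators _ _) (m_mem_operators _ _), hw.1 k hk, map_zero, map_zero]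
  · change P.L.m' k (P.L.Y v a (P.R.Y v c (P.R.m n w))) = 0
    rw [P.commute_apply (Y_mem_operators _ _) (Y_mem_operators _ _),
      P.commute_apply (Y_mem_operators _ _) (m_mem_operators _ _),
      P.commute_apply (m'_mem_operators _ _) (Y_mem_operators _ _),
      P.commute_apply (m'_mem_operators _ _) (m_mem_operators _ _), hw.2.2 k hk, map_zero, map_zero]

/-- The chiral zero modes vanish on the values of the antichiral constituent. -/
theorem noZeroModes_of_mem (hgr : DirectSum.IsInternal gr) (ht : t ≠ 0) {w : W}
    (hw : P.L.NoZeroModes w) {c : ℝ} {x : W} (hx : x ∈ P.valuesR c w) : P.L.NoZeroModes x := by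
  have hx' := ChiralBlock.values_le hgr (oriented_conj ht) P.R c w hx
  refine Submodule.span_induction (p := fun x _ => P.L.NoZeroModes x) ?_ ?_ ?_ ?_ hx'
  · rintro _ ⟨n, rfl⟩
    exact P.noZeroModes_vec0 hw c n
  · exact ⟨fun k _ => map_zero _, hw.2.1, fun k _ a => by rw [map_zero, map_zero]⟩
  · exact fun x y _ _ h1 h2 => ⟨fun k hk => by rw [map_add, h1.1 k hk, h2.1 k hk, add_zero], hw.2.1,
      fun k hk a => by rw [map_add, map_add, h1.2.2 k hk, h2.2.2 k hk, add_zero]⟩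
  · exact fun a x _ h1 => ⟨fun k hk => by rw [map_smul, h1.1 k hk, smul_zero], hw.2.1,
      fun k hk b => by rw [map_smul, map_smul, h1.2.2 k hk, smul_zero]⟩

/-- Commuting chiral past antichiral operators puts the term into the form "chiral coefficient
applied to antichiral coefficient", which the basis expansion can split. The same reordering is used
for the inner term; for the field term it is built into `Y_desc`. -/
theorem outerTerm_eq (R : ℝ) (c : ℝ × ℝ) (f : Module.Dual ℂ W) (w : W) (n : ℤ) :
    P.outerTerm R c f w n = ((R ^ (2 * (n + (α + β))) : ℝ) : ℂ) *
      (((Real.pi / (n + (α + β)) : ℝ) : ℂ) * f (P.L.vecI c.1 n (P.R.vecI c.2 n w))) := by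
  rw [outerTerm, φ', P.Y_v, add_assoc, LinearMap.smul_apply, map_smul, smul_eq_mul]
  congr 3
  change P.L.m' n (P.R.m' n (P.L.Y v _ (P.R.Y v _ w))) =
    P.L.m' n (P.L.Y v _ (P.R.m' n (P.R.Y v _ w)))
  rw [P.commute_apply (Y_mem_operators _ _) (m'_mem_operators _ _), add_assoc]

theorem fieldTerm_eq (s : ℝ) (c : ℝ × ℝ) (f : Module.Dual ℂ W) (w : W) (n : ℤ) :
    P.fieldTerm s c f w n = ((s ^ (2 * (n + α)) : ℝ) : ℂ) *
      (((Real.pi / (n + α) : ℝ) : ℂ) * f (P.L.vec1 c.1 n (P.R.vec1 c.2 n w))) := by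
  rw [fieldTerm, φ'', LinearMap.smul_apply, map_smul, Pi.smul_apply, LinearMap.smul_apply, map_smul,
    smul_eq_mul, Module.End.mul_apply, P.Y_desc]
  rfl

theorem innerTerm_eq (r : ℝ) (c : ℝ × ℝ) (f : Module.Dual ℂ W) (w : W) (n : ℤ) :
    P.innerTerm r c f w n = ((r ^ (2 * (n + β)) : ℝ) : ℂ) *
      (((Real.pi / (n + β) : ℝ) : ℂ) * f (P.L.vec0 c.1 n (P.R.vec0 c.2 n w))) := by
  rw [innerTerm, φ, P.Y_v, LinearMap.smul_apply, map_smul, map_smul, smul_eq_mul]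
  congr 3
  change P.L.Y v _ (P.R.Y v _ (P.L.m n (P.R.m n w))) =
    P.L.Y v _ (P.L.m n (P.R.Y v _ (P.R.m n w)))
  rw [P.commute_apply (m_mem_operators _ _) (Y_mem_operators _ _)]

/-- The integral over the worldsheet of a summand of the 4-point function. -/
theorem integral_fourPoint (hgr : DirectSum.IsInternal gr) (ht : t ≠ 0) {r s R : ℝ} (hr : 0 < r)
    (hs : 0 < s) (hrs : r + s < ‖t‖) (hR : ‖t‖ + s < R) {w : W} (hw : P.NoZeroModes w)
    {C D Ct Dt : ℝ → Module.End ℂ W}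
    (hC : ∀ c x f, f (C c x) = t * (P.triL hgr ht c f x).C)
    (hD : ∀ c x f, f (D c x) = t * (P.triL hgr ht c f x).D)
    (hCt : ∀ c x, Ct c x ∈ P.valuesR c x ∧ ∀ f, f (Ct c x) = conj (t * (P.triR hgr ht c f x).C))
    (hDt : ∀ c x, Dt c x ∈ P.valuesR c x ∧ ∀ f, f (Dt c x) = conj (t * (P.triR hgr ht c f x).D))
    (c : ℝ × ℝ) (f : Module.Dual ℂ W) :
    IntegrableOn (P.fourPoint c f w) (worldsheet t r s R) ∧
    Summable (P.outerTerm R c f w) ∧ Summable (P.fieldTerm s c f w) ∧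
    Summable (P.innerTerm r c f w) ∧
    ∫ z in worldsheet t r s R, P.fourPoint c f w z = P.localPart r s R c f w +
      I / 2 * (f (C c.1 (Ct c.2 w)) * (-1 + exp (-2 * Real.pi * I * α)) +
        f (D c.1 (Dt c.2 w)) * (1 - exp (2 * Real.pi * I * β))) ∧
    (((∃ n : ℤ, α = n) ∨ (∃ n : ℤ, β = n) ∨ ∃ n : ℤ, α + β = n) →
      ∫ z in worldsheet t r s R, P.fourPoint c f w z = P.localPart r s R c f w) := by
  have : FiniteDimensional ℂ (P.valuesR c.2 w) :=
    ChiralBlock.finiteDimensional_values (κ := starRingEnd ℂ) hgr P.R c.2 w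
  -- The basis of the space of antichiral values decouples the chiralities: each matrix element
  -- becomes a finite sum over i of a chiral element on e i and an antichiral element against g i.
  obtain ⟨d, e, g, he, hg⟩ := exists_dual_family (P.valuesR c.2 w)
  have hn : 0 < ‖t‖ := norm_pos_iff.2 ht
  set A := fun i => P.triL hgr ht c.1 f (e i) with hA
  set B := fun i => P.triR hgr ht c.2 (g i) w with hB
  have hA0 : ∀ i, (A i).NoZero := fun i => ChiralBlock.noZero_tri (κ := RingHom.id ℂ) hgr
    (oriented_id ht) P.L (P.noZeroModes_of_mem hgr ht hw.1 (he i)) c.1 f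
  have hB0 : ∀ i, (B i).NoZero := fun i => ChiralBlock.noZero_tri (κ := starRingEnd ℂ) hgr
    (oriented_conj ht) P.R hw.2 c.2 (g i)
  have expand : ∀ (L : W →ₗ[ℂ] W) (x : W), x ∈ P.valuesR c.2 w →
      f (L x) = ∑ i, f (L (e i)) * g i x := fun L x hx => by
    conv_lhs => rw [hg x hx]
    simp [mul_comm]
  have hvec := ChiralBlock.vec_mem_values hgr (oriented_conj ht) P.R c.2 w
  have main := fun i => TriBlock.integral_worldsheet (A i) (B i) (div_pos hr hn) (div_pos hs hn)
    (by rw [← add_div, div_lt_one hn]; exact hrs)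
    (show 1 + s / ‖t‖ < R / ‖t‖ by rw [one_add_div hn.ne']; gcongr) (hA0 i) (hB0 i)
  have hR0 : 0 < R := by linarith
  -- The two factors e^((α+β) log t) in the scalar blocks multiply to ‖t‖^(2(α+β)), which is what
  -- scaling the real powers in `fourPoint` produces.
  have hpt : ∀ y ∈ worldsheet 1 (r / ‖t‖) (s / ‖t‖) (R / ‖t‖),
      P.fourPoint c f w (t * y) = ∑ i, (A i).A y * conj ((B i).A y) := by
    intro y hy
    have hy0 : y ≠ 0 := norm_pos_iff.1 ((div_pos hr hn).trans hy.1)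
    have hy1 : y ≠ 1 := sub_ne_zero.1 (norm_pos_iff.1 ((div_pos hs hn).trans hy.2.2))
    have hmem := ChiralBlock.Z_mem_values P.R c.2 w (oriented_conj ht) hy0 hy1
    have e1 : t * y - t = t * (y - 1) := by ring
    have hE := exp_mul_conj_exp_log ht (α + β)
    rw [fourPoint, expand _ _ hmem, Finset.mul_sum, e1, norm_mul, norm_mul,
      Real.mul_rpow hn.le (norm_nonneg _), Real.mul_rpow hn.le (norm_nonneg _)]
    refine Finset.sum_congr rfl fun i _ => ?_
    rw [TriBlock.A_mul_conj]
    change _ = _ * (f (P.L.Z c.1 (t * y) (e i)) * exp (((α + β : ℝ) : ℂ) * log t) *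
      conj (conj (g i (P.R.Z c.2 (conj (t * y)) w)) * exp (((α + β : ℝ) : ℂ) * log t)))
    simp only [map_mul, conj_conj]
    rw [mul_add, Real.rpow_add hn] at hE
    push_cast at hE ⊢
    linear_combination (-(((‖y - 1‖ ^ (2 * α) : ℝ) : ℂ) * ((‖y‖ ^ (2 * β) : ℝ) : ℂ) *
      f (P.L.Z c.1 (t * y) (e i)) * g i (P.R.Z c.2 (conj t * conj y) w))) * hE
  have hint := integral_worldsheet_scaled ht r s R hpt
    (integrable_finsetSum _ fun i _ => (main i).1)
  have hout : HasSum (P.outerTerm R c f w) (∑ i, ((‖t‖ ^ 2 : ℝ) : ℂ) *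
      localSeries (A i).cI (B i).cI (α + β) ((R / ‖t‖) ^ 2)) := by
    refine Eq.mpr (congrArg (fun f => HasSum f _) (funext fun n => ?_)) (hasSum_sum fun i _ =>
      hasSum_localSeries ht (k := fun n => f (P.L.vecI c.1 n (e i)))
        (k' := fun n => g i (P.R.vecI c.2 n w)) hR0 (A i).convI (B i).convI
        (show 1 < R / ‖t‖ by rw [one_lt_div hn]; linarith))
    rw [outerTerm_eq, expand _ _ (hvec n).2.1, Finset.mul_sum, Finset.mul_sum]
  have hfld : HasSum (P.fieldTerm s c f w) (∑ i, ((‖t‖ ^ 2 : ℝ) : ℂ) *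
      localSeries (A i).c1 (B i).c1 α ((s / ‖t‖) ^ 2)) := by
    refine Eq.mpr (congrArg (fun f => HasSum f _) (funext fun n => ?_)) (hasSum_sum fun i _ =>
      hasSum_localSeries ht (k := fun n => f (P.L.vec1 c.1 n (e i)))
        (k' := fun n => g i (P.R.vec1 c.2 n w)) hs (A i).conv1 (B i).conv1
        ⟨div_pos hs hn, by rw [div_lt_one hn]; linarith⟩)
    rw [fieldTerm_eq, expand _ _ (hvec n).2.2, Finset.mul_sum, Finset.mul_sum]
  have hinn : HasSum (P.innerTerm r c f w) (∑ i, ((‖t‖ ^ 2 : ℝ) : ℂ) *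
      localSeries (A i).c0 (B i).c0 β ((r / ‖t‖) ^ 2)) := by
    refine Eq.mpr (congrArg (fun f => HasSum f _) (funext fun n => ?_)) (hasSum_sum fun i _ =>
      hasSum_localSeries ht (k := fun n => f (P.L.vec0 c.1 n (e i)))
        (k' := fun n => g i (P.R.vec0 c.2 n w)) hr (A i).conv0 (B i).conv0
        ⟨div_pos hr hn, by rw [div_lt_one hn]; linarith⟩)
    rw [innerTerm_eq, expand _ _ (hvec n).1, Finset.mul_sum, Finset.mul_sum]
  have htt : t * conj t = ((‖t‖ ^ 2 : ℝ) : ℂ) := by rw [mul_conj, normSq_eq_norm_sq]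
  -- The scalars t and conj t carried by the constants give the Jacobian factor ‖t‖² of the
  -- integral.
  have hCC : f (C c.1 (Ct c.2 w)) = ∑ i, ((‖t‖ ^ 2 : ℝ) : ℂ) * ((A i).C * conj (B i).C) := by
    rw [expand _ _ (hCt c.2 w).1]
    refine Finset.sum_congr rfl fun i _ => ?_
    rw [hC, (hCt c.2 w).2, ← htt, map_mul]
    ring
  have hDD : f (D c.1 (Dt c.2 w)) = ∑ i, ((‖t‖ ^ 2 : ℝ) : ℂ) * ((A i).D * conj (B i).D) := by
    rw [expand _ _ (hDt c.2 w).1]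
    refine Finset.sum_congr rfl fun i _ => ?_
    rw [hD, (hDt c.2 w).2, ← htt, map_mul]
    ring
  have hval : ∫ z in worldsheet t r s R, P.fourPoint c f w z = P.localPart r s R c f w +
      ∑ i, ((‖t‖ ^ 2 : ℝ) : ℂ) * (I / 2 * ((A i).C * conj (B i).C *
        (-1 + exp (-2 * Real.pi * I * α)) +
        (A i).D * conj (B i).D * (1 - exp (2 * Real.pi * I * β)))) := by
    rw [hint.2, integral_finsetSum _ fun i _ => (main i).1, localPart, hout.tsum_eq, hfld.tsum_eq,
      hinn.tsum_eq, Finset.mul_sum, ← Finset.sum_sub_distrib, ← Finset.sum_sub_distrib,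
      ← Finset.sum_add_distrib]
    refine Finset.sum_congr rfl fun i _ => ?_
    rw [(main i).2]
    ring
  refine ⟨hint.1, hout.summable, hfld.summable, hinn.summable, ?_, fun h => ?_⟩
  · rw [hval, hCC, hDD, Finset.sum_mul, Finset.sum_mul, ← Finset.sum_add_distrib, Finset.mul_sum]
    congr 1
    refine Finset.sum_congr rfl fun i _ => ?_
    ring
  · rw [hval, Finset.sum_eq_zero, add_zero]
    intro i _
    rw [TriBlock.constants_eq_zero _ _ (hA0 i) (hB0 i) h, mul_zero, mul_zero]

end BlockPair

/-! ### Comparison with the field theory and the theorem -/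

namespace BlockPair

variable {W : Type*} [AddCommGroup W] [Module ℂ W] {gr : ℝ × ℝ → Submodule ℂ W}
  {t : ℂ} {α β : ℝ} {v : W}

theorem isOfWeight_comp_φ' (P : BlockPair gr t α β v) (n : ℤ) {c : ℝ × ℝ} {f : Module.Dual ℂ W}
    (hf : IsOfWeight gr c f) :
    IsOfWeight gr (c.1 - (n + α + β), c.2 - (n + α + β)) (f ∘ₗ P.φ' n) := by
  intro k hk x hx
  have h1 := P.L.m'_mem _ n _ (P.R.m'_mem k n x hx)
  rw [LinearMap.comp_apply, φ', LinearMap.smul_apply, map_smul]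
  refine (congrArg _ (hf _ (fun h => hk ?_) _ h1)).trans (smul_zero _)
  have e1 : k.1 + (n + α + β) = c.1 := congrArg Prod.fst h
  have e2 : k.2 + (n + α + β) = c.2 := congrArg Prod.snd h
  exact Prod.ext (by rw [← e1]; simp) (by rw [← e2]; simp)

end BlockPair

/-- Agreement of the vertex operators is applied term by term. In the outer term the operator φ'
acts last and is absorbed into the functional, which then has a shifted weight. -/
theorem VertexCFT.localPart_eq {V W : Type*} [AddCommGroup V] [Module ℂ V] [AddCommGroup W]
    [Module ℂ W] (X : VertexCFT V W) {t : ℂ} {α β : ℝ} {v w : V}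
    (P : BlockPair X.grW t α β (X.emb v)) (r s R : ℝ) {c : ℝ × ℝ} {f : Module.Dual ℂ W}
    (hf : IsOfWeight X.grW c f) {a b : ℤ → V} (ha : ∀ n, X.emb (a n) = P.φ'' n (X.emb v))
    (hb : ∀ n, X.emb (b n) = P.φ n (X.emb w)) (h : X.AgreesOn P v w)
    (h' : ∀ n, X.AgreesOn P (a n) w) (h'' : ∀ n, X.AgreesOn P v (b n)) :
    P.localPart r s R c f (X.emb w) = X.localPart P r s R f v w a b := by
  have outer : ∀ n, P.outerTerm R c f (X.emb w) n = ((R ^ (2 * (n + α + β)) : ℝ) : ℂ) *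
      matrixElement X.mode ((f ∘ₗ P.φ' n) ∘ₗ X.emb) v w t := fun n =>
    congrArg _ (h _ _ (P.isOfWeight_comp_φ' n hf))
  have field : ∀ n, P.fieldTerm s c f (X.emb w) n = _ := fun n => by
    rw [BlockPair.fieldTerm, ← ha, h' n c f hf]
  have inner : ∀ n, P.innerTerm r c f (X.emb w) n = _ := fun n => by
    rw [BlockPair.innerTerm, ← hb, h'' n c f hf]
  rw [BlockPair.localPart, VertexCFT.localPart, tsum_congr outer, tsum_congr field,
    tsum_congr inner]

open Classical in
theorem mainTheorem1 {V W : Type*} [AddCommGroup V] [Module ℂ V] [AddCommGroup W] [Module ℂ W]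
    (X : VertexCFT V W) (u v w : V) (hu : X.IsPrimary (1, 1) u)
    (t : ℂ) (r s R : ℝ) (hr : 0 < r) (hs : 0 < s) (hrs : r + s < ‖t‖) (hR : ‖t‖ + s < R)
    {J : Type*} [Fintype J] (lab : J → ℝ × ℝ)
    (P : ∀ j, BlockPair X.grW t (lab j).1 (lab j).2 (X.emb v))
    (hZ : ∀ (c : ℝ × ℝ) (f : Module.Dual ℂ W), IsOfWeight X.grW c f → ∀ z, z ≠ 0 → z ≠ t →
      X.corr (f ∘ₗ X.emb) u v w z t = ∑ j, (P j).fourPoint c f (X.emb w) z)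
    (h0 : ∀ j, (P j).NoZeroModes (X.emb w)) :
    (∀ (c : ℝ × ℝ) (f : Module.Dual ℂ W), IsOfWeight X.grW c f →
      (∀ p, IntegrableOn (labelFourPoint lab P p c f (X.emb w)) (worldsheet t r s R)) ∧
      X.deformed u v t r s R (f ∘ₗ X.emb) w =
        TrivSqZeroExt.inl (matrixElement X.mode (f ∘ₗ X.emb) v w t) +
        TrivSqZeroExt.inr (∑ p ∈ Finset.univ.image lab,
          ∫ z in worldsheet t r s R, labelFourPoint lab P p c f (X.emb w) z)) ∧
    (∀ (c : ℝ × ℝ) (f : Module.Dual ℂ W), IsOfWeight X.grW c f → ∀ j,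
      Summable ((P j).outerTerm R c f (X.emb w)) ∧
      Summable ((P j).fieldTerm s c f (X.emb w)) ∧
      Summable ((P j).innerTerm r c f (X.emb w))) ∧
    (∀ (c : ℝ × ℝ) (f : Module.Dual ℂ W), IsOfWeight X.grW c f → ∀ (j : J) (a b : ℤ → V),
      (∀ n, X.emb (a n) = (P j).φ'' n (X.emb v)) → (∀ n, X.emb (b n) = (P j).φ n (X.emb w)) →
      X.AgreesOn (P j) v w → (∀ n, X.AgreesOn (P j) (a n) w) →
      (∀ n, X.AgreesOn (P j) v (b n)) →
      (P j).localPart r s R c f (X.emb w) = X.localPart (P j) r s R f v w a b) ∧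
    ∃ C D Ct Dt : J → ℝ → Module.End ℂ W,
      (∀ j, (P j).L.IsDiscrepancy (C j) (D j) ∧ (P j).R.IsDiscrepancy (Ct j) (Dt j)) ∧
      (∀ (α β : ℝ) (c : ℝ × ℝ) (f : Module.Dual ℂ W), IsOfWeight X.grW c f →
        ∫ z in worldsheet t r s R, labelFourPoint lab P (α, β) c f (X.emb w) z =
          ∑ j with lab j = (α, β), ((P j).localPart r s R c f (X.emb w) +
            Complex.I / 2 *
              (f (C j c.1 (Ct j c.2 (X.emb w))) *
                  (-1 + Complex.exp (-2 * Real.pi * Complex.I * α)) +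
                f (D j c.1 (Dt j c.2 (X.emb w))) *
                  (1 - Complex.exp (2 * Real.pi * Complex.I * β))))) ∧
      (∀ j, (∃ n : ℤ, (lab j).1 = n) → (¬ ∃ n : ℤ, (lab j).2 = n) → ∀ c x,
        ((P j).L.NoZeroModes x → D j c x = 0) ∧ ((P j).R.NoZeroModes x → Dt j c x = 0)) ∧
      (∀ j, (∃ n : ℤ, (lab j).2 = n) → (¬ ∃ n : ℤ, (lab j).1 = n) → ∀ c x,
        ((P j).L.NoZeroModes x → C j c x = 0) ∧ ((P j).R.NoZeroModes x → Ct j c x = 0)) ∧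
      (∀ α β : ℝ, ((∃ n : ℤ, α = n) ∨ (∃ n : ℤ, β = n) ∨ ∃ n : ℤ, α + β = n) →
        ∀ (c : ℝ × ℝ) (f : Module.Dual ℂ W), IsOfWeight X.grW c f →
        ∫ z in worldsheet t r s R, labelFourPoint lab P (α, β) c f (X.emb w) z =
          ∑ j with lab j = (α, β), (P j).localPart r s R c f (X.emb w)) := by
  have hgr := X.grW_internal
  have ht : t ≠ 0 := norm_pos_iff.1 (by linarith)
  choose C D hC hD using fun j =>
    ChiralBlock.exists_constants (κ := RingHom.id ℂ) hgr (oriented_id ht) (P j).L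
  choose Ct Dt hCt hDt using fun j =>
    ChiralBlock.exists_constants (κ := starRingEnd ℂ) hgr (oriented_conj ht) (P j).R
  have key := fun j => (P j).integral_fourPoint hgr ht hr hs hrs hR (h0 j)
    (fun c x => (hC j c x).2) (fun c x => (hD j c x).2) (hCt j) (hDt j)
  have hlabel : ∀ p c f, ∫ z in worldsheet t r s R, labelFourPoint lab P p c f (X.emb w) z =
      ∑ j with lab j = p, ∫ z in worldsheet t r s R, (P j).fourPoint c f (X.emb w) z :=
    fun p c f => integral_finsetSum _ fun j _ => (key j c f).1
  have hzero : ∀ {y : W}, (∀ f : Module.Dual ℂ W, f y = 0) → y = 0 :=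
    fun h => (Module.forall_dual_apply_eq_zero_iff ℂ _).1 h
  refine ⟨fun c f hf => ⟨fun p => integrable_finsetSum _ fun j _ => (key j c f).1, ?_⟩,
    fun c f _ j => ⟨(key j c f).2.1, (key j c f).2.2.1, (key j c f).2.2.2.1⟩,
    fun c f hf j a b ha hb h h' h'' => X.localPart_eq (P j) r s R hf ha hb h h' h'',
    C, D, Ct, Dt, fun j => ⟨?_, ?_⟩, fun α β c f _ => ?_, fun j hα hβ c x => ⟨fun hx => ?_,
      fun hx => ?_⟩, fun j hβ hα c x => ⟨fun hx => ?_, fun hx => ?_⟩, fun α β h c f _ => ?_⟩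
  · rw [VertexCFT.deformed]
    congr 2
    have hcorr : ∫ z in worldsheet t r s R, X.corr (f ∘ₗ X.emb) u v w z t =
        ∫ z in worldsheet t r s R, ∑ j, (P j).fourPoint c f (X.emb w) z :=
      setIntegral_congr_fun (TriBlock.measurableSet_worldsheet t r s R) fun z hz =>
        hZ c f hf z (norm_pos_iff.1 (hr.trans hz.1))
          (sub_ne_zero.1 (norm_pos_iff.1 (hs.trans hz.2.2)))
    rw [hcorr, integral_finsetSum _ fun j _ => (key j c f).1]
    simp only [hlabel]
    -- Summation over all summands is regrouped by label.
    exact (Finset.sum_fiberwise_of_maps_to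
      (fun j _ => Finset.mem_image_of_mem lab (Finset.mem_univ j)) _).symm
  · exact ChiralBlock.isDiscrepancy (κ := RingHom.id ℂ) hgr (oriented_id ht) (P j).L
      (fun c x => (hC j c x).2) (fun c x => (hD j c x).2)
  · exact ChiralBlock.isDiscrepancy (κ := starRingEnd ℂ) hgr (oriented_conj ht) (P j).R
      (fun c x => (hCt j c x).2) (fun c x => (hDt j c x).2)
  · rw [hlabel]
    refine Finset.sum_congr rfl fun j hj => ?_
    have hj' := (Finset.mem_filter.1 hj).2
    have h1 : (lab j).1 = α := congrArg Prod.fst hj'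
    have h2 : (lab j).2 = β := congrArg Prod.snd hj'
    rw [(key j c f).2.2.2.2.1, ← h1, ← h2]
  · refine hzero fun f => ?_
    rw [(hD j c x).2, TriBlock.D_eq_zero _ (ChiralBlock.noZero_tri hgr _ _ hx c f) hα hβ, mul_zero,
      map_zero]
  · refine hzero fun f => ?_
    rw [(hDt j c x).2, TriBlock.D_eq_zero _ (ChiralBlock.noZero_tri hgr _ _ hx c f) hα hβ, mul_zero,
      map_zero]
  · refine hzero fun f => ?_
    rw [(hC j c x).2, TriBlock.C_eq_zero _ (ChiralBlock.noZero_tri hgr _ _ hx c f) hα hβ, mul_zero,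
      map_zero]
  · refine hzero fun f => ?_
    rw [(hCt j c x).2, TriBlock.C_eq_zero _ (ChiralBlock.noZero_tri hgr _ _ hx c f) hα hβ, mul_zero,
      map_zero]
  · rw [hlabel]
    refine Finset.sum_congr rfl fun j hj => ?_
    have hj' := (Finset.mem_filter.1 hj).2
    refine (key j c f).2.2.2.2.2 ?_
    rwa [hj']
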